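/- Let $R$ be a unital ring. Let $\langle t\rangle$ be the infinite cyclic group, with $t$ acting on $\mathbb R$ by $x\mapsto x+1$, and let $D_\infty=\langle r,s\mid s^2=1,\ rs=sr^{-1}\rangle$ be the infinite dihedral group, with $r$ acting on $\mathbb R$ by $x\mapsto x+1$ and $s$ by $x\mapsto -x$. Let $D_\infty$ act on $\mathbb Z/2=D_\infty/\langle r\rangle$ ($r$ trivially, $s$ by interchanging the two elements) and diagonally on $\overline{\mathbb R}:=\mathbb Z/2\times\mathbb R$. For a group $G$, a $G$-space $X$ and a $G$-map $p:\overline X\to X$ define the obstruction category $\mathcal O^G(\overline X)$ as follows; $G$ acts trivially on $[1,\infty]$ and diagonally on products. *Objects* are families $A=(A_z)_{z\in \overline X\times[1,\infty)}$ of finitely generated free $R$-modules such that the support $\{z: A_z\ne 0\}$ is locally finite in $\overline X\times[1,\infty)$ (every point has a neighbourhood meeting it in a finite set) and is contained in $GK\times[1,\infty)$ for some compact $K\subseteq\overline X$, and such that $A_{gz}=A_z$ for all $g\in G$ and all $z$. *Morphisms* $\varphi:A\to B$ are families of $R$-linear maps $\varphi_z^w:A_z\to B_w$ such that, for every $z$,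 only finitely many $\varphi_z^w$ and only finitely many $\varphi_w^z$ are nonzero; $\varphi_{gz}^{gw}=\varphi_z^w$ for all $g\in G$; and $\{((p(x),t),(p(y),s)):\varphi_{(x,t)}^{(y,s)}\neq0\}$ is contained in some $E\subseteq (X\times[1,\infty))^2$ with the following properties: 1. for every $x\in X$ and every $G_x$-invariant open neighbourhood $U$ of $(x,\infty)$ in $X\times[1,\infty]$ there is a $G_x$-invariant open neighbourhood $V\subseteq U$ of $(x,\infty)$ such that $E$ contains no pair $(a,b)$ with $a\notin U$ and $b\in V$; 2. there is $\delta<\infty$ such that $|t-s|\le\delta$ for all $((x,t),(y,s))\in E$; 3. $E$ is symmetric and invariant under the diagonal action of $G$. Composition is matrix multiplication. When $X$ is a metric space with $G$-invariant metric $d$ (here $X=\mathbb R$), the horizontal size of $\varphi$ is $\mathrm{hsize}(\varphi)=\sup\{d(p(x),p(y)):\varphi_{(x,t)}^{(y,s)}\ne0\}\in[0,\infty]$ (and $0$ if $\varphi=0$), and an automorphism $\alpha$ is an *$\varepsilon$-automorphism* if $\mathrm{hsize}(\alpha)<\varepsilon$ and $\mathrm{hsize}(\alpha^{-1})<\varepsilon$.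 For an additive category $\mathcal C$, $K_1(\mathcal C)$ is the abelian group generated by the classes $[A,\alpha]$ of automorphisms $\alpha:A\to A$ in $\mathcal C$, subject to $[A,\alpha\beta]=[A,\alpha]+[A,\beta]$ and to $[A_2,\alpha_2]=[A_1,\alpha_1]+[A_3,\alpha_3]$ for every automorphism $(\alpha_1,\alpha_2,\alpha_3)$ of a split short exact sequence $A_1\to A_2\to A_3$. **Theorem 4.5.** Let $\alpha:A\to A$ be a $\frac1{30}$-automorphism in $\widetilde{\mathcal O}^{\langle t\rangle}(\mathbb R)$, the obstruction category of $\langle t\rangle$ for $p=\mathrm{id}:\mathbb R\to\mathbb R$, or in $\mathcal O^{D_\infty}(\overline{\mathbb R})$, the obstruction category of $D_\infty$ for the projection $p:\overline{\mathbb R}=\mathbb Z/2\times\mathbb R\to\mathbb R$. Then the class $[A,\alpha]$ is zero in $K_1$ of that category. -/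

import Mathlib

open CategoryTheory Topology
open scoped ENNReal

noncomputable section

universe u v w

/-! ### `K₁` of an additive category -/

namespace AddK1

variable (C : Type v) [Category.{w} C] [Preadditive C]

/-- The free abelian group on all automorphisms `(A, α)` of objects of `C`. -/
abbrev Gen : Type (max v w) := FreeAbelianGroup (Σ A : C, Aut A)

/-- The defining relations of Bass' `K₁` of an additive category with its split exact sequences:
`[A, α ∘ β] = [A, α] + [A, β]`, and `[A₂, α₂] = [A₁, α₁] + [A₃, α₃]` for every automorphism
`(α₁, α₂, α₃)` of a split short exact sequence `A₁ ⟶ A₂ ⟶ A₃`. -/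
def relations : Set (Gen C) :=
  {z | ∃ (A : C) (α β : Aut A),
      z = FreeAbelianGroup.of ⟨A, α ≪≫ β⟩
        - (FreeAbelianGroup.of ⟨A, α⟩ + FreeAbelianGroup.of ⟨A, β⟩)} ∪
  {z | ∃ (S : ShortComplex C) (_ : Nonempty S.Splitting) (φ : Aut S),
      z = FreeAbelianGroup.of ⟨S.X₂, ShortComplex.π₂.mapIso φ⟩
        - (FreeAbelianGroup.of ⟨S.X₁, ShortComplex.π₁.mapIso φ⟩
          + FreeAbelianGroup.of ⟨S.X₃, ShortComplex.π₃.mapIso φ⟩)}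

end AddK1

/-- `K₁` of an additive category. -/
abbrev AddK1 (C : Type v) [Category.{w} C] [Preadditive C] : Type (max v w) :=
  AddK1.Gen C ⧸ AddSubgroup.closure (AddK1.relations C)

/-- The class `[A, α]` in `K₁` of an automorphism `α` of `A`. -/
def AddK1.mk {C : Type v} [Category.{w} C] [Preadditive C] {A : C} (α : Aut A) : AddK1 C :=
  QuotientAddGroup.mk (FreeAbelianGroup.of ⟨A, α⟩)

/-! ### Geometric modules -/

/-- A geometric `R`-module over a space `Y`: a family of finitely generated free `R`-modules
whose support is locally finite in `Y`. -/
structure GeomModule (R : Type u) [Ring R] (Y : Type v) [TopologicalSpace Y] where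
  mod : Y → ModuleCat.{u} R
  free : ∀ y, Module.Free R (mod y)
  finite : ∀ y, Module.Finite R (mod y)
  locallyFinite : ∀ y, ∃ U ∈ 𝓝 y, (U ∩ {z | Nontrivial (mod z)}).Finite

namespace GeomModule

variable {R : Type u} [Ring R] {Y : Type v} [TopologicalSpace Y]

/-- The support of a geometric module. -/
def supp (A : GeomModule R Y) : Set Y := {y | Nontrivial (A.mod y)}

/-- A morphism of geometric modules: a row- and column-finite matrix of homomorphisms;
`φ.app x y : A_x ⟶ B_y` is the component `φ_x^y`. -/
@[ext]
structure Hom (A B : GeomModule R Y) where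
  app : ∀ x y, A.mod x ⟶ B.mod y
  finite_right : ∀ x, {y | app x y ≠ 0}.Finite
  finite_left : ∀ y, {x | app x y ≠ 0}.Finite

namespace Hom

variable {A B C D : GeomModule R Y}

/-- The support of a morphism. -/
def supp (φ : Hom A B) : Set (Y × Y) := {z | φ.app z.1 z.2 ≠ 0}

instance : Zero (Hom A B) :=
  ⟨{ app := fun _ _ => 0
     finite_right := fun _ => by simp
     finite_left := fun _ => by simp }⟩

instance : Neg (Hom A B) :=
  ⟨fun φ =>
   { app := fun x y => -φ.app x y
     finite_right := fun x => by simpa using φ.finite_right x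
     finite_left := fun y => by simpa using φ.finite_left y }⟩

instance : Add (Hom A B) :=
  ⟨fun φ ψ =>
   { app := fun x y => φ.app x y + ψ.app x y
     finite_right := fun x => ((φ.finite_right x).union (ψ.finite_right x)).subset (by
       intro y hy
       by_contra h
       simp only [Set.mem_union, Set.mem_ofPred_eq, not_or, not_not] at h
       exact hy (by rw [h.1, h.2, add_zero]))
     finite_left := fun y => ((φ.finite_left y).union (ψ.finite_left y)).subset (by
       intro x hx
       by_contra h
       simp only [Set.mem_union, Set.mem_ofPred_eq, not_or, not_not] at h
       exact hx (by rw [h.1, h.2, add_zero])) }⟩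

@[simp] theorem zero_app (x y : Y) : (0 : Hom A B).app x y = 0 := rfl
@[simp] theorem neg_app (φ : Hom A B) (x y : Y) : (-φ).app x y = -φ.app x y := rfl
@[simp] theorem add_app (φ ψ : Hom A B) (x y : Y) :
    (φ + ψ).app x y = φ.app x y + ψ.app x y := rfl

instance : AddCommGroup (Hom A B) :=
  { AddGroup.ofLeftAxioms (G := Hom A B)
      (fun _ _ _ => by ext1; funext x y; simp [add_assoc])
      (fun _ => by ext1; funext x y; simp)
      (fun _ => by ext1; funext x y; simp) with
    add_comm := fun _ _ => by ext1; funext x y; simp [add_comm] }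

open Classical in
/-- The identity matrix. -/
def id (A : GeomModule R Y) : Hom A A where
  app x y := if h : x = y then eqToHom (by rw [h]) else 0
  finite_right x := (Set.finite_singleton x).subset (by
    intro y hy
    by_contra h
    exact hy (dif_neg fun e => h e.symm))
  finite_left y := (Set.finite_singleton y).subset (by
    intro x hx
    by_contra h
    exact hx (dif_neg h))

theorem id_app_self (x : Y) : (id A).app x x = 𝟙 _ := by simp [id]

theorem id_app_ne {x y : Y} (h : x ≠ y) : (id A).app x y = 0 := by simp [id, h]

theorem exists_ne_zero_of_sum_ne_zero {ι M : Type*} [AddCommMonoid M] {f : ι → M}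
    (h : ∑ᶠ i, f i ≠ 0) : ∃ i, f i ≠ 0 := by
  by_contra! h'
  exact h (by simp [h'])

/-- Matrix multiplication: `(ψ ∘ φ)_x^z = ∑_y ψ_y^z ∘ φ_x^y` (a finite sum). -/
def comp (φ : Hom A B) (ψ : Hom B C) : Hom A C where
  app x z := ∑ᶠ y, φ.app x y ≫ ψ.app y z
  finite_right x :=
    ((φ.finite_right x).biUnion fun y _ => ψ.finite_right y).subset (by
      intro z hz
      obtain ⟨y, hy⟩ := exists_ne_zero_of_sum_ne_zero hz
      simp only [Set.mem_iUnion, Set.mem_ofPred_eq, exists_prop]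
      exact ⟨y, fun h => hy (by rw [h, Limits.zero_comp]),
        fun h => hy (by rw [h, Limits.comp_zero])⟩)
  finite_left z :=
    ((ψ.finite_left z).biUnion fun y _ => φ.finite_left y).subset (by
      intro x hx
      obtain ⟨y, hy⟩ := exists_ne_zero_of_sum_ne_zero hx
      simp only [Set.mem_iUnion, Set.mem_ofPred_eq, exists_prop]
      exact ⟨y, fun h => hy (by rw [h, Limits.comp_zero]),
        fun h => hy (by rw [h, Limits.zero_comp])⟩)

theorem comp_app (φ : Hom A B) (ψ : Hom B C) (x z : Y) :
    (comp φ ψ).app x z = ∑ᶠ y, φ.app x y ≫ ψ.app y z := rfl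

theorem comp_app_of_left (φ : Hom A B) (ψ : Hom B C) (x z : Y) (s : Finset Y)
    (hs : ∀ y, φ.app x y ≠ 0 → y ∈ s) :
    (comp φ ψ).app x z = ∑ y ∈ s, φ.app x y ≫ ψ.app y z := by
  refine finsum_eq_sum_of_support_subset _ fun y hy => hs y fun h => hy ?_
  simp only [h, Limits.zero_comp]

theorem comp_app_of_right (φ : Hom A B) (ψ : Hom B C) (x z : Y) (s : Finset Y)
    (hs : ∀ y, ψ.app y z ≠ 0 → y ∈ s) :
    (comp φ ψ).app x z = ∑ y ∈ s, φ.app x y ≫ ψ.app y z := by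
  refine finsum_eq_sum_of_support_subset _ fun y hy => hs y fun h => hy ?_
  simp only [h, Limits.comp_zero]

theorem exists_of_comp_app_ne_zero {φ : Hom A B} {ψ : Hom B C} {x z : Y}
    (h : (comp φ ψ).app x z ≠ 0) : ∃ y, φ.app x y ≠ 0 ∧ ψ.app y z ≠ 0 := by
  obtain ⟨y, hy⟩ := exists_ne_zero_of_sum_ne_zero h
  exact ⟨y, fun h => hy (by rw [h, Limits.zero_comp]), fun h => hy (by rw [h, Limits.comp_zero])⟩

theorem id_comp (φ : Hom A B) : comp (id A) φ = φ := by
  ext1; funext x z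
  rw [comp_app_of_left _ _ _ _ {x} (fun y hy => by
    by_contra h
    exact hy (id_app_ne fun e => h (by simp [e])))]
  simp [id_app_self]

theorem comp_id (φ : Hom A B) : comp φ (id B) = φ := by
  ext1; funext x z
  rw [comp_app_of_right _ _ _ _ {z} (fun y hy => by
    by_contra h
    exact hy (id_app_ne fun e => h (by simp [e])))]
  simp [id_app_self]

theorem assoc (φ : Hom A B) (ψ : Hom B C) (χ : Hom C D) :
    comp (comp φ ψ) χ = comp φ (comp ψ χ) := by
  ext1; funext x w
  have hs : ∀ y, φ.app x y ≠ 0 → y ∈ (φ.finite_right x).toFinset := fun y hy => by simpa using hy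
  have ht : ∀ z, χ.app z w ≠ 0 → z ∈ (χ.finite_left w).toFinset := fun z hz => by simpa using hz
  rw [comp_app_of_right _ _ _ _ _ ht, comp_app_of_left _ _ _ _ _ hs]
  simp only [comp_app_of_left φ ψ x _ _ hs, comp_app_of_right ψ χ _ w _ ht,
    Preadditive.sum_comp, Preadditive.comp_sum, Category.assoc]
  exact Finset.sum_comm

theorem add_comp (φ φ' : Hom A B) (ψ : Hom B C) :
    comp (φ + φ') ψ = comp φ ψ + comp φ' ψ := by
  ext1; funext x z
  have ht : ∀ y, ψ.app y z ≠ 0 → y ∈ (ψ.finite_left z).toFinset := fun z hz => by simpa using hz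
  simp only [add_app, comp_app_of_right _ ψ x z _ ht, Preadditive.add_comp,
    Finset.sum_add_distrib]

theorem comp_add (φ : Hom A B) (ψ ψ' : Hom B C) :
    comp φ (ψ + ψ') = comp φ ψ + comp φ ψ' := by
  ext1; funext x z
  have hs : ∀ y, φ.app x y ≠ 0 → y ∈ (φ.finite_right x).toFinset := fun y hy => by simpa using hy
  simp only [add_app, comp_app_of_left φ _ x z _ hs, Preadditive.comp_add,
    Finset.sum_add_distrib]

end Hom

/-- The category of geometric `R`-modules over `Y`. -/
instance : Category (GeomModule R Y) where
  Hom A B := Hom A B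
  id A := Hom.id A
  comp φ ψ := Hom.comp φ ψ
  id_comp := Hom.id_comp
  comp_id := Hom.comp_id
  assoc := Hom.assoc

instance : Preadditive (GeomModule R Y) where
  homGroup A B := inferInstanceAs (AddCommGroup (Hom A B))
  add_comp _ _ _ := Hom.add_comp
  comp_add _ _ _ := Hom.comp_add

variable (G : Type*) [Group G] [MulAction G Y]

/-- `A` is `G`-invariant: `g^* A = A`, that is, `A_{gy} = A_y`. -/
def IsInvariant (A : GeomModule R Y) : Prop := ∀ (g : G) (y : Y), A.mod (g • y) = A.mod y

variable {G}

/-- `φ` is `G`-invariant: `g^* φ = φ`, that is, `φ_{gx}^{gy} = φ_x^y`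
(under the identifications `A_{gx} = A_x` and `B_{gy} = B_y`). -/
def Hom.IsInvariant {A B : GeomModule R Y} (hA : A.IsInvariant G) (hB : B.IsInvariant G)
    (φ : Hom A B) : Prop :=
  ∀ (g : G) (x y : Y),
    φ.app (g • x) (g • y) = eqToHom (hA g x) ≫ φ.app x y ≫ eqToHom (hB g y).symm

namespace Hom

variable {A B C : GeomModule R Y} {hA : A.IsInvariant G} {hB : B.IsInvariant G}
  {hC : C.IsInvariant G}

theorem IsInvariant.zero : (0 : Hom A B).IsInvariant hA hB := fun g x y => by simp

theorem IsInvariant.neg {φ : Hom A B} (h : φ.IsInvariant hA hB) : (-φ).IsInvariant hA hB :=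
  fun g x y => by simp [h g x y]

theorem IsInvariant.add {φ ψ : Hom A B} (h : φ.IsInvariant hA hB) (h' : ψ.IsInvariant hA hB) :
    (φ + ψ).IsInvariant hA hB :=
  fun g x y => by simp [h g x y, h' g x y]

theorem IsInvariant.id : (Hom.id A).IsInvariant hA hA := fun g x y => by
  by_cases h : x = y
  · subst h
    simp [id_app_self]
  · rw [id_app_ne h, id_app_ne fun e => h (MulAction.injective g e)]
    simp

theorem IsInvariant.comp {φ : Hom A B} {ψ : Hom B C} (h : φ.IsInvariant hA hB)
    (h' : ψ.IsInvariant hB hC) : (Hom.comp φ ψ).IsInvariant hA hC := fun g x z => by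
  have hs : ∀ y, φ.app x y ≠ 0 → y ∈ (φ.finite_right x).toFinset := fun y hy => by simpa using hy
  have hs' : ∀ y, φ.app (g • x) y ≠ 0 →
      y ∈ (φ.finite_right x).toFinset.map (MulAction.toPerm g).toEmbedding := fun y hy => by
    obtain ⟨y, rfl⟩ := MulAction.surjective g y
    refine Finset.mem_map.2 ⟨y, hs y fun h0 => hy ?_, rfl⟩
    rw [h g, h0, Limits.zero_comp, Limits.comp_zero]
  rw [comp_app_of_left _ _ _ _ _ hs', comp_app_of_left _ _ _ _ _ hs, Finset.sum_map]
  simp only [Preadditive.sum_comp, Preadditive.comp_sum, Category.assoc]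
  refine Finset.sum_congr rfl fun y _ => ?_
  change φ.app (g • x) (g • y) ≫ ψ.app (g • y) (g • z) = _
  simp [h g, h' g]

end Hom

end GeomModule

/-! ### Control conditions -/

/-- The half-line `[1, ∞)`. -/
def Height : Type := Set.Ici (1 : ℝ)

/-- The compactified half-line `[1, ∞]`, as a subspace of the extended reals. -/
abbrev ExtHeight : Type := Set.Ici (1 : EReal)

namespace Height

instance : TopologicalSpace Height := inferInstanceAs (TopologicalSpace (Set.Ici (1 : ℝ)))

/-- The underlying real number. -/
def toReal (t : Height) : ℝ := t.1

/-- The inclusion `[1, ∞) ⊂ [1, ∞]`. -/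
def toExt (t : Height) : ExtHeight := ⟨(t.toReal : EReal), EReal.coe_le_coe_iff.2 t.2⟩

/-- Every group acts trivially on `[1, ∞)`; products `X × [1, ∞)` then carry the
diagonal action. -/
instance (G : Type*) [Group G] : MulAction G Height where
  smul _ t := t
  one_smul _ := rfl
  mul_smul _ _ _ := rfl

end Height

/-- The point `∞` of `[1, ∞]`. -/
def ExtHeight.top : ExtHeight := ⟨⊤, Set.mem_Ici.2 le_top⟩

section Control

variable (G : Type*) [Group G] {X : Type*} [TopologicalSpace X] [MulAction G X]

/-- The `G`-compact subsets: those of the form `G K` with `K` compact. -/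
def IsGCompact (S : Set X) : Prop :=
  ∃ K : Set X, IsCompact K ∧ S = {x | ∃ g : G, ∃ k ∈ K, x = g • k}

/-- `U ⊆ X × [1, ∞]` is an open neighbourhood of `(x, ∞)` that is invariant under the
stabilizer of `x`. -/
structure IsInvNhdAtInfty (x : X) (U : Set (X × ExtHeight)) : Prop where
  isOpen : IsOpen U
  mem : (x, ExtHeight.top) ∈ U
  invariant : ∀ g ∈ MulAction.stabilizer G x, ∀ z ∈ U, (g • z.1, z.2) ∈ U

/-- The equivariant continuous control condition: the subsets
`E ⊆ (X × [1, ∞)) × (X × [1, ∞))` that are continuously controlled at infinity, of bounded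
vertical extent, symmetric and `G`-invariant. -/
structure IsEquivContControlled (E : Set ((X × Height) × (X × Height))) : Prop where
  atInfty : ∀ (x : X) (U : Set (X × ExtHeight)), IsInvNhdAtInfty G x U →
    ∃ V ⊆ U, IsInvNhdAtInfty G x V ∧
      ∀ a b : X × Height, (a.1, a.2.toExt) ∉ U → (b.1, b.2.toExt) ∈ V → (a, b) ∉ E
  vertical : ∃ δ : ℝ, ∀ a b : X × Height, (a, b) ∈ E → |a.2.toReal - b.2.toReal| ≤ δ
  symm : ∀ a b : X × Height, (a, b) ∈ E → (b, a) ∈ E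
  invariant : ∀ (g : G) (a b : X × Height), (a, b) ∈ E → (g • a, g • b) ∈ E

variable {G}

theorem IsInvNhdAtInfty.inter {x : X} {U V : Set (X × ExtHeight)} (hU : IsInvNhdAtInfty G x U)
    (hV : IsInvNhdAtInfty G x V) : IsInvNhdAtInfty G x (U ∩ V) :=
  ⟨hU.isOpen.inter hV.isOpen, ⟨hU.mem, hV.mem⟩,
    fun g hg z hz => ⟨hU.invariant g hg z hz.1, hV.invariant g hg z hz.2⟩⟩

theorem IsEquivContControlled.diag :
    IsEquivContControlled G {e : (X × Height) × (X × Height) | e.1 = e.2} where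
  atInfty x U hU := ⟨U, subset_rfl, hU, fun a b ha hb h => ha (by
    have h : a = b := h
    rw [h]; exact hb)⟩
  vertical := ⟨0, fun a b h => by
    have h : a = b := h
    simp [h]⟩
  symm a b h := Eq.symm h
  invariant g a b h := congrArg (g • ·) h

theorem IsEquivContControlled.union {E F : Set ((X × Height) × (X × Height))}
    (hE : IsEquivContControlled G E) (hF : IsEquivContControlled G F) :
    IsEquivContControlled G (E ∪ F) where
  atInfty x U hU := by
    obtain ⟨V, hVU, hV, h⟩ := hE.atInfty x U hU
    obtain ⟨W, _, hW, h'⟩ := hF.atInfty x U hU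
    exact ⟨V ∩ W, fun z hz => hVU hz.1, hV.inter hW, fun a b ha hb hab =>
      hab.elim (h a b ha hb.1) (h' a b ha hb.2)⟩
  vertical := by
    obtain ⟨δ, h⟩ := hE.vertical
    obtain ⟨δ', h'⟩ := hF.vertical
    exact ⟨max δ δ', fun a b hab => hab.elim (fun k => (h a b k).trans (le_max_left _ _))
      (fun k => (h' a b k).trans (le_max_right _ _))⟩
  symm a b hab := hab.imp (hE.symm a b) (hF.symm a b)
  invariant g a b hab := hab.imp (hE.invariant g a b) (hF.invariant g a b)

theorem IsEquivContControlled.comp {E F : Set ((X × Height) × (X × Height))}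
    (hE : IsEquivContControlled G E) (hF : IsEquivContControlled G F) :
    IsEquivContControlled G ({e | ∃ c, (e.1, c) ∈ E ∧ (c, e.2) ∈ F} ∪
      {e | ∃ c, (e.1, c) ∈ F ∧ (c, e.2) ∈ E}) where
  atInfty x U hU := by
    obtain ⟨V, hVU, hV, h⟩ := hE.atInfty x U hU
    obtain ⟨W, hWV, hW, h'⟩ := hF.atInfty x V hV
    obtain ⟨V', _, hV', k⟩ := hF.atInfty x U hU
    obtain ⟨W', _, hW', k'⟩ := hE.atInfty x V' hV'
    refine ⟨W ∩ W', fun z hz => hVU (hWV hz.1), hW.inter hW', ?_⟩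
    rintro a b ha hb (⟨c, hac, hcb⟩ | ⟨c, hac, hcb⟩)
    · by_cases hc : (c.1, c.2.toExt) ∈ V
      · exact h a c ha hc hac
      · exact h' c b hc hb.1 hcb
    · by_cases hc : (c.1, c.2.toExt) ∈ V'
      · exact k a c ha hc hac
      · exact k' c b hc hb.2 hcb
  vertical := by
    obtain ⟨δ, h⟩ := hE.vertical
    obtain ⟨δ', h'⟩ := hF.vertical
    refine ⟨δ + δ', ?_⟩
    rintro a b (⟨c, hac, hcb⟩ | ⟨c, hac, hcb⟩)
    · exact (abs_sub_le _ c.2.toReal _).trans (add_le_add (h _ _ hac) (h' _ _ hcb))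
    · rw [add_comm]
      exact (abs_sub_le _ c.2.toReal _).trans (add_le_add (h' _ _ hac) (h _ _ hcb))
  symm := by
    rintro a b (⟨c, hac, hcb⟩ | ⟨c, hac, hcb⟩)
    · exact Or.inr ⟨c, hF.symm _ _ hcb, hE.symm _ _ hac⟩
    · exact Or.inl ⟨c, hE.symm _ _ hcb, hF.symm _ _ hac⟩
  invariant := by
    rintro g a b (⟨c, hac, hcb⟩ | ⟨c, hac, hcb⟩)
    · exact Or.inl ⟨g • c, hE.invariant g _ _ hac, hF.invariant g _ _ hcb⟩
    · exact Or.inr ⟨g • c, hF.invariant g _ _ hac, hE.invariant g _ _ hcb⟩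

end Control

/-! ### The obstruction category -/

/-- The objects of the obstruction category `𝒪^G(Xbar)` of a `G`-map `p : Xbar → X`:
`G`-invariant geometric `R`-modules over `Xbar × [1, ∞)` whose support lies over a `G`-compact
subset of `Xbar`. For `p = id` on a free `G`-space this is the category `𝒪~^G(X)`. -/
structure ObsCat (R : Type u) [Ring R] (G : Type*) [Group G] {Xbar : Type*} [TopologicalSpace Xbar]
    [MulAction G Xbar] {X : Type*} (p : Xbar → X) where
  toGeom : GeomModule R (Xbar × Height)
  invariant : toGeom.IsInvariant G
  support : ∃ S : Set Xbar, IsGCompact G S ∧ toGeom.supp ⊆ {z | z.1 ∈ S}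

namespace ObsCat

variable {R : Type u} [Ring R] {G : Type*} [Group G] {Xbar : Type*} [TopologicalSpace Xbar]
  {X : Type*} [TopologicalSpace X] [MulAction G X] {p : Xbar → X}

variable (G p) in
/-- The support of `φ` lies in `((p × id)²)⁻¹(E)` for some `E` satisfying the equivariant
continuous control condition of `X`. -/
def IsControlled {A B : GeomModule R (Xbar × Height)} (φ : GeomModule.Hom A B) : Prop :=
  ∃ E : Set ((X × Height) × (X × Height)), IsEquivContControlled G E ∧
    φ.supp ⊆ {z | ((p z.1.1, z.1.2), (p z.2.1, z.2.2)) ∈ E}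

section

variable {A B C : GeomModule R (Xbar × Height)}

theorem IsControlled.zero : IsControlled G p (0 : GeomModule.Hom A B) :=
  ⟨_, IsEquivContControlled.diag, fun _ hz => absurd rfl hz⟩

theorem IsControlled.neg {φ : GeomModule.Hom A B} (h : IsControlled G p φ) :
    IsControlled G p (-φ) := by
  obtain ⟨E, hE, h⟩ := h
  exact ⟨E, hE, fun z hz => h fun h0 => hz (by rw [GeomModule.Hom.neg_app, h0, neg_zero])⟩

theorem IsControlled.add {φ ψ : GeomModule.Hom A B} (h : IsControlled G p φ)
    (h' : IsControlled G p ψ) : IsControlled G p (φ + ψ) := by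
  obtain ⟨E, hE, h⟩ := h
  obtain ⟨F, hF, h'⟩ := h'
  refine ⟨E ∪ F, hE.union hF, fun z hz => ?_⟩
  by_cases h0 : φ.app z.1 z.2 = 0
  · exact Or.inr (h' fun h1 => hz (by rw [GeomModule.Hom.add_app, h0, h1, add_zero]))
  · exact Or.inl (h h0)

theorem IsControlled.id : IsControlled G p (GeomModule.Hom.id A) := by
  refine ⟨_, IsEquivContControlled.diag, fun z hz => ?_⟩
  have : z.1 = z.2 := by
    by_contra h
    exact hz (GeomModule.Hom.id_app_ne h)
  simp [this]

theorem IsControlled.comp {φ : GeomModule.Hom A B} {ψ : GeomModule.Hom B C}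
    (h : IsControlled G p φ) (h' : IsControlled G p ψ) :
    IsControlled G p (GeomModule.Hom.comp φ ψ) := by
  obtain ⟨E, hE, h⟩ := h
  obtain ⟨F, hF, h'⟩ := h'
  refine ⟨_, hE.comp hF, fun z hz => ?_⟩
  obtain ⟨y, h1, h2⟩ := GeomModule.Hom.exists_of_comp_app_ne_zero hz
  exact Or.inl ⟨(p y.1, y.2), h (a := (z.1, y)) h1, h' (a := (y, z.2)) h2⟩

end

variable [MulAction G Xbar]

/-- The morphisms of the obstruction category: the `G`-invariant morphisms of geometric modules
satisfying the control condition. -/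
@[ext]
structure Hom (A B : ObsCat R G p) where
  toGeom : GeomModule.Hom A.toGeom B.toGeom
  invariant : toGeom.IsInvariant A.invariant B.invariant
  controlled : IsControlled G p toGeom

namespace Hom

variable {A B : ObsCat R G p}

instance : Zero (Hom A B) := ⟨⟨0, .zero, .zero⟩⟩
instance : Neg (Hom A B) := ⟨fun φ => ⟨-φ.toGeom, φ.invariant.neg, φ.controlled.neg⟩⟩
instance : Add (Hom A B) :=
  ⟨fun φ ψ => ⟨φ.toGeom + ψ.toGeom, φ.invariant.add ψ.invariant, φ.controlled.add ψ.controlled⟩⟩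

instance : AddCommGroup (Hom A B) :=
  { AddGroup.ofLeftAxioms (G := Hom A B)
      (fun _ _ _ => Hom.ext (add_assoc _ _ _))
      (fun _ => Hom.ext (zero_add _))
      (fun _ => Hom.ext (neg_add_cancel _)) with
    add_comm := fun _ _ => Hom.ext (add_comm _ _) }

end Hom

instance : Category (ObsCat R G p) where
  Hom A B := Hom A B
  id A := ⟨.id A.toGeom, .id, .id⟩
  comp φ ψ := ⟨φ.toGeom.comp ψ.toGeom, φ.invariant.comp ψ.invariant,
    φ.controlled.comp ψ.controlled⟩
  id_comp _ := Hom.ext (GeomModule.Hom.id_comp _)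
  comp_id _ := Hom.ext (GeomModule.Hom.comp_id _)
  assoc _ _ _ := Hom.ext (GeomModule.Hom.assoc _ _ _)

instance : Preadditive (ObsCat R G p) where
  homGroup A B := inferInstanceAs (AddCommGroup (Hom A B))
  add_comp _ _ _ _ _ _ := Hom.ext (GeomModule.Hom.add_comp _ _ _)
  comp_add _ _ _ _ _ _ := Hom.ext (GeomModule.Hom.comp_add _ _ _)

end ObsCat

section Size

variable {R : Type u} [Ring R] {G : Type*} [Group G] {Xbar : Type*} [TopologicalSpace Xbar]
  [MulAction G Xbar] {X : Type*} [MetricSpace X] [MulAction G X] {p : Xbar → X}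

/-- The horizontal size of a morphism of the obstruction category, as an extended non-negative
real: the supremum of `d(p x, p y)` over all `((x, t), (y, s))` in the support. -/
def ObsCat.hsize {A B : ObsCat R G p} (φ : A ⟶ B) : ℝ≥0∞ :=
  ⨆ z ∈ (ObsCat.Hom.toGeom φ).supp, edist (p z.1.1) (p z.2.1)

/-- `α` is an `ε`-automorphism: `α` and `α⁻¹` have horizontal size `< ε`. -/
def ObsCat.IsEpsAutomorphism (ε : ℝ) {A : ObsCat R G p} (α : Aut A) : Prop :=
  ObsCat.hsize α.hom < ENNReal.ofReal ε ∧ ObsCat.hsize α.inv < ENNReal.ofReal ε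

end Size

/-! ### The two examples -/

/-- The infinite cyclic group `⟨t⟩`, written multiplicatively. -/
abbrev CyclicT : Type := Multiplicative ℤ

/-- The infinite dihedral group; `DihedralGroup.sr i` is `s rⁱ`. -/
abbrev DInf : Type := DihedralGroup 0

/-- The generator `t` acts on `ℝ` by translation by `1`. -/
instance CyclicT.actionReal : MulAction CyclicT ℝ where
  smul n x := x + ((Multiplicative.toAdd n : ℤ) : ℝ)
  one_smul x := by
    change x + ((0 : ℤ) : ℝ) = x
    simp
  mul_smul m n x := by
    change x + ((Multiplicative.toAdd m + Multiplicative.toAdd n : ℤ) : ℝ)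
      = x + ((Multiplicative.toAdd n : ℤ) : ℝ) + ((Multiplicative.toAdd m : ℤ) : ℝ)
    push_cast
    ring

/-- `r` acts on `ℝ` by translation by `1`, `s` by `x ↦ -x`. -/
def DInf.smulReal : DInf → ℝ → ℝ
  | .r i, x => x + Int.cast (R := ℝ) i
  | .sr i, x => -(x + Int.cast (R := ℝ) i)

instance DInf.actionReal : MulAction DInf ℝ where
  smul := DInf.smulReal
  one_smul x := by
    change x + ((0 : ℤ) : ℝ) = x
    simp
  mul_smul := by
    have hadd : ∀ i j : ZMod 0,
        Int.cast (R := ℝ) (i + j) = Int.cast (R := ℝ) i + Int.cast (R := ℝ) j :=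
      fun i j => Int.cast_add (R := ℝ) i j
    have hsub : ∀ i j : ZMod 0,
        Int.cast (R := ℝ) (i - j) = Int.cast (R := ℝ) i - Int.cast (R := ℝ) j :=
      fun i j => Int.cast_sub (R := ℝ) i j
    rintro (i | i) (j | j) x
    · change x + Int.cast (R := ℝ) (i + j) = x + Int.cast (R := ℝ) j + Int.cast (R := ℝ) i
      rw [hadd]; ring
    · change -(x + Int.cast (R := ℝ) (j - i)) = -(x + Int.cast (R := ℝ) j) + Int.cast (R := ℝ) i
      rw [hsub]; ring
    · change -(x + Int.cast (R := ℝ) (i + j)) = -(x + Int.cast (R := ℝ) j + Int.cast (R := ℝ) i)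
      rw [hadd]; ring
    · change x + Int.cast (R := ℝ) (j - i) = -(-(x + Int.cast (R := ℝ) j) + Int.cast (R := ℝ) i)
      rw [hsub]; ring

/-- The action on `ℤ/2 = D∞/⟨r⟩`: `r` acts trivially, `s` interchanges the two elements. -/
def DInf.smulZModTwo : DInf → ZMod 2 → ZMod 2
  | .r _, e => e
  | .sr _, e => e + 1

instance DInf.actionZModTwo : MulAction DInf (ZMod 2) where
  smul := DInf.smulZModTwo
  one_smul _ := rfl
  mul_smul := by
    rintro (i | i) (j | j) e
    · rfl
    · rfl
    · rfl
    · change e = e + 1 + 1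
      rw [add_assoc, show (1 + 1 : ZMod 2) = 0 from rfl, add_zero]

/-- The obstruction category of `⟨t⟩` acting (freely) on `ℝ`. -/
abbrev ObsCyclic (R : Type u) [Ring R] := ObsCat R CyclicT (id : ℝ → ℝ)

/-- The obstruction category of `D∞` acting on `ℝ`, formed with the resolution
`ℤ/2 × ℝ → ℝ` (projection; diagonal action on `ℤ/2 × ℝ`). -/
abbrev ObsDihedral (R : Type u) [Ring R] := ObsCat R DInf (Prod.snd : ZMod 2 × ℝ → ℝ)

end

-- A small automorphism can be cut into blocks over short disjoint intervals, and each block can be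
-- pushed to infinity. Choosing bases (`ObsCat.framing`) turns an object into a G-set of basis
-- elements placed over the line, and an automorphism of bounded size into a unit of `ctlSubring`, a
-- ring of equivariant matrices whose horizontal extent tends to zero as the height grows
-- (`exists_unit_of_bounded`).
--
-- Vanishing comes from an Eilenberg swindle (`cls_eq_zero_of_center`). Suppose a unit links only
-- basis elements with a common center, the centers being chosen equivariantly at distance at most
-- 1. Copies of it can then be stacked on the levels of a tower whose positions converge to the
-- centers along the rays of a cone, so the stack is controlled. The stack on levels ≥ 0 is
-- conjugate, by the shift, to the stack on levels ≥ 1, and the two differ by one copy. That copy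
-- therefore has class zero.
--
-- For a small unit e, cut the line at the points of 1/4 + ½ℤ, and let π be the coordinate
-- projection to the pieces around the integers. The projection q = e π e⁻¹ agrees with π away from
-- the cut points, where χ denotes the coordinate projection to their neighbourhoods. Room is added
-- by the tower: extend π and q by χ on all positive levels (`Tower.ray`). The unit that shifts only
-- the image of b = χ(1 - q) up by one level conjugates a projection depending on π alone to the
-- extended q (`Tower.shift_add_mul_ray`). Using it for q and for π gives a unit γ, supported near
-- the cut points, which conjugates the extended q to the extended π.
--
-- With α equal to e on level zero and to the identity elsewhere, β = γ α commutes with the extended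
-- π. It is thus the product of a part near the integers and a part near the half-integers. These
-- two parts and γ all respect suitable centers, so their classes vanish by the swindle. Hence [α] =
-- 0, and [α] = [e] by stabilization (`cls_tower_eq`). The argument ends in
-- `Framing.cls_eq_zero_of_small`.
--
-- Both groups are treated at once through `LineCover`. In the dihedral case the factor ℤ/2 makes
-- the reflections act freely.

universe u v w

set_option linter.unusedSectionVars false

noncomputable section

/-! ### Consequences of the relations of `K₁` -/

namespace AddK1

variable {C : Type v} [Category.{w} C] [Preadditive C]

theorem mk_trans {A : C} (α β : Aut A) : mk (α ≪≫ β) = mk α + mk β := by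
  rw [← sub_eq_zero]
  exact (QuotientAddGroup.eq_zero_iff _).2 (AddSubgroup.subset_closure (Or.inl ⟨A, α, β, rfl⟩))

theorem mk_refl (A : C) : mk (Iso.refl A : Aut A) = 0 := by
  have h := mk_trans (Iso.refl A : Aut A) (Iso.refl A)
  rwa [Iso.trans_refl, left_eq_add] at h

theorem mk_of_splitting {S : ShortComplex C} (hS : S.Splitting) (φ : Aut S) :
    mk (ShortComplex.π₂.mapIso φ) =
      mk (ShortComplex.π₁.mapIso φ) + mk (ShortComplex.π₃.mapIso φ) := by
  rw [← sub_eq_zero]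
  exact (QuotientAddGroup.eq_zero_iff _).2
    (AddSubgroup.subset_closure (Or.inr ⟨S, ⟨hS⟩, φ, rfl⟩))

/-- An automorphism which restricts to `α` on a direct summand and is the identity on the
complement has the class of `α`. -/
theorem mk_eq_of_splitting {X Y Z : C} {i : X ⟶ Y} {q : Y ⟶ Z} {r : Y ⟶ X} {s : Z ⟶ Y}
    (hir : i ≫ r = 𝟙 X) (hsq : s ≫ q = 𝟙 Z) (h : r ≫ i + q ≫ s = 𝟙 Y) (hiq : i ≫ q = 0)
    (α : Aut X) (β : Aut Y) (h₁ : α.hom ≫ i = i ≫ β.hom) (h₂ : β.hom ≫ q = q) :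
    mk β = mk α := by
  let S : ShortComplex C := ShortComplex.mk i q hiq
  let hS : S.Splitting := { r := r, s := s, f_r := hir, s_g := hsq, id := h }
  have h₂' : β.hom ≫ q = q ≫ (Iso.refl Z).hom := by simpa using h₂
  let φ : Aut S := ShortComplex.isoMk (S₁ := S) (S₂ := S) α β (Iso.refl Z) h₁ h₂'
  have key := mk_of_splitting hS φ
  have e₂ : ShortComplex.π₂.mapIso φ = β := Iso.ext rfl
  have e₁ : ShortComplex.π₁.mapIso φ = α := Iso.ext rfl
  have e₃ : ShortComplex.π₃.mapIso φ = Iso.refl Z := Iso.ext rfl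
  rw [e₁, e₂, e₃] at key
  exact (key.trans (congrArg (mk α + ·) (mk_refl Z))).trans (add_zero _)

end AddK1

/-! ### Relations and linear maps of based modules -/

section Entries

variable {R : Type u} [Ring R] {I J K : Type}

/-- All non-zero matrix entries of `f` are at places where `r` holds. -/
def SuppIn (f : (I →₀ R) →ₗ[R] (J →₀ R)) (r : I → J → Prop) : Prop :=
  ∀ i j, f (Finsupp.single i 1) j ≠ 0 → r i j

theorem Finsupp.linearMap_apply_eq_sum (f : (I →₀ R) →ₗ[R] (J →₀ R)) (v : I →₀ R) (j : J) :
    f v j = v.sum fun i a => a * f (Finsupp.single i 1) j := by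
  conv_lhs => rw [← Finsupp.sum_single v]
  rw [Finsupp.sum, map_sum, Finsupp.finsetSum_apply, Finsupp.sum]
  refine Finset.sum_congr rfl fun i _ => ?_
  rw [show Finsupp.single i (v i) = v i • Finsupp.single i (1 : R) by simp, map_smul]
  simp

theorem Finsupp.exists_of_linearMap_apply_ne_zero {f : (I →₀ R) →ₗ[R] (J →₀ R)} {v : I →₀ R}
    {j : J} (h : f v j ≠ 0) : ∃ i, v i ≠ 0 ∧ f (Finsupp.single i 1) j ≠ 0 := by
  rw [Finsupp.linearMap_apply_eq_sum] at h
  obtain ⟨i, hi, h⟩ := Finset.exists_ne_zero_of_sum_ne_zero h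
  exact ⟨i, Finsupp.mem_support_iff.1 hi, fun h0 => h (by simp only [h0, mul_zero])⟩

theorem Finsupp.linearMap_ext_entries {f g : (I →₀ R) →ₗ[R] (J →₀ R)}
    (h : ∀ i j, f (Finsupp.single i 1) j = g (Finsupp.single i 1) j) : f = g :=
  Finsupp.lhom_ext' fun i => LinearMap.ext_ring (Finsupp.ext (h i))

namespace SuppIn

variable {f g : (I →₀ R) →ₗ[R] (J →₀ R)} {h : (J →₀ R) →ₗ[R] (K →₀ R)} {r s : I → J → Prop}
  {q : J → K → Prop}

theorem mono (hf : SuppIn f r) (hrs : ∀ i j, r i j → s i j) : SuppIn f s :=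
  fun i j h => hrs i j (hf i j h)

theorem zero : SuppIn (0 : (I →₀ R) →ₗ[R] (J →₀ R)) r := fun _ _ h => absurd rfl h

theorem add (hf : SuppIn f r) (hg : SuppIn g r) : SuppIn (f + g) r := fun i j h => by
  by_cases h0 : f (Finsupp.single i 1) j = 0
  · refine hg i j fun h1 => h ?_
    simp [h0, h1]
  · exact hf i j h0

theorem neg (hf : SuppIn f r) : SuppIn (-f) r := fun i j h => hf i j fun h0 => h (by simp [h0])

theorem comp (hf : SuppIn f r) (hh : SuppIn h q) :
    SuppIn (h ∘ₗ f) fun i k => ∃ j, r i j ∧ q j k := fun i k hik => by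
  obtain ⟨j, hj, hjk⟩ := Finsupp.exists_of_linearMap_apply_ne_zero (f := h)
    (v := f (Finsupp.single i 1)) hik
  exact ⟨j, hf i j hj, hh j k hjk⟩

theorem refl {r : I → I → Prop} (hr : ∀ i, r i i) :
    SuppIn (LinearMap.id : (I →₀ R) →ₗ[R] (I →₀ R)) r := fun i j h => by
  have : i = j := by
    by_contra hij
    exact h (Finsupp.single_eq_of_ne' hij)
  exact this ▸ hr i

end SuppIn

/-- The endomorphisms with entries in an equivalence relation form a ring. -/
def suppSubring (R : Type u) [Ring R] (r : Setoid I) : Subring (Module.End R (I →₀ R)) where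
  carrier := {f | SuppIn f r}
  mul_mem' hf hg := (SuppIn.comp hg hf).mono fun _ _ ⟨_, h, h'⟩ => r.trans' h h'
  one_mem' := .refl r.refl'
  add_mem' hf hg := hf.add hg
  zero_mem' := .zero
  neg_mem' hf := hf.neg

/-! ### Coordinate projections of based modules -/

open Classical in
/-- The projection onto the coordinates in `S`. -/
def coordProj (R : Type u) [Ring R] (S : Set I) : Module.End R (I →₀ R) :=
  Finsupp.lsum ℕ fun i => if i ∈ S then Finsupp.lsingle i else 0

theorem coordProj_single_of_mem {S : Set I} {i : I} (h : i ∈ S) (a : R) :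
    coordProj R S (Finsupp.single i a) = Finsupp.single i a := by
  simp [coordProj, h]

theorem coordProj_single_of_notMem {S : Set I} {i : I} (h : i ∉ S) (a : R) :
    coordProj R S (Finsupp.single i a) = 0 := by
  simp [coordProj, h]

theorem coordProj_apply_of_mem {S : Set I} {i : I} (h : i ∈ S) (v : I →₀ R) :
    coordProj R S v i = v i := by
  induction v using Finsupp.induction_linear with
  | zero => simp
  | add v w hv hw => simp [hv, hw]
  | single j a =>
    by_cases hj : j ∈ S
    · rw [coordProj_single_of_mem hj]
    · rw [coordProj_single_of_notMem hj, Finsupp.single_eq_of_ne (by rintro rfl; exact hj h)]; rfl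

theorem coordProj_apply_of_notMem {S : Set I} {i : I} (h : i ∉ S) (v : I →₀ R) :
    coordProj R S v i = 0 := by
  induction v using Finsupp.induction_linear with
  | zero => simp
  | add v w hv hw => simp [hv, hw]
  | single j a =>
    by_cases hj : j ∈ S
    · rw [coordProj_single_of_mem hj, Finsupp.single_eq_of_ne (by rintro rfl; exact h hj)]
    · rw [coordProj_single_of_notMem hj]; rfl

theorem coordProj_suppIn (S : Set I) : SuppIn (coordProj R S) Eq := fun i j h => by
  by_contra hij
  by_cases hi : i ∈ S
  · exact h (by rw [coordProj_single_of_mem hi, Finsupp.single_eq_of_ne' hij])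
  · exact h (by rw [coordProj_single_of_notMem hi]; rfl)

theorem isIdempotentElem_coordProj (S : Set I) : IsIdempotentElem (coordProj R S) := by
  refine Finsupp.linearMap_ext_entries fun i j => ?_
  by_cases hj : j ∈ S
  · exact coordProj_apply_of_mem hj _
  · exact (coordProj_apply_of_notMem hj _).trans (coordProj_apply_of_notMem hj _).symm

theorem commute_coordProj (S T : Set I) : Commute (coordProj R S) (coordProj R T) := by
  refine Finsupp.linearMap_ext_entries fun i j => ?_
  simp only [Module.End.mul_apply]
  by_cases hj : j ∈ S <;> by_cases hj' : j ∈ T <;>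
    simp only [hj, hj', not_false_eq_true, coordProj_apply_of_mem, coordProj_apply_of_notMem]

/-! ### Equivariant maps between free modules over G-sets -/

/-- `x ↦ g x` on a free module over a `G`-set. -/
def gtranslate (R : Type u) [Ring R] {G : Type*} [Group G] [MulAction G I] (g : G) :
    (I →₀ R) →ₗ[R] (I →₀ R) :=
  Finsupp.lmapDomain R R (g • ·)

section

variable {G : Type*} [Group G] [MulAction G I] [MulAction G J]

@[simp]
theorem gtranslate_single (g : G) (i : I) (a : R) :
    gtranslate R g (Finsupp.single i a) = Finsupp.single (g • i) a :=
  Finsupp.mapDomain_single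

@[simp]
theorem gtranslate_apply_smul (g : G) (v : I →₀ R) (i : I) : gtranslate R g v (g • i) = v i :=
  Finsupp.mapDomain_apply (MulAction.injective g) v i

variable (G) in
/-- `G`-equivariance of a linear map between free modules over `G`-sets. -/
def IsEquivariant (f : (I →₀ R) →ₗ[R] (J →₀ R)) : Prop :=
  ∀ (g : G) (v : I →₀ R), f (gtranslate R g v) = gtranslate R g (f v)

theorem isEquivariant_of_single {f : (I →₀ R) →ₗ[R] (J →₀ R)}
    (h : ∀ (g : G) (i : I),
      f (Finsupp.single (g • i) 1) = gtranslate R g (f (Finsupp.single i 1))) :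
    IsEquivariant G f := fun g => by
  suffices h' : f ∘ₗ gtranslate R g = gtranslate R g ∘ₗ f from fun v => LinearMap.congr_fun h' v
  refine Finsupp.lhom_ext' fun i => LinearMap.ext_ring ?_
  simpa using h g i

theorem IsEquivariant.entry_smul {f : (I →₀ R) →ₗ[R] (J →₀ R)} (h : IsEquivariant G f)
    (g : G) (i : I) (j : J) :
    f (Finsupp.single (g • i) 1) (g • j) = f (Finsupp.single i 1) j := by
  rw [← gtranslate_single, h, gtranslate_apply_smul]

theorem isEquivariant_coordProj {S : Set I} (hS : ∀ (g : G) (i : I), g • i ∈ S ↔ i ∈ S) :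
    IsEquivariant G (coordProj R S) := isEquivariant_of_single fun g i => by
  by_cases h : i ∈ S
  · rw [coordProj_single_of_mem h, coordProj_single_of_mem ((hS g i).2 h), gtranslate_single]
  · rw [coordProj_single_of_notMem h, coordProj_single_of_notMem (mt (hS g i).1 h), map_zero]

end

end Entries

/-! ### Covers of the line and placements over them -/

/-- A free `G`-space `Xbar` with a proper `G`-map to the line, on which `G` acts through
integral affine isometries including all integral translations, and a way to move the points
of `Xbar` along the line. -/
class LineCover (G : Type*) [Group G] [MulAction G ℝ] {Xbar : Type*} [TopologicalSpace Xbar]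
    [MulAction G Xbar] (p : Xbar → ℝ) where
  continuous : Continuous p
  isCompact : ∀ B : ℝ, IsCompact {x | |p x| ≤ B}
  map_smul : ∀ (g : G) x, p (g • x) = g • p x
  free : ∀ (g : G) (x : Xbar), g • x = x → g = 1
  move : Xbar → ℝ → Xbar
  map_move : ∀ x y, p (move x y) = y
  move_map : ∀ x, move x (p x) = x
  smul_move : ∀ (g : G) x y, g • move x y = move (g • x) (g • y)
  smul_eq : ∀ g : G, (∃ n : ℤ, ∀ y : ℝ, g • y = y + n) ∨ (∃ n : ℤ, ∀ y : ℝ, g • y = -y + n)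
  exists_translation : ∀ n : ℤ, ∃ g : G, ∀ y : ℝ, g • y = y + n

theorem LineCover.abs_smul_sub_smul {G : Type*} [Group G] [MulAction G ℝ] {Xbar : Type*}
    [TopologicalSpace Xbar] [MulAction G Xbar] (p : Xbar → ℝ) [LineCover G p] (g : G) (x y : ℝ) :
    |g • x - g • y| = |x - y| := by
  obtain ⟨n, h⟩ | ⟨n, h⟩ := LineCover.smul_eq p g
  · rw [h, h]; congr 1; ring
  · rw [h, h, abs_sub_comm]; congr 1; ring

/-- A `G`-set of basis elements placed equivariantly and properly over `Xbar × [1, ∞)`. -/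
structure Placement (G : Type*) [Group G] {Xbar : Type*} [MulAction G Xbar] (p : Xbar → ℝ)
    (I : Type) [MulAction G I] where
  pt : I → Xbar
  ht : I → Height
  pt_smul : ∀ (g : G) i, pt (g • i) = g • pt i
  ht_smul : ∀ (g : G) i, ht (g • i) = ht i
  finite : ∀ B : ℝ, {i | |p (pt i)| ≤ B ∧ (ht i).toReal ≤ B}.Finite

theorem Height.one_le (t : Height) : 1 ≤ t.toReal := t.2

namespace Placement

variable {R : Type u} [Ring R] {G : Type*} [Group G] {Xbar : Type*} [MulAction G Xbar]
  {p : Xbar → ℝ}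
  {I J K : Type} [MulAction G I] [MulAction G J] [MulAction G K]
  (P : Placement G p I) (Q : Placement G p J) (S : Placement G p K)

/-- The position of a basis element. -/
def pos (i : I) : Xbar × Height := (P.pt i, P.ht i)

/-- The horizontal position of a basis element. -/
def loc (i : I) : ℝ := p (P.pt i)

/-- The height of a basis element. -/
def hgt (i : I) : ℝ := (P.ht i).toReal

theorem one_le_hgt (i : I) : 1 ≤ P.hgt i := (P.ht i).one_le

theorem hgt_pos (i : I) : 0 < P.hgt i := one_pos.trans_le (P.one_le_hgt i)

theorem hgt_smul (g : G) (i : I) : P.hgt (g • i) = P.hgt i :=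
  congrArg Height.toReal (P.ht_smul g i)

theorem pos_smul (g : G) (i : I) : P.pos (g • i) = g • P.pos i :=
  Prod.ext (P.pt_smul g i) (P.ht_smul g i)

theorem loc_smul [MulAction G ℝ] [TopologicalSpace Xbar] [LineCover G p] (g : G) (i : I) :
    P.loc (g • i) = g • P.loc i := by
  rw [loc, P.pt_smul, LineCover.map_smul (p := p), loc]

theorem finite_fiber (z : Xbar × Height) : {i | P.pos i = z}.Finite :=
  (P.finite (max |p z.1| z.2.toReal)).subset fun i (hi : P.pos i = z) => by
    subst hi
    exact ⟨le_max_left _ _, le_max_right _ _⟩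

/-- The relation `r` has bounded extent, and its horizontal extent tends to zero as the height
tends to infinity. -/
structure IsSqueezing (r : I → J → Prop) : Prop where
  bounded : ∃ D : ℝ, ∀ i j, r i j → |P.loc i - Q.loc j| ≤ D ∧ |P.hgt i - Q.hgt j| ≤ D
  atTop : ∀ ε > 0, ∃ T : ℝ, ∀ i j, r i j → T ≤ P.hgt i → |P.loc i - Q.loc j| ≤ ε

variable {P Q S}

namespace IsSqueezing

theorem mono {r s : I → J → Prop} (hs : P.IsSqueezing Q s) (h : ∀ i j, r i j → s i j) :
    P.IsSqueezing Q r where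
  bounded := hs.bounded.imp fun _ hD i j hij => hD i j (h i j hij)
  atTop ε hε := (hs.atTop ε hε).imp fun _ hT i j hij => hT i j (h i j hij)

theorem of_eq {r : I → J → Prop} (h : ∀ i j, r i j → P.pos i = Q.pos j) :
    P.IsSqueezing Q r := by
  have h0 : ∀ i j, r i j → P.loc i - Q.loc j = 0 ∧ P.hgt i - Q.hgt j = 0 := fun i j hij =>
    ⟨sub_eq_zero.2 (congrArg (fun z : Xbar × Height => p z.1) (h i j hij)),
      sub_eq_zero.2 (congrArg (fun z : Xbar × Height => z.2.toReal) (h i j hij))⟩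
  refine ⟨⟨0, fun i j hij => ?_⟩, fun ε hε => ⟨0, fun i j hij _ => ?_⟩⟩
  · simp [h0 i j hij]
  · simpa [h0 i j hij] using hε.le

theorem sup {r s : I → J → Prop} (hr : P.IsSqueezing Q r) (hs : P.IsSqueezing Q s) :
    P.IsSqueezing Q fun i j => r i j ∨ s i j where
  bounded := by
    obtain ⟨D, hD⟩ := hr.bounded
    obtain ⟨D', hD'⟩ := hs.bounded
    refine ⟨max D D', fun i j h => ?_⟩
    obtain h | h := h
    · exact (hD i j h).imp (le_max_of_le_left ·) (le_max_of_le_left ·)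
    · exact (hD' i j h).imp (le_max_of_le_right ·) (le_max_of_le_right ·)
  atTop ε hε := by
    obtain ⟨T, hT⟩ := hr.atTop ε hε
    obtain ⟨T', hT'⟩ := hs.atTop ε hε
    refine ⟨max T T', fun i j h ht => ?_⟩
    obtain h | h := h
    · exact hT i j h (le_of_max_le_left ht)
    · exact hT' i j h (le_of_max_le_right ht)

theorem comp {r : I → J → Prop} {s : J → K → Prop} (hr : P.IsSqueezing Q r)
    (hs : Q.IsSqueezing S s) : P.IsSqueezing S fun i k => ∃ j, r i j ∧ s j k where
  bounded := by
    obtain ⟨D, hD⟩ := hr.bounded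
    obtain ⟨D', hD'⟩ := hs.bounded
    refine ⟨D + D', ?_⟩
    rintro i k ⟨j, h, h'⟩
    exact ⟨(abs_sub_le _ (Q.loc j) _).trans (add_le_add (hD i j h).1 (hD' j k h').1),
      (abs_sub_le _ (Q.hgt j) _).trans (add_le_add (hD i j h).2 (hD' j k h').2)⟩
  atTop ε hε := by
    obtain ⟨D, hD⟩ := hr.bounded
    obtain ⟨T, hT⟩ := hr.atTop (ε / 2) (half_pos hε)
    obtain ⟨T', hT'⟩ := hs.atTop (ε / 2) (half_pos hε)
    -- The second relation starts at the intermediate element, which may be lower than `i` by `D`.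
    refine ⟨max T (T' + D), ?_⟩
    rintro i k ⟨j, h, h'⟩ ht
    have h1 := hT i j h (le_of_max_le_left ht)
    have h2 := hT' j k h' (by linarith [(abs_le.1 (hD i j h).2).2, le_of_max_le_right ht])
    exact (abs_sub_le _ (Q.loc j) _).trans ((add_le_add h1 h2).trans (by linarith))

end IsSqueezing

variable (P Q) in
/-- The morphisms of the matrix model of the obstruction category: equivariant maps with
squeezing support. -/
structure IsCtl (f : (I →₀ R) →ₗ[R] (J →₀ R)) : Prop where
  equivariant : IsEquivariant G f
  squeezing : P.IsSqueezing Q fun i j => f (Finsupp.single i 1) j ≠ 0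

namespace IsCtl

theorem of_suppIn {f : (I →₀ R) →ₗ[R] (J →₀ R)} {r : I → J → Prop} (hf : IsEquivariant G f)
    (h : SuppIn f r) (hr : P.IsSqueezing Q r) : IsCtl P Q f :=
  ⟨hf, hr.mono h⟩

theorem of_pos_eq {f : (I →₀ R) →ₗ[R] (J →₀ R)} (hf : IsEquivariant G f)
    (h : SuppIn f fun i j => P.pos i = Q.pos j) : IsCtl P Q f :=
  .of_suppIn hf h (.of_eq fun _ _ h => h)

theorem of_suppIn_eq {f : (I →₀ R) →ₗ[R] (I →₀ R)} (hf : IsEquivariant G f)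
    (h : SuppIn f Eq) : IsCtl P P f :=
  .of_pos_eq hf (h.mono fun _ _ h => congrArg _ h)

theorem id : IsCtl P P (LinearMap.id : (I →₀ R) →ₗ[R] (I →₀ R)) :=
  .of_suppIn_eq (fun _ _ => rfl) (.refl fun _ => rfl)

theorem zero : IsCtl P Q (0 : (I →₀ R) →ₗ[R] (J →₀ R)) :=
  .of_pos_eq (fun _ _ => by simp) .zero

theorem neg {f : (I →₀ R) →ₗ[R] (J →₀ R)} (hf : IsCtl P Q f) : IsCtl P Q (-f) :=
  .of_suppIn (fun g v => by simp [hf.equivariant g v]) (SuppIn.neg fun _ _ h => h) hf.squeezing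

theorem add {f f' : (I →₀ R) →ₗ[R] (J →₀ R)} (hf : IsCtl P Q f) (hf' : IsCtl P Q f') :
    IsCtl P Q (f + f') :=
  .of_suppIn (fun g v => by simp [hf.equivariant g v, hf'.equivariant g v])
    (SuppIn.add (fun _ _ h => Or.inl h) (fun _ _ h => Or.inr h)) (hf.squeezing.sup hf'.squeezing)

theorem comp {f : (I →₀ R) →ₗ[R] (J →₀ R)} {h : (J →₀ R) →ₗ[R] (K →₀ R)} (hf : IsCtl P Q f)
    (hh : IsCtl Q S h) : IsCtl P S (h ∘ₗ f) :=
  .of_suppIn (fun g v => by simp [hf.equivariant g v, hh.equivariant g])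
    (SuppIn.comp (fun _ _ h => h) (fun _ _ h => h)) (hf.squeezing.comp hh.squeezing)

/-- A basis element has a finitely supported image for free. Finiteness in the other direction is
not automatic: it follows from bounded extent and the properness of the placement. -/
theorem finite_left {f : (I →₀ R) →ₗ[R] (J →₀ R)} (hf : IsCtl P Q f) (z : Xbar × Height) :
    {i | ∃ j, Q.pos j = z ∧ f (Finsupp.single i 1) j ≠ 0}.Finite := by
  obtain ⟨D, hD⟩ := hf.squeezing.bounded
  refine (P.finite (D + max |p z.1| z.2.toReal)).subset ?_
  rintro i ⟨j, rfl, hij⟩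
  obtain ⟨h1, h2⟩ := hD i j hij
  constructor
  · calc |P.loc i| ≤ |P.loc i - Q.loc j| + |Q.loc j| := by
          simpa using abs_sub_le (P.loc i) (Q.loc j) 0
      _ ≤ _ := add_le_add h1 (le_max_left _ _)
  · have : Q.hgt j ≤ max |p (Q.pos j).1| (Q.pos j).2.toReal := le_max_right _ _
    change P.hgt i ≤ _
    linarith [(abs_le.1 h2).2]

end IsCtl

variable (R P) in
/-- The ring of controlled endomorphisms. -/
def ctlSubring : Subring (Module.End R (I →₀ R)) where
  carrier := {f | IsCtl P P f}
  mul_mem' hf hg := IsCtl.comp hg hf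
  one_mem' := .id
  add_mem' hf hg := hf.add hg
  zero_mem' := .zero
  neg_mem' hf := hf.neg

theorem mem_ctlSubring {f : Module.End R (I →₀ R)} : f ∈ ctlSubring R P ↔ IsCtl P P f := Iff.rfl

theorem coordProj_mem_ctlSubring {s : Set I} (hs : ∀ (g : G) (i : I), g • i ∈ s ↔ i ∈ s) :
    coordProj R s ∈ ctlSubring R P :=
  IsCtl.of_suppIn_eq (isEquivariant_coordProj hs) (coordProj_suppIn s)

/-- The comap of a placement along an injective equivariant map. -/
def comap (θ : K → I) (hθ : Function.Injective θ) (hθ' : ∀ (g : G) k, θ (g • k) = g • θ k)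
    (P : Placement G p I) : Placement G p K where
  pt k := P.pt (θ k)
  ht k := P.ht (θ k)
  pt_smul g k := by rw [hθ', P.pt_smul]
  ht_smul g k := by rw [hθ', P.ht_smul]
  finite B := (P.finite B).preimage hθ.injOn

end Placement

/-! ### Control conditions over the line -/

section Control

variable {G : Type*} [Group G] [MulAction G ℝ] {Xbar : Type*} [TopologicalSpace Xbar]
  [MulAction G Xbar] (p : Xbar → ℝ) [LineCover G p]

theorem Height.toExt_val (t : Height) : (t.toExt : EReal) = (t.toReal : EReal) := rfl

include p in
/-- The horizontal neighbourhoods of `(x, ∞)` above height `T`. -/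
theorem isInvNhdAtInfty_ball (x : ℝ) {ε : ℝ} (hε : 0 < ε) (T : ℝ) :
    IsInvNhdAtInfty G x {z : ℝ × ExtHeight | |z.1 - x| < ε ∧ (T : EReal) < z.2} where
  isOpen := by
    refine IsOpen.and (isOpen_lt (by fun_prop) continuous_const) (isOpen_lt continuous_const ?_)
    exact continuous_subtype_val.comp continuous_snd
  mem := ⟨by simpa using hε, EReal.coe_lt_top T⟩
  invariant g hg z hz := ⟨by
    have h := LineCover.abs_smul_sub_smul p g z.1 x
    rw [MulAction.mem_stabilizer_iff.1 hg] at h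
    exact h.trans_lt hz.1, hz.2⟩

theorem exists_ball_subset {x : ℝ} {U : Set (ℝ × ExtHeight)} (hU : U ∈ 𝓝 (x, ExtHeight.top)) :
    ∃ ε > 0, ∃ T : ℝ, ∀ z : ℝ × ExtHeight, |z.1 - x| < ε → (T : EReal) < z.2 → z ∈ U := by
  rw [nhds_prod_eq, Filter.mem_prod_iff] at hU
  obtain ⟨V, hV, W, hW, h⟩ := hU
  obtain ⟨ε, hε, hV⟩ := Metric.mem_nhds_iff.1 hV
  rw [nhds_subtype_eq_comap, Filter.mem_comap] at hW
  obtain ⟨W', hW', hW⟩ := hW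
  obtain ⟨T, hT⟩ := EReal.mem_nhds_top_iff.1 hW'
  exact ⟨ε, hε, T, fun z h1 h2 => h ⟨hV (by rwa [Metric.mem_ball, Real.dist_eq]), hW (hT h2)⟩⟩

-- Squeezing is uniform along the line, hence stronger than what continuous control asks at each
-- point of the line separately.
include p in
theorem isEquivContControlled_of_squeezing {E : Set ((ℝ × Height) × (ℝ × Height))}
    (vertical : ∃ δ : ℝ, ∀ a b : ℝ × Height, (a, b) ∈ E → |a.2.toReal - b.2.toReal| ≤ δ)
    (atTop : ∀ ε > 0, ∃ T : ℝ, ∀ a b : ℝ × Height, (a, b) ∈ E → T ≤ b.2.toReal →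
      |a.1 - b.1| ≤ ε)
    (symm : ∀ a b : ℝ × Height, (a, b) ∈ E → (b, a) ∈ E)
    (invariant : ∀ (g : G) (a b : ℝ × Height), (a, b) ∈ E → (g • a, g • b) ∈ E) :
    IsEquivContControlled G E where
  vertical := vertical
  symm := symm
  invariant := invariant
  atInfty x U hU := by
    obtain ⟨ε, hε, T, hT⟩ := exists_ball_subset (hU.isOpen.mem_nhds hU.mem)
    obtain ⟨δ, hδ⟩ := vertical
    obtain ⟨T', hT'⟩ := atTop (ε / 2) (half_pos hε)
    -- Halving the radius absorbs the horizontal displacement, and the summand `δ` absorbs the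
    -- vertical one.
    refine ⟨U ∩ _, Set.inter_subset_left,
      hU.inter (isInvNhdAtInfty_ball p x (half_pos hε) (max T' (T + δ))), ?_⟩
    rintro a b ha ⟨-, hb1, hb2⟩ hab
    rw [Height.toExt_val, EReal.coe_lt_coe_iff, max_lt_iff] at hb2
    refine ha (hT _ ?_ ?_)
    · have := hT' a b hab hb2.1.le
      exact (abs_sub_le _ b.1 _).trans_lt (by linarith)
    · rw [Height.toExt_val, EReal.coe_lt_coe_iff]
      linarith [(abs_le.1 (hδ a b hab)).1]

-- Continuous control is a condition at each point separately. Finitely many good balls cover [0,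
-- 1], which makes it uniform there, and the integral translations carry the bound along the whole
-- line.
include p in
theorem IsEquivContControlled.exists_height {E : Set ((ℝ × Height) × (ℝ × Height))}
    (hE : IsEquivContControlled G E) {ε : ℝ} (hε : 0 < ε) :
    ∃ T : ℝ, ∀ a b : ℝ × Height, (a, b) ∈ E → T ≤ b.2.toReal → |a.1 - b.1| ≤ ε := by
  have local_bound : ∀ x : ℝ, ∃ r > 0, ∃ T : ℝ, ∀ a b : ℝ × Height, (a, b) ∈ E →
      |b.1 - x| < r → T < b.2.toReal → |a.1 - b.1| ≤ ε := fun x => by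
    obtain ⟨V, hVU, hV, h⟩ := hE.atInfty x _ (isInvNhdAtInfty_ball p x (half_pos hε) 0)
    obtain ⟨r, hr, T, hT⟩ := exists_ball_subset (hV.isOpen.mem_nhds hV.mem)
    refine ⟨r, hr, T, fun a b hab hb1 hb2 => ?_⟩
    have hb := hT (b.1, b.2.toExt) hb1 (EReal.coe_lt_coe_iff.2 hb2)
    have ha := not_imp_comm.1 (fun ha => h a b ha hb) (not_not.2 hab)
    have h1 : |a.1 - x| < ε / 2 := ha.1
    have h2 : |b.1 - x| < ε / 2 := (hVU hb).1
    rw [abs_sub_comm] at h2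
    exact (abs_sub_le _ x _).trans (by linarith)
  choose r hr T hT using local_bound
  obtain ⟨t, -, ht⟩ := (isCompact_Icc (a := (0 : ℝ)) (b := 1)).elim_nhds_subcover
    (fun x => Metric.ball x (r x)) fun x _ => Metric.ball_mem_nhds x (hr x)
  obtain ⟨M, hM⟩ := (t.image T).bddAbove
  refine ⟨M + 1, fun a b hab hb => ?_⟩
  obtain ⟨g, hg⟩ := LineCover.exists_translation (G := G) p (-⌊b.1⌋)
  have hmem : g • b.1 ∈ Set.Icc (0 : ℝ) 1 := by
    rw [hg]
    push_cast
    exact ⟨by linarith [Int.floor_le b.1], by linarith [Int.lt_floor_add_one b.1]⟩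
  obtain ⟨x, hx, hbx⟩ := Set.mem_iUnion₂.1 (ht hmem)
  have h := hT x _ _ (hE.invariant g a b hab) hbx
    ((hM (Finset.mem_image_of_mem T hx)).trans_lt (by
      change M < b.2.toReal
      linarith))
  change |g • a.1 - g • b.1| ≤ ε at h
  rwa [LineCover.abs_smul_sub_smul p] at h

-- The action is cocompact, so the support condition on objects holds automatically.
include p in
theorem isGCompact_univ : IsGCompact G (Set.univ : Set Xbar) := by
  refine ⟨_, LineCover.isCompact (G := G) (p := p) 1, (Set.eq_univ_of_forall fun x => ?_).symm⟩
  obtain ⟨g, hg⟩ := LineCover.exists_translation (G := G) p (-⌊p x⌋)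
  refine ⟨g⁻¹, g • x, ?_, (inv_smul_smul g x).symm⟩
  rw [Set.mem_ofPred_eq, LineCover.map_smul (p := p), hg, abs_le]
  push_cast
  exact ⟨by linarith [Int.floor_le (p x)], by linarith [Int.lt_floor_add_one (p x)]⟩

end Control

/-! ### Framings -/

namespace Placement

variable {R : Type u} [Ring R] {G : Type*} [Group G] [MulAction G ℝ] {Xbar : Type*}
  [TopologicalSpace Xbar] [MulAction G Xbar] {p : Xbar → ℝ}
  {I J K : Type} [MulAction G I] [MulAction G J] [MulAction G K]
  {P : Placement G p I} {Q : Placement G p J} {S : Placement G p K}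

theorem IsCtl.isEquivContControlled [LineCover G p] {f : (I →₀ R) →ₗ[R] (J →₀ R)}
    (hf : IsCtl P Q f) :
    IsEquivContControlled G {e : (ℝ × Height) × (ℝ × Height) |
      ∃ i j, f (Finsupp.single i 1) j ≠ 0 ∧
        (e = ((P.loc i, P.ht i), (Q.loc j, Q.ht j)) ∨
          e = ((Q.loc j, Q.ht j), (P.loc i, P.ht i)))} := by
  obtain ⟨D, hD⟩ := hf.squeezing.bounded
  refine isEquivContControlled_of_squeezing p ⟨D, ?_⟩ (fun ε hε => ?_) ?_ ?_
  · rintro a b ⟨i, j, hij, h | h⟩ <;> obtain ⟨rfl, rfl⟩ := Prod.ext_iff.1 h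
    · exact (hD i j hij).2
    · rw [abs_sub_comm]
      exact (hD i j hij).2
  · obtain ⟨T, hT⟩ := hf.squeezing.atTop ε hε
    -- Squeezing is phrased by the height of the source, control by that of the second point of the
    -- pair; the two heights differ by at most `D`.
    refine ⟨T + D, ?_⟩
    rintro a b ⟨i, j, hij, h | h⟩ ht <;> obtain ⟨rfl, rfl⟩ := Prod.ext_iff.1 h
    · refine hT i j hij ?_
      change T + D ≤ Q.hgt j at ht
      linarith [(abs_le.1 (hD i j hij).2).1]
    · rw [abs_sub_comm]
      refine hT i j hij ?_
      change T + D ≤ P.hgt i at ht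
      linarith [(abs_nonneg _).trans (hD i j hij).2]
  · rintro a b ⟨i, j, hij, h | h⟩ <;> obtain ⟨rfl, rfl⟩ := Prod.ext_iff.1 h
    · exact ⟨i, j, hij, Or.inr rfl⟩
    · exact ⟨i, j, hij, Or.inl rfl⟩
  · have h1 : ∀ (g : G) i, g • (P.loc i, P.ht i) = (P.loc (g • i), P.ht (g • i)) := fun g i => by
      rw [P.loc_smul, P.ht_smul]; rfl
    have h2 : ∀ (g : G) i, g • (Q.loc i, Q.ht i) = (Q.loc (g • i), Q.ht (g • i)) := fun g i => by
      rw [Q.loc_smul, Q.ht_smul]; rfl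
    rintro g a b ⟨i, j, hij, h | h⟩ <;> obtain ⟨rfl, rfl⟩ := Prod.ext_iff.1 h <;>
      refine ⟨g • i, g • j, by rwa [hf.equivariant.entry_smul], ?_⟩ <;> simp only [h1, h2]
    · exact Or.inl trivial
    · exact Or.inr trivial

variable (P) in
/-- An identification of an object of the obstruction category with the free module on a placed
`G`-set: the inclusions `ι` and the projections `π` of the summands. -/
structure Framing (A : ObsCat R G p) where
  ι : ∀ z, A.toGeom.mod z →ₗ[R] (I →₀ R)
  π : ∀ z, (I →₀ R) →ₗ[R] A.toGeom.mod z
  π_ι : ∀ z v, π z (ι z v) = v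
  ι_π_of_eq : ∀ {z i}, P.pos i = z → ∀ v, ι z (π z v) i = v i
  ι_π_of_ne : ∀ {z i}, P.pos i ≠ z → ∀ v, ι z (π z v) i = 0
  ι_smul : ∀ (g : G) z v,
    ι (g • z) v = gtranslate R g (ι z ((eqToHom (A.invariant g z)).hom v))

namespace Framing

variable {A B C : ObsCat R G p} (a : P.Framing A) (b : Q.Framing B) (c : S.Framing C)

theorem ι_injective (z : Xbar × Height) : Function.Injective (a.ι z) :=
  Function.LeftInverse.injective (a.π_ι z)

theorem ι_apply_of_ne {z : Xbar × Height} {i : I} (h : P.pos i ≠ z) (v) : a.ι z v i = 0 := by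
  rw [← a.π_ι z v, a.ι_π_of_ne h]

theorem π_smul (g : G) (z : Xbar × Height) (v : I →₀ R) :
    a.π (g • z) (gtranslate R g v) = (eqToHom (A.invariant g z).symm).hom (a.π z v) := by
  apply a.ι_injective
  have : (eqToHom (A.invariant g z)).hom ((eqToHom (A.invariant g z).symm).hom (a.π z v))
      = a.π z v := by
    rw [← ModuleCat.comp_apply, eqToHom_trans, eqToHom_refl, ModuleCat.id_apply]
  refine Eq.trans ?_ (a.ι_smul g z _).symm
  rw [this]
  ext i
  obtain ⟨i, rfl⟩ := MulAction.surjective g i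
  rw [gtranslate_apply_smul]
  by_cases h : P.pos i = z
  · rw [a.ι_π_of_eq h, a.ι_π_of_eq (by rw [P.pos_smul, h]), gtranslate_apply_smul]
  · rw [a.ι_π_of_ne h, a.ι_π_of_ne fun e => h ?_]
    rw [P.pos_smul] at e
    exact MulAction.injective g e

theorem π_eq_zero {z : Xbar × Height} {v : I →₀ R} (h : ∀ i, P.pos i = z → v i = 0) :
    a.π z v = 0 := by
  apply a.ι_injective
  rw [map_zero]
  ext i
  by_cases hi : P.pos i = z
  · rw [a.ι_π_of_eq hi, h i hi]; rfl
  · rw [a.ι_π_of_ne hi]; rfl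

/-- The components of the morphism given by a matrix. -/
def realApp (f : (I →₀ R) →ₗ[R] (J →₀ R)) (z w : Xbar × Height) :
    A.toGeom.mod z ⟶ B.toGeom.mod w :=
  ModuleCat.ofHom (b.π w ∘ₗ f ∘ₗ a.ι z)

variable {a b} in
theorem exists_of_realApp_ne_zero {f : (I →₀ R) →ₗ[R] (J →₀ R)} {z w : Xbar × Height}
    (h : realApp a b f z w ≠ 0) :
    ∃ i j, P.pos i = z ∧ Q.pos j = w ∧ f (Finsupp.single i 1) j ≠ 0 := by
  by_contra! H
  apply h
  ext v
  refine b.π_eq_zero fun j hj => ?_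
  by_contra hv
  obtain ⟨i, hi, hij⟩ := Finsupp.exists_of_linearMap_apply_ne_zero (f := f) (v := a.ι z v) hv
  refine hij (H i j ?_ hj)
  by_contra hz
  exact hi (a.ι_apply_of_ne hz v)

/-- The morphism of the obstruction category given by a matrix. -/
def real [LineCover G p] {f : (I →₀ R) →ₗ[R] (J →₀ R)} (hf : IsCtl P Q f) : A ⟶ B where
  toGeom :=
    { app := realApp a b f
      finite_right z := by
        refine (Set.Finite.biUnion (P.finite_fiber z) fun i _ =>
          ((f (Finsupp.single i 1)).support.finite_toSet.image Q.pos)).subset fun w hw => ?_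
        obtain ⟨i, j, hi, hj, hij⟩ := exists_of_realApp_ne_zero hw
        exact Set.mem_biUnion (x := i) hi ⟨j, Finsupp.mem_support_iff.2 hij, hj⟩
      finite_left w := by
        refine ((hf.finite_left w).image P.pos).subset fun z hz => ?_
        obtain ⟨i, j, hi, hj, hij⟩ := exists_of_realApp_ne_zero hz
        exact ⟨i, ⟨j, hj, hij⟩, hi⟩ }
  invariant g z w := by
    ext v
    change b.π (g • w) (f (a.ι (g • z) v)) =
      (eqToHom (B.invariant g w).symm).hom (b.π w (f (a.ι z ((eqToHom (A.invariant g z)).hom v))))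
    rw [a.ι_smul, hf.equivariant, b.π_smul]
  controlled := by
    refine ⟨_, hf.isEquivContControlled, fun z hz => ?_⟩
    obtain ⟨i, j, hi, hj, hij⟩ := exists_of_realApp_ne_zero hz
    refine ⟨i, j, hij, Or.inl ?_⟩
    rw [← hi, ← hj]
    rfl

/-! ### Matrix calculus inside the obstruction category -/

section Functor

variable [LineCover G p]

theorem hom_ext' {φ ψ : A ⟶ B}
    (h : ∀ z w v, (φ.toGeom.app z w).hom v = (ψ.toGeom.app z w).hom v) : φ = ψ :=
  ObsCat.Hom.ext (GeomModule.Hom.ext (funext fun z => funext fun w =>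
    ModuleCat.hom_ext (LinearMap.ext (h z w))))

theorem real_id : real a a IsCtl.id = 𝟙 A := by
  refine hom_ext' fun z w v => ?_
  by_cases h : z = w
  · subst h
    change a.π z (a.ι z v) = ((GeomModule.Hom.id A.toGeom).app z z).hom v
    rw [a.π_ι, GeomModule.Hom.id_app_self]; rfl
  · change a.π w (a.ι z v) = ((GeomModule.Hom.id A.toGeom).app z w).hom v
    rw [GeomModule.Hom.id_app_ne h, a.π_eq_zero fun i hi => a.ι_apply_of_ne (hi.trans_ne
      (Ne.symm h)) v]
    rfl

/-- The maps `ι z ∘ π z` are the coordinate projections to the disjoint fibres of `pos`. Inserting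
this decomposition of `v` between two matrices turns their product into the composition of the
category. -/
theorem sum_ι_π (s : Finset (Xbar × Height)) (v : I →₀ R) (h : ∀ z ∉ s, a.π z v = 0) :
    ∑ z ∈ s, a.ι z (a.π z v) = v := by
  ext i
  rw [Finsupp.finsetSum_apply]
  by_cases hi : P.pos i ∈ s
  · rw [Finset.sum_eq_single (P.pos i) (fun z _ hz => a.ι_π_of_ne hz.symm v)
      fun h => absurd hi h, a.ι_π_of_eq rfl]
  · rw [Finset.sum_eq_zero fun z hz => a.ι_π_of_ne (fun e => hi (by rwa [e])) v,
      ← a.ι_π_of_eq rfl v, h _ hi, map_zero]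
    rfl

theorem real_comp {f : (I →₀ R) →ₗ[R] (J →₀ R)} {h : (J →₀ R) →ₗ[R] (K →₀ R)}
    (hf : IsCtl P Q f) (hh : IsCtl Q S h) :
    real a c (hf.comp hh) = real a b hf ≫ real b c hh := by
  refine hom_ext' fun x z v => ?_
  change c.π z (h (f (a.ι x v))) =
    ((GeomModule.Hom.comp (real a b hf).toGeom (real b c hh).toGeom).app x z).hom v
  rw [GeomModule.Hom.comp_app_of_left _ _ _ _
    ((real a b hf).toGeom.finite_right x).toFinset (fun y hy => by simpa using hy),
    ModuleCat.hom_sum, LinearMap.sum_apply]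
  conv_lhs => rw [← sum_ι_π b ((real a b hf).toGeom.finite_right x).toFinset (f (a.ι x v))
    (fun y hy => by
      rw [Set.Finite.mem_toFinset, Set.mem_ofPred_eq, not_not] at hy
      exact LinearMap.congr_fun (congrArg ModuleCat.Hom.hom hy) v)]
  rw [map_sum, map_sum]
  rfl

theorem real_add {f f' : (I →₀ R) →ₗ[R] (J →₀ R)} (hf : IsCtl P Q f) (hf' : IsCtl P Q f') :
    real a b (hf.add hf') = real a b hf + real a b hf' :=
  hom_ext' fun z w v => map_add (b.π w) (f (a.ι z v)) (f' (a.ι z v))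

theorem real_zero : real a b (IsCtl.zero (R := R)) = 0 :=
  hom_ext' fun _ w _ => map_zero (b.π w)

/-- This carries the equations between an automorphism and its inverse back to matrices. -/
theorem real_injective {f f' : (I →₀ R) →ₗ[R] (J →₀ R)} {hf : IsCtl P Q f} {hf' : IsCtl P Q f'}
    (h : real a b hf = real a b hf') : f = f' := by
  refine Finsupp.linearMap_ext_entries fun i j => ?_
  have hi : a.ι (P.pos i) (a.π (P.pos i) (Finsupp.single i 1)) = Finsupp.single i 1 := by
    ext k
    by_cases hk : P.pos k = P.pos i
    · rw [a.ι_π_of_eq hk]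
    · rw [a.ι_π_of_ne hk, Finsupp.single_eq_of_ne (by rintro rfl; exact hk rfl)]
  have key : b.π (Q.pos j) (f (Finsupp.single i 1)) = b.π (Q.pos j) (f' (Finsupp.single i 1)) := by
    have h' : (real a b hf).toGeom.app (P.pos i) (Q.pos j)
      = (real a b hf').toGeom.app (P.pos i) (Q.pos j) := by rw [h]
    have := LinearMap.congr_fun (congrArg ModuleCat.Hom.hom h')
      (a.π (P.pos i) (Finsupp.single i 1))
    rw [← hi]
    exact this
  rw [← b.ι_π_of_eq rfl (f _), key, b.ι_π_of_eq rfl]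

/-- The automorphism given by an invertible matrix. -/
def autOfUnit (e : (ctlSubring R P)ˣ) : Aut A where
  hom := real a a (mem_ctlSubring.1 e.val.2)
  inv := real a a (mem_ctlSubring.1 e.inv.2)
  hom_inv_id := by
    rw [← real_comp, ← real_id a]
    congr 1
    exact congrArg Subtype.val e.inv_val
  inv_hom_id := by
    rw [← real_comp, ← real_id a]
    congr 1
    exact congrArg Subtype.val e.val_inv

/-- The class in `K₁` of an invertible matrix. -/
def cls (e : (ctlSubring R P)ˣ) : AddK1 (ObsCat R G p) := AddK1.mk (a.autOfUnit e)

theorem cls_mul (e e' : (ctlSubring R P)ˣ) : a.cls (e * e') = a.cls e + a.cls e' := by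
  -- The product of matrices applies the right factor first, whereas `≪≫` is diagrammatic;
  -- commutativity of `K₁` reconciles the two.
  rw [cls, cls, cls, add_comm, ← AddK1.mk_trans]
  congr 1
  exact Iso.ext (real_comp a a a (mem_ctlSubring.1 e'.val.2) (mem_ctlSubring.1 e.val.2))

/-- Stabilization: the class of a matrix does not change under adding the identity matrix of a
complement. -/
theorem cls_eq_of_extend {i : (I →₀ R) →ₗ[R] (J →₀ R)} {r : (J →₀ R) →ₗ[R] (I →₀ R)}
    {q : (J →₀ R) →ₗ[R] (K →₀ R)} {s : (K →₀ R) →ₗ[R] (J →₀ R)}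
    (hi : IsCtl P Q i) (hr : IsCtl Q P r) (hq : IsCtl Q S q) (hs : IsCtl S Q s)
    (hir : r ∘ₗ i = LinearMap.id) (hsq : q ∘ₗ s = LinearMap.id)
    (h : i ∘ₗ r + s ∘ₗ q = LinearMap.id) (hiq : q ∘ₗ i = 0) (c : S.Framing C)
    (e : (ctlSubring R P)ˣ) (e' : (ctlSubring R Q)ˣ)
    (h₁ : i ∘ₗ (e.val.1 : (I →₀ R) →ₗ[R] (I →₀ R)) = (e'.val.1 : (J →₀ R) →ₗ[R] (J →₀ R)) ∘ₗ i)
    (h₂ : q ∘ₗ (e'.val.1 : (J →₀ R) →ₗ[R] (J →₀ R)) = q) :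
    b.cls e' = a.cls e := by
  refine AddK1.mk_eq_of_splitting (i := real a b hi) (r := real b a hr) (q := real b c hq)
    (s := real c b hs) ?_ ?_ ?_ ?_ _ _ ?_ ?_
  · rw [← real_comp, ← real_id a]; congr 1
  · rw [← real_comp, ← real_id c]; congr 1
  · rw [← real_comp, ← real_comp, ← real_add, ← real_id b]; congr 1
  · rw [← real_comp, ← real_zero a c]; congr 1
  · change real a a (mem_ctlSubring.1 e.val.2) ≫ real a b hi =
      real a b hi ≫ real b b (mem_ctlSubring.1 e'.val.2)
    rw [← real_comp, ← real_comp]; congr 1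
  · change real b b (mem_ctlSubring.1 e'.val.2) ≫ real b c hq = real b c hq
    rw [← real_comp]; congr 1

end Functor

end Framing

end Placement

/-! ### The object of a placement -/

theorem Height.continuous_toReal : Continuous Height.toReal := continuous_subtype_val

theorem Height.isCompact_le (B : ℝ) : IsCompact {t : Height | t.toReal ≤ B} := by
  have h : IsClosedEmbedding Height.toReal := isClosed_Ici.isClosedEmbedding_subtypeVal
  have h' := h.isCompact_preimage (isCompact_Icc (a := (1 : ℝ)) (b := B))
  exact h'.of_isClosed_subset (isClosed_le Height.continuous_toReal continuous_const)
    fun t ht => ⟨t.one_le, ht⟩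

/-! ### Representatives and transport in a free G-set -/

section OrbitRep

variable (G : Type*) [Group G] {Y : Type*} [MulAction G Y]

/-- A representative of the orbit of `z`. -/
def orbitRep (z : Y) : Y := Quotient.out (Quotient.mk (MulAction.orbitRel G Y) z)

theorem orbitRep_smul (g : G) (z : Y) : orbitRep G (g • z) = orbitRep G z :=
  congrArg Quotient.out (Quotient.sound (MulAction.orbitRel_apply.2 ⟨g, rfl⟩))

theorem exists_smul_orbitRep (z : Y) : ∃ g : G, g • orbitRep G z = z := by
  obtain ⟨g, hg⟩ := MulAction.orbitRel_apply.1
    (Quotient.exact (Quotient.out_eq (Quotient.mk (MulAction.orbitRel G Y) z)))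
  exact ⟨g⁻¹, inv_smul_eq_iff.2 hg.symm⟩

/-- A group element carrying the representative of the orbit of `z` to `z`. -/
def orbitTransport (z : Y) : G := (exists_smul_orbitRep G z).choose

theorem orbitTransport_smul_orbitRep (z : Y) : orbitTransport G z • orbitRep G z = z :=
  (exists_smul_orbitRep G z).choose_spec

/-- Both sides carry the same representative to `g • z`. Elements doing so are unique only up to the
stabilizer, so freeness is essential. -/
theorem orbitTransport_smul (hfree : ∀ (g : G) (y : Y), g • y = y → g = 1) (g : G) (z : Y) :
    orbitTransport G (g • z) = g * orbitTransport G z := by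
  rw [← inv_mul_eq_one]
  apply hfree _ (orbitRep G z)
  rw [mul_smul, mul_smul, orbitTransport_smul_orbitRep, inv_smul_eq_iff]
  conv_rhs => rw [← orbitRep_smul G g z, orbitTransport_smul_orbitRep]

end OrbitRep

namespace Placement

variable {R : Type u} [Ring R] {G : Type*} [Group G] [MulAction G ℝ] {Xbar : Type*}
  [TopologicalSpace Xbar] [MulAction G Xbar] {p : Xbar → ℝ} {I : Type} [MulAction G I]
  (P : Placement G p I)

/-- The free module on the basis elements over `r`. -/
abbrev fiberModule (R : Type u) [Ring R] (r : Xbar × Height) : ModuleCat.{u} R :=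
  ModuleCat.of R ({i // P.pos i = r} →₀ R)

theorem exists_pos_eq_of_nontrivial {z : Xbar × Height}
    (h : Nontrivial (P.fiberModule R (orbitRep G z))) : ∃ i, P.pos i = z := by
  obtain h' | ⟨⟨i, hi⟩⟩ := isEmpty_or_nonempty {i // P.pos i = orbitRep G z}
  · exact absurd h (not_nontrivial_iff_subsingleton.2 inferInstance)
  · exact ⟨orbitTransport G z • i, by rw [P.pos_smul, hi, orbitTransport_smul_orbitRep]⟩

variable (R) in
/-- The object of the obstruction category with basis given by a placement. -/
def toObsCat [LineCover G p] : ObsCat R G p where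
  toGeom :=
    -- Invariance demands an equality of modules along an orbit, so every point receives the fibre
    -- over the representative of its orbit.
    { mod z := P.fiberModule R (orbitRep G z)
      free _ := inferInstanceAs (Module.Free R (_ →₀ R))
      finite z :=
        haveI : Finite {i // P.pos i = orbitRep G z} := P.finite_fiber _
        inferInstanceAs (Module.Finite R (_ →₀ R))
      locallyFinite y := by
        have hp : Continuous p := LineCover.continuous (G := G)
        refine ⟨{z | |p z.1| < |p y.1| + 1 ∧ z.2.toReal < y.2.toReal + 1},
          (IsOpen.and (isOpen_lt (by fun_prop) continuous_const)
            (isOpen_lt (Height.continuous_toReal.comp continuous_snd)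
              continuous_const)).mem_nhds ⟨lt_add_one _, lt_add_one _⟩, ?_⟩
        refine ((P.finite (max (|p y.1| + 1) (y.2.toReal + 1))).image P.pos).subset ?_
        rintro z ⟨⟨h1, h2⟩, hz⟩
        obtain ⟨i, rfl⟩ := P.exists_pos_eq_of_nontrivial hz
        exact ⟨i, ⟨h1.le.trans (le_max_left _ _), h2.le.trans (le_max_right _ _)⟩, rfl⟩ }
  invariant g z := congrArg (P.fiberModule R) (orbitRep_smul G g z)
  support := ⟨Set.univ, isGCompact_univ p, fun _ _ => trivial⟩

theorem orbitTransport_smul_injective (z : Xbar × Height) : Function.Injective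
    fun k : {i // P.pos i = orbitRep G z} => orbitTransport G z • k.1 :=
  (MulAction.injective _).comp Subtype.val_injective

/-- The base points are kept as variables so that the equality between them can be substituted. -/
theorem mapDomain_eqToHom {r r' : Xbar × Height} (h : r = r') (g : G) (v : P.fiberModule R r) :
    Finsupp.mapDomain (fun k : {i // P.pos i = r'} => g • k.1)
      ((eqToHom (congrArg (P.fiberModule R) h)).hom v) =
    Finsupp.mapDomain (fun k : {i // P.pos i = r} => g • k.1) v := by
  subst h
  rfl

variable (R) in
/-- The tautological framing of the object of a placement. -/
def framing [LineCover G p] : P.Framing (P.toObsCat R) where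
  ι z := Finsupp.lmapDomain R R fun k : {i // P.pos i = orbitRep G z} => orbitTransport G z • k.1
  π z := Finsupp.lcomapDomain _ (P.orbitTransport_smul_injective z)
  π_ι z v := Finsupp.comapDomain_mapDomain _ (P.orbitTransport_smul_injective z) v
  ι_π_of_eq {z i} h v := by
    have hi : P.pos ((orbitTransport G z)⁻¹ • i) = orbitRep G z := by
      rw [P.pos_smul, h, inv_smul_eq_iff, orbitTransport_smul_orbitRep]
    have := Finsupp.mapDomain_apply (P.orbitTransport_smul_injective z)
      (Finsupp.comapDomain _ v (P.orbitTransport_smul_injective z).injOn) ⟨_, hi⟩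
    simp only [smul_inv_smul] at this
    refine this.trans ?_
    rw [Finsupp.comapDomain_apply]
    exact congrArg v (smul_inv_smul _ i)
  ι_π_of_ne {z i} h v := by
    refine Finsupp.mapDomain_of_notMem_range _ _ ?_
    rintro ⟨⟨k, hk⟩, rfl⟩
    exact h (by rw [P.pos_smul, hk, orbitTransport_smul_orbitRep])
  ι_smul g z v := by
    have hfree : ∀ (g : G) (y : Xbar × Height), g • y = y → g = 1 := fun g y h =>
      LineCover.free (p := p) g y.1 (congrArg Prod.fst h)
    refine Eq.trans (congrArg (fun h => Finsupp.mapDomain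
      (fun k : {i // P.pos i = orbitRep G (g • z)} => h • k.1) v)
      (orbitTransport_smul G hfree g z)) ((P.mapDomain_eqToHom (orbitRep_smul G g z)
        (g * orbitTransport G z) v).symm.trans ?_)
    simp only [mul_smul]
    exact Finsupp.mapDomain_comp (f := fun k : {i // P.pos i = orbitRep G z} =>
      orbitTransport G z • k.1) (g := (g • ·))

end Placement

/-! ### Framings of arbitrary objects -/

section Basis

variable {R : Type u} [Ring R]

/-- The smallest size of a finite basis. -/
def basisSize (M : ModuleCat.{u} R) : ℕ := sInf {n | Nonempty (Module.Basis (Fin n) R M)}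

theorem nonempty_basis (M : ModuleCat.{u} R) (h : Module.Free R M) (h' : Module.Finite R M) :
    Nonempty (Module.Basis (Fin (basisSize M)) R M) := by
  obtain _ | _ := subsingleton_or_nontrivial R
  · have : Subsingleton M := Module.subsingleton R M
    exact Nat.sInf_mem (s := {n | Nonempty (Module.Basis (Fin n) R M)})
      ⟨0, ⟨Module.Basis.empty M⟩⟩
  · exact Nat.sInf_mem (s := {n | Nonempty (Module.Basis (Fin n) R M)})
      ⟨_, ⟨(Module.Free.chooseBasis R M).reindex (Fintype.equivFin _)⟩⟩

/-- Over the zero ring a zero module has bases of every finite size. Taking the minimum ensures that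
no basis element lies outside the support of an object. -/
theorem basisSize_eq_zero (M : ModuleCat.{u} R) (h : Subsingleton M) : basisSize M = 0 :=
  Nat.sInf_eq_zero.2 (Or.inl ⟨Module.Basis.empty M⟩)

/-- A finite basis of a finitely generated free module, depending on the module only. -/
def finBasis (M : ModuleCat.{u} R) (h : Module.Free R M) (h' : Module.Finite R M) :
    Module.Basis (Fin (basisSize M)) R M := (nonempty_basis M h h').some

/-- The basis is a function of the module and not of the point where it sits. The equality of the
modules at `z` and `g • z` therefore matches their bases, and G permutes the basis elements of an
object. -/
theorem finBasis_repr_eqToHom {M M' : ModuleCat.{u} R} (e : M = M') (h h' k k') (v : M) (n : ℕ)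
    (hn : n < basisSize M) (hn' : n < basisSize M') :
    (finBasis M' k k').repr ((eqToHom e).hom v) ⟨n, hn'⟩ = (finBasis M h h').repr v ⟨n, hn⟩ := by
  subst e
  rfl

end Basis

namespace ObsCat

variable {R : Type u} [Ring R] {G : Type*} [Group G] [MulAction G ℝ] {Xbar : Type}
  [TopologicalSpace Xbar] [MulAction G Xbar] {p : Xbar → ℝ} (A : ObsCat R G p)

/-- The basis elements of an object of the obstruction category. -/
def BasisIndex : Type := {q : (Xbar × Height) × ℕ // q.2 < basisSize (A.toGeom.mod q.1)}

instance : MulAction G A.BasisIndex where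
  smul g q := ⟨(g • q.1.1, q.1.2), by
    rw [A.invariant g q.1.1]
    exact q.2⟩
  one_smul q := Subtype.ext (Prod.ext (one_smul G q.1.1) rfl)
  mul_smul g h q := Subtype.ext (Prod.ext (mul_smul g h q.1.1) rfl)

theorem nontrivial_of_basisIndex (q : A.BasisIndex) : q.1.1 ∈ A.toGeom.supp := by
  by_contra h
  have := basisSize_eq_zero _ (not_nontrivial_iff_subsingleton.1 h)
  exact absurd q.2 (by omega)

theorem finite_supp_inter {K : Set (Xbar × Height)} (hK : IsCompact K) :
    (K ∩ A.toGeom.supp).Finite := by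
  choose U hU hU' using A.toGeom.locallyFinite
  obtain ⟨t, -, ht⟩ := hK.elim_nhds_subcover U fun x _ => hU x
  refine (t.finite_toSet.biUnion fun x _ => hU' x).subset fun z hz => ?_
  obtain ⟨x, hx, hzx⟩ := Set.mem_iUnion₂.1 (ht hz.1)
  exact Set.mem_biUnion (x := x) hx ⟨hzx, hz.2⟩

/-- The placement of the basis elements of an object. -/
def placement [LineCover G p] : Placement G p A.BasisIndex where
  pt q := q.1.1.1
  ht q := q.1.1.2
  pt_smul _ _ := rfl
  ht_smul _ _ := rfl
  finite B := by
    have hK := (LineCover.isCompact (G := G) (p := p) B).prod (Height.isCompact_le B)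
    refine Set.Finite.preimage (f := fun q : A.BasisIndex => q.1) Subtype.val_injective.injOn
      (s := ⋃ z ∈ (_ ∩ A.toGeom.supp), (Prod.mk z) '' (Set.Iio (basisSize (A.toGeom.mod z))))
      ((A.finite_supp_inter hK).biUnion fun z _ => (Set.finite_Iio _).image _) |>.subset ?_
    rintro q ⟨h1, h2⟩
    exact Set.mem_biUnion (x := q.1.1) ⟨⟨h1, h2⟩, A.nontrivial_of_basisIndex q⟩
      ⟨q.1.2, q.2, rfl⟩

/-- The inclusion of the basis elements over `z`. -/
def basisIncl (z : Xbar × Height) (k : Fin (basisSize (A.toGeom.mod z))) : A.BasisIndex :=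
  ⟨(z, k), k.2⟩

theorem basisIncl_injective (z : Xbar × Height) : Function.Injective (A.basisIncl z) :=
  fun _ _ h => Fin.ext (congrArg (fun q : A.BasisIndex => q.1.2) h)

/-- Every object of the obstruction category has a framing. -/
def framing [LineCover G p] : A.placement.Framing A where
  ι z := Finsupp.lmapDomain R R (A.basisIncl z) ∘ₗ
    (finBasis _ (A.toGeom.free z) (A.toGeom.finite z)).repr.toLinearMap
  π z := (finBasis _ (A.toGeom.free z) (A.toGeom.finite z)).repr.symm.toLinearMap ∘ₗ
    Finsupp.lcomapDomain _ (A.basisIncl_injective z)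
  π_ι z v := by
    change (finBasis _ _ _).repr.symm (Finsupp.comapDomain _ (Finsupp.mapDomain _ _) _) = v
    exact (congrArg _ (Finsupp.comapDomain_mapDomain _ (A.basisIncl_injective z) _)).trans
      (LinearEquiv.symm_apply_apply _ _)
  ι_π_of_eq {z q} h v := by
    subst h
    change Finsupp.mapDomain _ ((finBasis _ _ _).repr ((finBasis _ _ _).repr.symm _)) q = _
    rw [LinearEquiv.apply_symm_apply]
    exact Finsupp.mapDomain_apply (A.basisIncl_injective _) _ ⟨q.1.2, q.2⟩
  ι_π_of_ne {z q} h v := by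
    refine Finsupp.mapDomain_of_notMem_range _ _ ?_
    rintro ⟨k, rfl⟩
    exact h rfl
  ι_smul g z v := by
    ext q
    obtain ⟨q, rfl⟩ := MulAction.surjective g q
    rw [gtranslate_apply_smul]
    by_cases h : A.placement.pos q = z
    · subst h
      refine (Finsupp.mapDomain_apply (A.basisIncl_injective _) _ ⟨q.1.2, (g • q).2⟩).trans
        (Eq.trans ?_
          (Finsupp.mapDomain_apply (A.basisIncl_injective _) _ ⟨q.1.2, q.2⟩).symm)
      exact (finBasis_repr_eqToHom (A.invariant g q.1.1) _ _ _ _ v _ _ _).symm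
    · refine (Finsupp.mapDomain_of_notMem_range _ _ ?_).trans
        (Finsupp.mapDomain_of_notMem_range _ _ ?_).symm
      · rintro ⟨k, hk⟩
        exact h (MulAction.injective g (congrArg (fun q : A.BasisIndex => q.1.1) hk)).symm
      · rintro ⟨k, rfl⟩
        exact h rfl

end ObsCat

/-! ### The matrix of a morphism -/

namespace Placement.Framing

variable {R : Type u} [Ring R] {G : Type*} [Group G] [MulAction G ℝ] {Xbar : Type*}
  [TopologicalSpace Xbar] [MulAction G Xbar] {p : Xbar → ℝ}
  {I J : Type} [MulAction G I] [MulAction G J]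
  {P : Placement G p I} {Q : Placement G p J} {A B : ObsCat R G p}
  (a : P.Framing A) (b : Q.Framing B) (φ : A ⟶ B)

/-- The matrix of a morphism. -/
def matrix : (I →₀ R) →ₗ[R] (J →₀ R) :=
  Finsupp.lsum ℕ fun i =>
    (∑ w ∈ (φ.toGeom.finite_right (P.pos i)).toFinset,
      b.ι w ∘ₗ (φ.toGeom.app (P.pos i) w).hom ∘ₗ a.π (P.pos i)) ∘ₗ Finsupp.lsingle i

theorem matrix_entry {i : I} {j : J} {z w : Xbar × Height} (hi : P.pos i = z) (hj : Q.pos j = w) :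
    matrix a b φ (Finsupp.single i 1) j =
      b.ι w ((φ.toGeom.app z w).hom (a.π z (Finsupp.single i 1))) j := by
  subst hi hj
  rw [matrix, Finsupp.lsum_single, LinearMap.comp_apply, LinearMap.sum_apply,
    Finsupp.finsetSum_apply]
  rw [Finset.sum_eq_single (Q.pos j)]
  · rfl
  · intro w _ hw
    exact b.ι_apply_of_ne hw.symm _
  · intro h
    rw [Set.Finite.mem_toFinset, Set.mem_ofPred_eq, not_not] at h
    simp [h]

theorem matrix_suppIn :
    SuppIn (matrix a b φ) fun i j => φ.toGeom.app (P.pos i) (Q.pos j) ≠ 0 := fun i j h h0 => by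
  rw [matrix_entry a b φ rfl rfl, h0] at h
  simp at h

theorem π_matrix_ι (z w : Xbar × Height) (v : A.toGeom.mod z) :
    b.π w (matrix a b φ (a.ι z v)) = (φ.toGeom.app z w).hom v := by
  apply b.ι_injective
  ext j
  by_cases hj : Q.pos j = w
  · rw [b.ι_π_of_eq hj, Finsupp.linearMap_apply_eq_sum]
    conv_rhs => rw [← a.π_ι z v]
    change _ = (b.ι w ∘ₗ (φ.toGeom.app z w).hom ∘ₗ a.π z) (a.ι z v) j
    rw [Finsupp.linearMap_apply_eq_sum]
    refine Finset.sum_congr rfl fun i hi => ?_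
    have hi : P.pos i = z := by
      by_contra h
      exact Finsupp.mem_support_iff.1 hi (a.ι_apply_of_ne h v)
    dsimp only
    rw [matrix_entry a b φ hi hj]
    rfl
  · rw [b.ι_π_of_ne hj, b.ι_apply_of_ne hj]

theorem isEquivariant_matrix :
    IsEquivariant G (matrix a b φ) := isEquivariant_of_single fun g i => by
  ext j
  obtain ⟨j, rfl⟩ := MulAction.surjective g j
  rw [gtranslate_apply_smul, matrix_entry a b φ (P.pos_smul g i) (Q.pos_smul g j),
    matrix_entry a b φ rfl rfl, ← gtranslate_single, a.π_smul, φ.invariant, b.ι_smul,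
    gtranslate_apply_smul]
  simp only [← ModuleCat.comp_apply, Category.assoc, eqToHom_trans, eqToHom_trans_assoc,
    eqToHom_refl, Category.id_comp, Category.comp_id]

/-- The control condition yields the vertical bound and the horizontal one at large heights. The
horizontal bound at low heights is taken from `hD`, which the smallness of an automorphism provides.
-/
theorem isCtl_matrix [LineCover G p] (D : ℝ)
    (hD : ∀ z w, φ.toGeom.app z w ≠ 0 → |p z.1 - p w.1| ≤ D) : IsCtl P Q (matrix a b φ) := by
  obtain ⟨E, hE, hφ⟩ := φ.controlled
  refine .of_suppIn (isEquivariant_matrix a b φ) (matrix_suppIn a b φ) ⟨?_, fun ε hε => ?_⟩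
  · obtain ⟨δ, hδ⟩ := hE.vertical
    exact ⟨max D δ, fun i j hij => ⟨(hD _ _ hij).trans (le_max_left _ _),
      (hδ _ _ (hφ (a := (_, _)) hij)).trans (le_max_right _ _)⟩⟩
  · obtain ⟨T, hT⟩ := hE.exists_height p hε
    refine ⟨T, fun i j hij ht => ?_⟩
    rw [abs_sub_comm]
    exact hT _ _ (hE.symm _ _ (hφ (a := (_, _)) hij)) ht

theorem real_matrix [LineCover G p] (h : IsCtl P Q (matrix a b φ)) : real a b h = φ :=
  hom_ext' fun z w v => π_matrix_ι a b φ z w v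

/-- Automorphisms of bounded size are given by invertible matrices. -/
theorem exists_unit_of_bounded [LineCover G p] (α : Aut A) (D : ℝ)
    (h : ∀ z w, α.hom.toGeom.app z w ≠ 0 → |p z.1 - p w.1| ≤ D)
    (h' : ∀ z w, α.inv.toGeom.app z w ≠ 0 → |p z.1 - p w.1| ≤ D) :
    ∃ e : (ctlSubring R P)ˣ, a.autOfUnit e = α ∧
      SuppIn e.val.1 (fun i j => |P.loc i - P.loc j| ≤ D) ∧
      SuppIn e.inv.1 fun i j => |P.loc i - P.loc j| ≤ D := by
  have hm := isCtl_matrix a a α.hom D h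
  have hm' := isCtl_matrix a a α.inv D h'
  refine ⟨⟨⟨_, hm⟩, ⟨_, hm'⟩, Subtype.ext ?_, Subtype.ext ?_⟩,
    Iso.ext (real_matrix a a α.hom hm), ?_, ?_⟩
  · refine real_injective a a (hf := hm'.comp hm) (hf' := IsCtl.id) ?_
    rw [real_comp a a a hm' hm, real_matrix, real_matrix, real_id, α.inv_hom_id]
  · refine real_injective a a (hf := hm.comp hm') (hf' := IsCtl.id) ?_
    rw [real_comp a a a hm hm', real_matrix, real_matrix, real_id, α.hom_inv_id]
  · exact (matrix_suppIn a a α.hom).mono fun i j => h _ _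
  · exact (matrix_suppIn a a α.inv).mono fun i j => h' _ _

end Placement.Framing

theorem ObsCat.abs_le_of_hsize_lt {R : Type u} [Ring R] {G : Type*} [Group G] [MulAction G ℝ]
    {Xbar : Type*} [TopologicalSpace Xbar] [MulAction G Xbar] {p : Xbar → ℝ} {A B : ObsCat R G p}
    {φ : A ⟶ B} {ε : ℝ} (h : ObsCat.hsize φ < ENNReal.ofReal ε) (z w : Xbar × Height)
    (hzw : φ.toGeom.app z w ≠ 0) : |p z.1 - p w.1| ≤ ε := by
  have h1 : edist (p z.1) (p w.1) ≤ ObsCat.hsize φ :=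
    le_iSup₂ (f := fun (y : (Xbar × Height) × (Xbar × Height)) (_ : y ∈ φ.toGeom.supp) =>
      edist (p y.1.1) (p y.2.1)) (z, w) hzw
  have h2 := h1.trans_lt h
  rw [edist_lt_ofReal, Real.dist_eq] at h2
  exact h2.le

/-! ### Towers -/

/-- The disjoint union of copies of `I` indexed by `M`. -/
@[ext]
structure Tower (M I : Type) : Type where
  level : M
  elt : I

instance {G : Type*} [Group G] {M I : Type} [MulAction G I] : MulAction G (Tower M I) where
  smul g a := ⟨a.1, g • a.2⟩
  one_smul a := Tower.ext rfl (one_smul G a.2)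
  mul_smul g h a := Tower.ext rfl (mul_smul g h a.2)

namespace Tower

variable {R : Type u} [Ring R] {M I : Type}

variable (R) in
/-- The inclusion of a level. -/
def incl (m : M) : (I →₀ R) →ₗ[R] (Tower M I →₀ R) :=
  Finsupp.lmapDomain R R (Tower.mk m)

theorem incl_single (m : M) (i : I) (a : R) :
    incl R m (Finsupp.single i a) = Finsupp.single (⟨m, i⟩ : Tower M I) a :=
  Finsupp.mapDomain_single

theorem incl_apply (m : M) (v : I →₀ R) (i : I) : incl R m v (⟨m, i⟩ : Tower M I) = v i :=
  Finsupp.mapDomain_apply (fun _ _ h => congrArg Tower.elt h) v i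

theorem incl_apply_of_ne {m : M} {a : Tower M I} (h : a.1 ≠ m) (v : I →₀ R) :
    incl R m v a = 0 := by
  refine Finsupp.mapDomain_of_notMem_range _ _ ?_
  rintro ⟨i, rfl⟩
  exact h rfl

theorem linearMap_ext {N : Type*} [AddCommGroup N] [Module R N]
    {f g : (Tower M I →₀ R) →ₗ[R] N} (h : ∀ m v, f (incl R m v) = g (incl R m v)) : f = g :=
  Finsupp.lhom_ext' fun a => LinearMap.ext_ring (by
    have := h a.1 (Finsupp.single a.2 1)
    rwa [incl_single] at this)

variable (R I) in
/-- The shift of the levels. -/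
def shift (k : ℤ) : Module.End R (Tower ℤ I →₀ R) :=
  Finsupp.lmapDomain R R fun a => ⟨a.1 + k, a.2⟩

theorem shift_incl (k m : ℤ) (v : I →₀ R) : shift R I k (incl R m v) = incl R (m + k) v :=
  (Finsupp.mapDomain_comp (v := v) (f := Tower.mk m)
    (g := fun a : Tower ℤ I => (⟨a.1 + k, a.2⟩ : Tower ℤ I))).symm

theorem shift_mul_shift (k l : ℤ) : shift R I k * shift R I l = shift R I (l + k) :=
  linearMap_ext fun m v => by
    rw [Module.End.mul_apply, shift_incl, shift_incl, shift_incl, add_assoc]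

theorem shift_zero : shift R I 0 = 1 := linearMap_ext fun m v => by
  rw [shift_incl, add_zero]; rfl

theorem shift_suppIn (k : ℤ) : SuppIn (shift R I k) fun a b => a.2 = b.2 ∧ b.1 = a.1 + k :=
  fun a b h => by
    by_contra hab
    refine h ?_
    rw [shift, Finsupp.lmapDomain_apply, Finsupp.mapDomain_single, Finsupp.single_eq_of_ne]
    rintro rfl
    exact hab ⟨rfl, rfl⟩

/-- The endomorphism acting by `f m` on level `m`. -/
def diag (f : M → Module.End R (I →₀ R)) : Module.End R (Tower M I →₀ R) :=
  Finsupp.lsum ℕ fun a => incl R a.1 ∘ₗ f a.1 ∘ₗ Finsupp.lsingle a.2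

theorem diag_incl (f : M → Module.End R (I →₀ R)) (m : M) (v : I →₀ R) :
    diag f (incl R m v) = incl R m (f m v) := by
  suffices h : diag f ∘ₗ incl R m = incl R m ∘ₗ f m from LinearMap.congr_fun h v
  refine Finsupp.lhom_ext' fun i => LinearMap.ext_ring ?_
  simp only [LinearMap.comp_apply, Finsupp.lsingle_apply, incl_single]
  rw [diag, Finsupp.lsum_single]
  rfl

theorem diag_mul_diag (f g : M → Module.End R (I →₀ R)) :
    diag f * diag g = diag fun m => f m * g m :=
  linearMap_ext fun m v => by
    rw [Module.End.mul_apply, diag_incl, diag_incl, diag_incl, Module.End.mul_apply]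

open Classical in
/-- The endomorphism acting by `x` on the levels in `q` and trivially on the others. -/
def onLevels (q : M → Prop) (x : Module.End R (I →₀ R)) : Module.End R (Tower M I →₀ R) :=
  diag fun m => if q m then x else 1

theorem onLevels_incl_of_pos {q : M → Prop} {m : M} (h : q m) (x : Module.End R (I →₀ R))
    (v : I →₀ R) : onLevels q x (incl R m v) = incl R m (x v) := by
  rw [onLevels, diag_incl, if_pos h]

theorem onLevels_incl_of_neg {q : M → Prop} {m : M} (h : ¬q m) (x : Module.End R (I →₀ R))
    (v : I →₀ R) : onLevels q x (incl R m v) = incl R m v := by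
  rw [onLevels, diag_incl, if_neg h]; rfl

theorem onLevels_mul_eq_one (q : M → Prop) {x y : Module.End R (I →₀ R)} (h : x * y = 1) :
    onLevels q x * onLevels q y = 1 := by
  refine linearMap_ext fun m v => ?_
  rw [Module.End.mul_apply]
  by_cases hm : q m
  · rw [onLevels_incl_of_pos hm, onLevels_incl_of_pos hm, ← Module.End.mul_apply, h]; rfl
  · rw [onLevels_incl_of_neg hm, onLevels_incl_of_neg hm]; rfl

/-- One of the two identities behind the swindle: it splits off the copy on level zero, while
`shift_mul_onLevels` makes the rest conjugate to the whole. -/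
theorem onLevels_mul_onLevels (x : Module.End R (I →₀ R)) :
    onLevels (fun m : ℤ => m = 0) x * onLevels (fun m => 1 ≤ m) x =
      onLevels (fun m => 0 ≤ m) x := by
  refine linearMap_ext fun m v => ?_
  rw [Module.End.mul_apply]
  obtain hm | rfl | hm := lt_trichotomy m 0
  · rw [onLevels_incl_of_neg (by omega), onLevels_incl_of_neg (by omega),
      onLevels_incl_of_neg (by omega)]
  · rw [onLevels_incl_of_neg (by omega), onLevels_incl_of_pos (q := (· = 0)) rfl,
      onLevels_incl_of_pos le_rfl]
  · rw [onLevels_incl_of_pos (by omega), onLevels_incl_of_neg (by omega),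
      onLevels_incl_of_pos (by omega)]

theorem shift_mul_onLevels (x : Module.End R (I →₀ R)) :
    shift R I 1 * onLevels (fun m : ℤ => 0 ≤ m) x = onLevels (fun m => 1 ≤ m) x * shift R I 1 := by
  refine linearMap_ext fun m v => ?_
  rw [Module.End.mul_apply, Module.End.mul_apply, shift_incl]
  by_cases hm : 0 ≤ m
  · rw [onLevels_incl_of_pos hm, onLevels_incl_of_pos (by omega), shift_incl]
  · rw [onLevels_incl_of_neg hm, onLevels_incl_of_neg (by omega), shift_incl]

theorem shift_mul_diag (k : ℤ) (f : ℤ → Module.End R (I →₀ R)) :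
    shift R I k * diag f = diag (fun m => f (m - k)) * shift R I k :=
  linearMap_ext fun m v => by
    rw [Module.End.mul_apply, diag_incl, shift_incl, Module.End.mul_apply, shift_incl, diag_incl,
      add_sub_cancel_right]

theorem diag_suppIn {f : M → Module.End R (I →₀ R)} {r : M → I → I → Prop}
    (h : ∀ m, SuppIn (f m) (r m)) : SuppIn (diag f) fun a b => a.1 = b.1 ∧ r a.1 a.2 b.2 := by
  rintro ⟨m, i⟩ ⟨n, j⟩ hab
  rw [← incl_single, diag_incl] at hab
  obtain rfl : n = m := by
    by_contra hne
    exact hab (incl_apply_of_ne hne _)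
  rw [incl_apply] at hab
  exact ⟨rfl, h _ i j hab⟩

section

variable {G : Type*} [Group G] [MulAction G I]

theorem gtranslate_incl (g : G) (m : M) (v : I →₀ R) :
    gtranslate R g (incl R m v) = incl R m (gtranslate R g v) :=
  (Finsupp.mapDomain_comp (v := v) (f := Tower.mk m)
    (g := fun a : Tower M I => g • a)).symm.trans
      (Finsupp.mapDomain_comp (v := v) (f := fun i : I => g • i) (g := Tower.mk m))

theorem isEquivariant_of_incl {J : Type} [MulAction G J] {f : (Tower M I →₀ R) →ₗ[R] (J →₀ R)}
    (h : ∀ (g : G) m v, f (incl R m (gtranslate R g v)) = gtranslate R g (f (incl R m v))) :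
    IsEquivariant G f := fun g => by
  suffices h' : f ∘ₗ gtranslate R g = gtranslate R g ∘ₗ f from fun v => LinearMap.congr_fun h' v
  refine linearMap_ext fun m v => ?_
  rw [LinearMap.comp_apply, gtranslate_incl, h]
  rfl

theorem isEquivariant_shift (k : ℤ) : IsEquivariant G (shift R I k) :=
  isEquivariant_of_incl fun g m v => by rw [shift_incl, shift_incl, gtranslate_incl]

theorem isEquivariant_diag {f : M → Module.End R (I →₀ R)} (h : ∀ m, IsEquivariant G (f m)) :
    IsEquivariant G (diag f) :=
  isEquivariant_of_incl fun g m v => by rw [diag_incl, diag_incl, gtranslate_incl, h]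

end

end Tower

/-- On level `m` the tower contracts distances to the center by `h / (h + m)`. This estimate
controls the shift between levels, and the next one controls matrix entries on a fixed level; both
errors decay with the height `h + m`. -/
theorem abs_div_add_sub_div_add_le_of_abs_sub_le_one {h m n : ℝ} (hh : 1 ≤ h) (hm : 0 ≤ m)
    (hn : 0 ≤ n) (hmn : |m - n| ≤ 1) : |h / (h + m) - h / (h + n)| ≤ 1 / (h + m) := by
  have h1 : 0 < h + m := by linarith
  have h2 : 0 < h + n := by linarith
  have : h / (h + m) - h / (h + n) = (h / (h + n)) * (n - m) / (h + m) := by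
    field_simp
    ring
  rw [this, abs_div, abs_of_pos h1, abs_mul, abs_sub_comm,
    abs_of_nonneg (div_nonneg (by linarith) h2.le)]
  gcongr
  exact mul_le_one₀ ((div_le_one h2).2 (by linarith)) (abs_nonneg _) hmn

theorem abs_div_add_sub_div_add_le {h k m D : ℝ} (hh : 1 ≤ h) (hk : 1 ≤ k) (hm : 0 ≤ m)
    (hhk : |h - k| ≤ D) : |h / (h + m) - k / (k + m)| ≤ D / (h + m) := by
  have h1 : 0 < h + m := by linarith
  have h2 : 0 < k + m := by linarith
  have : h / (h + m) - k / (k + m) = (m / (k + m)) * (h - k) / (h + m) := by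
    field_simp
    ring
  rw [this, abs_div, abs_of_pos h1, abs_mul, abs_of_nonneg (div_nonneg hm h2.le)]
  gcongr
  calc m / (k + m) * |h - k| ≤ 1 * |h - k| := by
        gcongr
        exact (div_le_one h2).2 (by linarith)
    _ ≤ D := by rwa [one_mul]

/-! ### The tower over a placement and its controlled endomorphisms -/

namespace Placement

variable {R : Type u} [Ring R] {G : Type*} [Group G] [MulAction G ℝ] {Xbar : Type*}
  [TopologicalSpace Xbar] [MulAction G Xbar] {p : Xbar → ℝ} {I : Type} [MulAction G I]

/-- Equivariant points of the line at distance at most `1` from the basis elements. -/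
structure Center (P : Placement G p I) where
  toFun : I → ℝ
  map_smul : ∀ (g : G) i, toFun (g • i) = g • toFun i
  abs_sub_le : ∀ i, |P.loc i - toFun i| ≤ 1

variable [LineCover G p] (P : Placement G p I) (c : P.Center)

/-- The position on level `m` of the tower: in the cone over the line, basis elements move
vertically by `|m|`, so that their distance to the center shrinks. -/
def towerLoc (m : ℤ) (i : I) : ℝ :=
  c.toFun i + P.hgt i / (P.hgt i + |(m : ℝ)|) * (P.loc i - c.toFun i)

/-- An affine combination of equivariant points with invariant weights is equivariant, since G acts
by affine maps. -/
theorem towerLoc_smul (m : ℤ) (g : G) (i : I) :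
    P.towerLoc c m (g • i) = g • P.towerLoc c m i := by
  obtain ⟨n, h⟩ | ⟨n, h⟩ := LineCover.smul_eq p g <;>
  · rw [towerLoc, towerLoc, c.map_smul, P.loc_smul, P.hgt_smul, h, h, h]
    ring

theorem ratio_mem (m : ℤ) (i : I) : P.hgt i / (P.hgt i + |(m : ℝ)|) ∈ Set.Icc (0 : ℝ) 1 := by
  have h := P.hgt_pos i
  have h' := abs_nonneg (m : ℝ)
  exact ⟨div_nonneg h.le (by linarith), (div_le_one (by linarith)).2 (by linarith)⟩

theorem towerLoc_zero (i : I) : P.towerLoc c 0 i = P.loc i := by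
  have := (P.hgt_pos i).ne'
  simp [towerLoc, this]

theorem abs_towerLoc_sub_center_le (m : ℤ) (i : I) :
    |P.towerLoc c m i - c.toFun i| ≤ |P.loc i - c.toFun i| := by
  rw [towerLoc, add_sub_cancel_left, abs_mul, abs_of_nonneg (P.ratio_mem m i).1]
  exact mul_le_of_le_one_left (abs_nonneg _) (P.ratio_mem m i).2

/-- The tower on a placement. -/
def tower : Placement G p (Tower ℤ I) where
  pt a := LineCover.move G p (P.pt a.2) (P.towerLoc c a.1 a.2)
  ht a := ⟨(P.ht a.2).toReal + |(a.1 : ℝ)|, by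
    have := (P.ht a.2).one_le
    have := abs_nonneg (a.1 : ℝ)
    rw [Set.mem_Ici]
    linarith⟩
  pt_smul g a := by
    rw [LineCover.smul_move, ← towerLoc_smul, ← P.pt_smul]
    rfl
  ht_smul g a := by
    apply Subtype.ext
    change P.hgt (g • a.2) + |(a.1 : ℝ)| = P.hgt a.2 + |(a.1 : ℝ)|
    rw [P.hgt_smul]
  finite B := by
    -- The height bounds the level. The positions before and after contraction are both within 1 of
    -- the center, hence within 2 of each other.
    refine (((Set.finite_Icc (-⌊B⌋) ⌊B⌋).prod (P.finite (B + 2))).preimage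
      (f := fun a : Tower ℤ I => (a.1, a.2)) fun a _ b _ h => Tower.ext (congrArg Prod.fst h)
        (congrArg Prod.snd h)).subset ?_
    rintro ⟨m, i⟩ ⟨h1, h2⟩
    change P.hgt i + |(m : ℝ)| ≤ B at h2
    rw [LineCover.map_move (p := p)] at h1
    change |P.towerLoc c m i| ≤ B at h1
    have h3 := P.hgt_pos i
    have h4 := abs_nonneg (m : ℝ)
    have h5 : |m| ≤ ⌊B⌋ := by
      rw [Int.le_floor]
      push_cast
      linarith
    refine ⟨abs_le.1 h5, ?_, ?_⟩
    · have h6 := abs_le.1 (c.abs_sub_le i)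
      have h7 := abs_le.1 ((P.abs_towerLoc_sub_center_le c m i).trans (c.abs_sub_le i))
      have h8 := abs_le.1 h1
      change |P.loc i| ≤ B + 2
      exact abs_le.2 ⟨by linarith, by linarith⟩
    · change P.hgt i ≤ B + 2
      linarith

theorem tower_loc (a : Tower ℤ I) : (P.tower c).loc a = P.towerLoc c a.1 a.2 :=
  LineCover.map_move _ _

theorem tower_hgt (a : Tower ℤ I) : (P.tower c).hgt a = P.hgt a.2 + |(a.1 : ℝ)| := rfl

theorem tower_pos_zero (i : I) : (P.tower c).pos ⟨0, i⟩ = P.pos i := by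
  refine Prod.ext ?_ (Subtype.ext ?_)
  · change LineCover.move G p (P.pt i) (P.towerLoc c 0 i) = P.pt i
    rw [towerLoc_zero]
    exact LineCover.move_map _
  · change P.hgt i + |((0 : ℤ) : ℝ)| = P.hgt i
    simp

/-- One step along a ray changes the contraction factor by at most the inverse of the height, and
this is multiplied by a distance to the center of at most 1. -/
theorem isSqueezing_shift : (P.tower c).IsSqueezing (P.tower c) fun a b =>
    a.2 = b.2 ∧ |a.1 - b.1| ≤ 1 := by
  have key : ∀ a b : Tower ℤ I, a.2 = b.2 ∧ |a.1 - b.1| ≤ 1 →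
      |(|(a.1 : ℝ)| - |(b.1 : ℝ)|)| ≤ 1 ∧
      |(P.tower c).loc a - (P.tower c).loc b| ≤ 1 / (P.tower c).hgt a := by
    rintro ⟨m, i⟩ ⟨n, j⟩ ⟨h, hmn⟩
    obtain rfl : i = j := h
    have hmn' : |(|(m : ℝ)| - |(n : ℝ)|)| ≤ 1 :=
      (abs_abs_sub_abs_le _ _).trans (by exact_mod_cast hmn)
    refine ⟨hmn', ?_⟩
    simp only [tower_loc, tower_hgt, towerLoc]
    rw [add_sub_add_left_eq_sub, ← sub_mul, abs_mul]
    exact (mul_le_of_le_one_right (abs_nonneg _) (c.abs_sub_le i)).trans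
      (abs_div_add_sub_div_add_le_of_abs_sub_le_one (P.one_le_hgt i) (abs_nonneg _)
        (abs_nonneg _) hmn')
  refine ⟨⟨1, fun a b hab => ⟨?_, ?_⟩⟩, fun ε hε => ⟨1 / ε, fun a b hab ht => ?_⟩⟩
  · exact (key a b hab).2.trans ((div_le_one ((P.tower c).hgt_pos a)).2
      ((P.tower c).one_le_hgt a))
  · rw [tower_hgt, tower_hgt, hab.1, add_sub_add_left_eq_sub]
    exact (key a b hab).1
  · exact (key a b hab).2.trans (((one_div_le hε ((P.tower c).hgt_pos a)).1 ht))

/-- For equal centers, the new horizontal difference is the contracted old one plus an error caused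
by unequal heights, which is at most D divided by the new height. The old difference is small if the
basis element was already high, and is strongly contracted if it was low. Level zero is not
contracted, so centers play no role there. -/
theorem isSqueezing_diag {r : I → I → Prop} (hr : P.IsSqueezing P r) :
    (P.tower c).IsSqueezing (P.tower c) fun a b =>
      a.1 = b.1 ∧ r a.2 b.2 ∧ (a.1 = 0 ∨ c.toFun a.2 = c.toFun b.2) := by
  obtain ⟨D, hD⟩ := hr.bounded
  have key : ∀ (m : ℤ) i j, r i j → c.toFun i = c.toFun j →
      |P.towerLoc c m i - P.towerLoc c m j| ≤
        P.hgt i / (P.hgt i + |(m : ℝ)|) * |P.loc i - P.loc j| +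
          D / (P.hgt i + |(m : ℝ)|) := fun m i j hij hc => by
    have e : P.towerLoc c m i - P.towerLoc c m j =
        P.hgt i / (P.hgt i + |(m : ℝ)|) * (P.loc i - P.loc j) +
          (P.hgt i / (P.hgt i + |(m : ℝ)|) - P.hgt j / (P.hgt j + |(m : ℝ)|)) *
            (P.loc j - c.toFun j) := by
      rw [towerLoc, towerLoc, hc]
      ring
    rw [e]
    refine (abs_add_le _ _).trans (add_le_add ?_ ?_)
    · rw [abs_mul, abs_of_nonneg (P.ratio_mem m i).1]
    · rw [abs_mul]
      exact (mul_le_of_le_one_right (abs_nonneg _) (c.abs_sub_le j)).trans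
        (abs_div_add_sub_div_add_le (P.one_le_hgt i) (P.one_le_hgt j) (abs_nonneg _)
          (hD i j hij).2)
  constructor
  · refine ⟨D + D, ?_⟩
    rintro ⟨m, i⟩ ⟨n, j⟩ ⟨hmn, hij, h⟩
    obtain rfl : m = n := hmn
    obtain ⟨h1, h2⟩ := hD i j hij
    have hD0 := (abs_nonneg _).trans h1
    refine ⟨?_, ?_⟩
    · simp only [tower_loc]
      obtain h | h := h
      · obtain rfl : m = 0 := h
        rw [towerLoc_zero, towerLoc_zero]
        linarith
      · refine (key m i j hij h).trans (add_le_add ?_ ?_)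
        · exact (mul_le_of_le_one_left (abs_nonneg _) (P.ratio_mem m i).2).trans h1
        · exact div_le_self hD0 (by linarith [P.one_le_hgt i, abs_nonneg (m : ℝ)])
    · rw [tower_hgt, tower_hgt, add_sub_add_right_eq_sub]
      change |P.hgt i - P.hgt j| ≤ _
      linarith
  · intro ε hε
    obtain ⟨T, hT⟩ := hr.atTop (ε / 2) (half_pos hε)
    -- The three thresholds serve level zero, the error from unequal heights, and basis elements of
    -- original height at most `T`, whose contraction factor is at most `T` divided by the new
    -- height.
    refine ⟨max T (max (2 * D / ε) (2 * (T * D) / ε)), ?_⟩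
    rintro ⟨m, i⟩ ⟨n, j⟩ ⟨hmn, hij, h⟩ ht
    obtain rfl : m = n := hmn
    obtain ⟨h1, h2⟩ := hD i j hij
    have hD0 := (abs_nonneg _).trans h1
    simp only [tower_loc]
    rw [tower_hgt, max_le_iff, max_le_iff] at ht
    obtain ⟨ht1, ht2, ht3⟩ := ht
    obtain h | h := h
    · obtain rfl : m = 0 := h
      rw [towerLoc_zero, towerLoc_zero]
      exact (hT i j hij (by simpa using ht1)).trans (by linarith)
    · have hpos : 0 < P.hgt i + |(m : ℝ)| := by linarith [P.hgt_pos i, abs_nonneg (m : ℝ)]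
      refine (key m i j hij h).trans ?_
      have e1 : D / (P.hgt i + |(m : ℝ)|) ≤ ε / 2 := by
        rw [div_le_iff₀ hε] at ht2
        rw [div_le_iff₀ hpos]
        change 2 * D ≤ (P.hgt i + |(m : ℝ)|) * ε at ht2
        linarith
      have e2 : P.hgt i / (P.hgt i + |(m : ℝ)|) * |P.loc i - P.loc j| ≤ ε / 2 := by
        obtain hi | hi := le_total T (P.hgt i)
        · exact (mul_le_of_le_one_left (abs_nonneg _) (P.ratio_mem m i).2).trans (hT i j hij hi)
        · rw [div_mul_eq_mul_div, div_le_iff₀ hpos]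
          rw [div_le_iff₀ hε] at ht3
          change 2 * (T * D) ≤ (P.hgt i + |(m : ℝ)|) * ε at ht3
          have := mul_le_mul hi h1 (abs_nonneg _) ((P.hgt_pos i).le.trans hi)
          linarith
      linarith

variable {P} in
theorem diag_mem_ctlSubring {f : ℤ → Module.End R (I →₀ R)} {r : I → I → Prop}
    (hr : P.IsSqueezing P r) (hf : ∀ m, IsEquivariant G (f m))
    (h : ∀ m, SuppIn (f m) fun i j => r i j ∧ (m = 0 ∨ c.toFun i = c.toFun j)) :
    Tower.diag f ∈ ctlSubring R (P.tower c) :=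
  IsCtl.of_suppIn (Tower.isEquivariant_diag hf) (Tower.diag_suppIn h) (P.isSqueezing_diag c hr)

theorem shift_mem_ctlSubring {k : ℤ} (hk : |k| ≤ 1) :
    Tower.shift R I k ∈ ctlSubring R (P.tower c) :=
  IsCtl.of_suppIn (Tower.isEquivariant_shift k)
    ((Tower.shift_suppIn k).mono fun a b h => ⟨h.1, by rw [h.2]; simpa using hk⟩)
    (P.isSqueezing_shift c)

variable (R) in
/-- The shift of the levels as a controlled automorphism. -/
def shiftUnit : (ctlSubring R (P.tower c))ˣ where
  val := ⟨Tower.shift R I 1, P.shift_mem_ctlSubring c (by simp)⟩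
  inv := ⟨Tower.shift R I (-1), P.shift_mem_ctlSubring c (by simp)⟩
  val_inv := Subtype.ext ((Tower.shift_mul_shift _ _).trans Tower.shift_zero)
  inv_val := Subtype.ext ((Tower.shift_mul_shift _ _).trans Tower.shift_zero)

variable {P} in
theorem level_mem_ctlSubring (q : ℤ → Prop) (x : ctlSubring R P)
    (h : ∀ m, q m → m = 0 ∨ SuppIn x.1 fun i j => c.toFun i = c.toFun j) :
    Tower.onLevels q x.1 ∈ ctlSubring R (P.tower c) := by
  refine diag_mem_ctlSubring c ((mem_ctlSubring.1 x.2).squeezing.sup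
    (.of_eq (r := Eq) fun _ _ h => congrArg P.pos h)) (fun m => ?_) fun m => ?_
  · split_ifs
    · exact (mem_ctlSubring.1 x.2).equivariant
    · exact fun _ _ => rfl
  · split_ifs with hm
    · exact fun _ _ hij => ⟨Or.inl hij, (h m hm).imp_right fun hx => hx _ _ hij⟩
    · exact (SuppIn.refl (r := Eq) fun _ => rfl).mono fun _ _ h =>
        ⟨Or.inr h, Or.inr (congrArg _ h)⟩

variable {P} in
/-- The controlled automorphism acting by `e` on the levels in `q`. -/
def levelUnit (q : ℤ → Prop) (e : (ctlSubring R P)ˣ)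
    (h : ∀ m, q m → m = 0 ∨ SuppIn e.val.1 fun i j => c.toFun i = c.toFun j)
    (h' : ∀ m, q m → m = 0 ∨ SuppIn e.inv.1 fun i j => c.toFun i = c.toFun j) :
    (ctlSubring R (P.tower c))ˣ where
  val := ⟨_, level_mem_ctlSubring c q e.val h⟩
  inv := ⟨_, level_mem_ctlSubring c q e.inv h'⟩
  val_inv := Subtype.ext (Tower.onLevels_mul_eq_one q (congrArg Subtype.val e.val_inv))
  inv_val := Subtype.ext (Tower.onLevels_mul_eq_one q (congrArg Subtype.val e.inv_val))

/-! ### Stabilization and the Eilenberg swindle -/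

namespace Framing

variable {P} {A B : ObsCat R G p} (a : P.Framing A) (b : (P.tower c).Framing B)

/-- Level zero is a copy of `P` in its original position, and the other levels form a complement on
which `e'` is the identity. So `cls_eq_of_extend` applies. -/
theorem cls_tower_eq (e : (ctlSubring R P)ˣ) (e' : (ctlSubring R (P.tower c))ˣ)
    (h : e'.val.1 = Tower.onLevels (· = 0) e.val.1) : b.cls e' = a.cls e := by
  let θ : Tower {m : ℤ // m ≠ 0} I → Tower ℤ I := fun k => ⟨k.1.1, k.2⟩
  have hθ : Function.Injective θ := fun k l h =>
    Tower.ext (Subtype.ext (congrArg Tower.level h :)) (congrArg Tower.elt h :)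
  let S := (P.tower c).comap θ hθ fun _ _ => rfl
  let r : (Tower ℤ I →₀ R) →ₗ[R] (I →₀ R) :=
    Finsupp.lsum ℕ fun a => if a.1 = 0 then Finsupp.lsingle a.2 else 0
  let q : (Tower ℤ I →₀ R) →ₗ[R] (Tower {m : ℤ // m ≠ 0} I →₀ R) :=
    Finsupp.lsum ℕ fun a => if h : a.1 ≠ 0 then Finsupp.lsingle ⟨⟨a.1, h⟩, a.2⟩ else 0
  let s : (Tower {m : ℤ // m ≠ 0} I →₀ R) →ₗ[R] (Tower ℤ I →₀ R) := Finsupp.lmapDomain R R θ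
  have hr0 : ∀ i (x : R), r (Finsupp.single ⟨0, i⟩ x) = Finsupp.single i x :=
    fun i x => by
      rw [show r _ = _ from Finsupp.lsum_single _ _ _ _, if_pos rfl]; rfl
  have hr1 : ∀ m i (x : R), m ≠ 0 → r (Finsupp.single ⟨m, i⟩ x) = 0 :=
    fun m i x hm => by
      rw [show r _ = _ from Finsupp.lsum_single _ _ _ _, if_neg hm]; rfl
  have hq0 : ∀ i (x : R), q (Finsupp.single ⟨0, i⟩ x) = 0 := fun i x => by
      rw [show q _ = _ from Finsupp.lsum_single _ _ _ _, dif_neg (by simp)]; rfl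
  have hq1 : ∀ m i (x : R) (hm : m ≠ 0),
      q (Finsupp.single ⟨m, i⟩ x) = Finsupp.single ⟨⟨m, hm⟩, i⟩ x :=
    fun m i x hm => by
      rw [show q _ = _ from Finsupp.lsum_single _ _ _ _, dif_pos hm]; rfl
  have hs : ∀ k (x : R), s (Finsupp.single k x) = Finsupp.single (θ k) x :=
    fun k x => Finsupp.mapDomain_single
  have hi' : IsCtl P (P.tower c) (Tower.incl R (I := I) (0 : ℤ)) := by
    refine .of_pos_eq (isEquivariant_of_single fun g i => ?_) fun i b hb => ?_
    · rw [Tower.incl_single, Tower.incl_single, gtranslate_single]; rfl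
    · rw [Tower.incl_single] at hb
      rw [← P.tower_pos_zero c]
      by_contra hne
      exact hb (Finsupp.single_eq_of_ne (by rintro rfl; exact hne rfl))
  have hr' : IsCtl (P.tower c) P r := by
    refine .of_pos_eq (isEquivariant_of_single ?_) ?_
    · rintro g ⟨m, i⟩
      change r (Finsupp.single (⟨m, g • i⟩ : Tower ℤ I) 1) = _
      by_cases hm : m = 0
      · subst hm
        rw [hr0, hr0, gtranslate_single]
      · rw [hr1 _ _ _ hm, hr1 _ _ _ hm, map_zero]
    · rintro ⟨m, i⟩ j hij
      by_cases hm : m = 0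
      · subst hm
        rw [hr0] at hij
        rw [← P.tower_pos_zero c]
        by_contra hne
        exact hij (Finsupp.single_eq_of_ne (by rintro rfl; exact hne rfl))
      · exact absurd (by rw [hr1 _ _ _ hm]; rfl) hij
  have hq' : IsCtl (P.tower c) S q := by
    refine .of_pos_eq (isEquivariant_of_single ?_) ?_
    · rintro g ⟨m, i⟩
      change q (Finsupp.single (⟨m, g • i⟩ : Tower ℤ I) 1) = _
      by_cases hm : m = 0
      · subst hm
        rw [hq0, hq0, map_zero]
      · rw [hq1 _ _ _ hm, hq1 _ _ _ hm, gtranslate_single]; rfl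
    · rintro ⟨m, i⟩ k hk
      by_cases hm : m = 0
      · subst hm
        exact absurd (by rw [hq0]; rfl) hk
      · rw [hq1 _ _ _ hm] at hk
        by_contra hne
        exact hk (Finsupp.single_eq_of_ne (by rintro rfl; exact hne rfl))
  have hs' : IsCtl S (P.tower c) s := by
    refine .of_pos_eq (isEquivariant_of_single fun g k => ?_) fun k b hb => ?_
    · rw [hs, hs, gtranslate_single]; rfl
    · rw [hs] at hb
      by_contra hne
      exact hb (Finsupp.single_eq_of_ne (by rintro rfl; exact hne rfl))
  have hqi' : q ∘ₗ Tower.incl R (I := I) (0 : ℤ) = 0 := by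
    refine Finsupp.lhom_ext' fun i => LinearMap.ext_ring ?_
    simp only [LinearMap.comp_apply, Finsupp.lsingle_apply, Tower.incl_single, hq0,
      LinearMap.zero_apply]
  have hqi : ∀ v : I →₀ R, q (Tower.incl R (0 : ℤ) v) = 0 := LinearMap.congr_fun hqi'
  refine cls_eq_of_extend a b hi' hr' hq' hs' ?_ ?_ ?_ hqi' (S.framing R) e e' ?_ ?_
  · refine Finsupp.lhom_ext' fun i => LinearMap.ext_ring ?_
    simp only [LinearMap.comp_apply, Finsupp.lsingle_apply, Tower.incl_single, hr0,
      LinearMap.id_apply]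
  · refine Finsupp.lhom_ext' fun k => LinearMap.ext_ring ?_
    simp only [LinearMap.comp_apply, Finsupp.lsingle_apply, hs, LinearMap.id_apply]
    exact hq1 _ _ _ k.1.2
  · refine Finsupp.lhom_ext' fun a => LinearMap.ext_ring ?_
    obtain ⟨m, i⟩ := a
    simp only [LinearMap.comp_apply, Finsupp.lsingle_apply, LinearMap.add_apply,
      LinearMap.id_apply]
    by_cases hm : m = 0
    · subst hm
      rw [hr0, hq0, map_zero, add_zero, Tower.incl_single]
    · rw [hr1 _ _ _ hm, hq1 _ _ _ hm, map_zero, zero_add, hs]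
  · refine LinearMap.ext fun v => ?_
    rw [LinearMap.comp_apply, LinearMap.comp_apply, h,
      Tower.onLevels_incl_of_pos (q := (· = 0)) rfl]
  · rw [h]
    refine Tower.linearMap_ext fun m v => ?_
    rw [LinearMap.comp_apply]
    by_cases hm : m = 0
    · subst hm
      rw [Tower.onLevels_incl_of_pos (q := (· = 0)) rfl, hqi, hqi]
    · rw [Tower.onLevels_incl_of_neg (q := (· = 0)) hm]

/-- The Eilenberg swindle: an automorphism which does not mix basis elements with different
centers has trivial class, since it can be pushed to infinity. -/
theorem cls_eq_zero_of_center (e : (ctlSubring R P)ˣ)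
    (h : SuppIn e.val.1 fun i j => c.toFun i = c.toFun j)
    (h' : SuppIn e.inv.1 fun i j => c.toFun i = c.toFun j) : a.cls e = 0 := by
  let d : (ℤ → Prop) → (ctlSubring R (P.tower c))ˣ := fun q =>
    levelUnit c q e (fun _ _ => Or.inr h) fun _ _ => Or.inr h'
  let b := (P.tower c).framing R
  have h1 : d (0 ≤ ·) = d (· = 0) * d (1 ≤ ·) :=
    Units.ext (Subtype.ext (Tower.onLevels_mul_onLevels e.val.1).symm)
  have h2 : P.shiftUnit R c * d (0 ≤ ·) = d (1 ≤ ·) * P.shiftUnit R c :=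
    Units.ext (Subtype.ext (Tower.shift_mul_onLevels e.val.1))
  -- Conjugate units have the same class because `cls` is additive with values in an abelian group.
  have h3 : b.cls (d (0 ≤ ·)) = b.cls (d (1 ≤ ·)) := by
    have := congrArg b.cls h2
    rwa [cls_mul, cls_mul, add_comm, add_left_inj] at this
  have h4 := congrArg b.cls h1
  rw [cls_mul, h3, right_eq_add] at h4
  rw [← h4]
  exact (cls_tower_eq c a b e (d (· = 0)) rfl).symm

end Framing

end Placement

/-! ### Units and idempotents in rings -/

section RingLemmas

variable {A : Type*} [Ring A]

/-- For an idempotent `b` commuting with the unit `σ`, the unit `(1 - b) + σ b`. -/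
def Units.bass (σ : Aˣ) (b : A) (hb : IsIdempotentElem b) (h : Commute (σ : A) b) : Aˣ where
  val := 1 - b + σ * b
  inv := 1 - b + σ⁻¹.val * b
  val_inv := by
    have h' : Commute σ⁻¹.val b := h.units_inv_left
    have e1 : (1 - b) * (σ⁻¹.val * b) = 0 := by
      rw [sub_mul, one_mul, ← mul_assoc, ← h'.eq, mul_assoc, hb.eq, sub_self]
    have e2 : σ * b * (1 - b) = 0 := by rw [mul_sub, mul_one, mul_assoc, hb.eq, sub_self]
    have e3 : σ * b * (σ⁻¹.val * b) = b := by
      rw [mul_assoc, ← mul_assoc b, ← h'.eq, mul_assoc, hb.eq, Units.mul_inv_cancel_left]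
    rw [add_mul, mul_add, mul_add, e1, e2, e3, hb.one_sub.eq, add_zero, zero_add,
      sub_add_cancel]
  inv_val := by
    have h' : Commute σ⁻¹.val b := h.units_inv_left
    have e1 : (1 - b) * (σ * b) = 0 := by
      rw [sub_mul, one_mul, ← mul_assoc, ← h.eq, mul_assoc, hb.eq, sub_self]
    have e2 : σ⁻¹.val * b * (1 - b) = 0 := by rw [mul_sub, mul_one, mul_assoc, hb.eq, sub_self]
    have e3 : σ⁻¹.val * b * (σ * b) = b := by
      rw [mul_assoc, ← mul_assoc b, ← h.eq, mul_assoc, hb.eq, Units.inv_mul_cancel_left]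
    rw [add_mul, mul_add, mul_add, e1, e2, e3, hb.one_sub.eq, add_zero, zero_add,
      sub_add_cancel]

theorem mul_add_one_sub_mul {u v x : A} (huv : u * v = 1) (hx : IsIdempotentElem x)
    (hv : Commute v x) : (u * x + (1 - x)) * (v * x + (1 - x)) = 1 := by
  have e1 : u * x * (v * x) = x := by
    rw [mul_assoc, ← mul_assoc x, ← hv.eq, mul_assoc, hx.eq, ← mul_assoc, huv, one_mul]
  have e2 : u * x * (1 - x) = 0 := by rw [mul_sub, mul_one, mul_assoc, hx.eq, sub_self]
  have e3 : (1 - x) * (v * x) = 0 := by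
    rw [sub_mul, one_mul, ← mul_assoc, ← hv.eq, mul_assoc, hx.eq, sub_self]
  rw [add_mul, mul_add, mul_add, e1, e2, e3, hx.one_sub.eq, add_zero, zero_add, add_sub_cancel]

/-- The unit which is `β` on the image of an idempotent `x` commuting with `β` and the identity
on the kernel. -/
def Units.restrict (β : Aˣ) (x : A) (hx : IsIdempotentElem x) (h : Commute (β : A) x) : Aˣ where
  val := β * x + (1 - x)
  inv := β⁻¹.val * x + (1 - x)
  val_inv := mul_add_one_sub_mul β.mul_inv hx h.units_inv_left
  inv_val := mul_add_one_sub_mul β.inv_mul hx h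

theorem Units.restrict_mul_restrict (β : Aˣ) (x y : A) (hx : IsIdempotentElem x)
    (h : Commute (β : A) x) (hy : IsIdempotentElem y) (h' : Commute (β : A) y) (hxy : x + y = 1) :
    β.restrict x hx h * β.restrict y hy h' = β := by
  obtain rfl : y = 1 - x := eq_sub_of_add_eq' hxy
  refine Units.ext ?_
  change (β * x + (1 - x)) * (β * (1 - x) + (1 - (1 - x))) = (β : A)
  have e1 : β * x * (β * (1 - x)) = 0 := by
    rw [mul_assoc, ← mul_assoc x, ← h.eq, mul_assoc, mul_sub, mul_one, hx.eq, sub_self, mul_zero,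
      mul_zero]
  have e2 : β * x * x = β * x := by rw [mul_assoc, hx.eq]
  have e3 : (1 - x) * (β * (1 - x)) = β * (1 - x) := by
    rw [← mul_assoc, ← h'.eq, mul_assoc, hy.eq]
  have e4 : (1 - x) * x = 0 := by rw [sub_mul, one_mul, hx.eq, sub_self]
  rw [sub_sub_cancel, add_mul, mul_add, mul_add, e1, e2, e3, e4, zero_add, add_zero, ← mul_add,
    add_sub_cancel, mul_one]

theorem one_sub_mul_eq_mul_one_sub {a b : A} (h : a * b = b * a) : (1 - a) * b = b * (1 - a) := by
  rw [sub_mul, mul_sub, one_mul, mul_one, h]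

/-- Conjugation by `a`, `v'` and `w` takes `x` to `y`, then to `z`, then back to `x`. -/
theorem commute_mul_mul_of_conj {v v' w a x y z : A} (hv : v * v' = 1) (hv' : v' * v = 1)
    (h₁ : v * z = y * v) (h₂ : w * z = x * w) (h₃ : a * x = y * a) : Commute (w * v' * a) x := by
  have h : v' * y = z * v' := by
    rw [← mul_one (v' * y), ← hv, mul_assoc, ← mul_assoc y, ← h₁, mul_assoc, ← mul_assoc v', hv',
      one_mul]
  rw [Commute, SemiconjBy, mul_assoc, h₃, mul_assoc w, ← mul_assoc v', h, ← mul_assoc,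
    ← mul_assoc, h₂]
  simp only [mul_assoc]

/-- The idempotent `q` agrees with `π` outside the image of the projection `χ`. -/
structure AgreesOff (χ π q : A) : Prop where
  idem : IsIdempotentElem q
  left : (1 - χ) * q = (1 - χ) * π
  right : q * (1 - χ) = π * (1 - χ)

namespace AgreesOff

variable {χ π q : A} (h : AgreesOff χ π q) (hχ : IsIdempotentElem χ) (hχπ : Commute χ π)

-- Both products equal `q` minus the part of `π` off `χ`, and `π` commutes with `χ`.
include h hχπ in
theorem commute : χ * q = q * χ := by
  have h1 : χ * q = q - (π - χ * π) := by
    have := h.left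
    rw [sub_mul, sub_mul, one_mul, one_mul] at this
    rw [← this]
    abel
  have h2 : q * χ = q - (π - π * χ) := by
    have := h.right
    rw [mul_sub, mul_sub, mul_one, mul_one] at this
    rw [← this]
    abel
  rw [h1, h2, hχπ.eq]

include hχ in
theorem left_mul_complement : χ * (χ * (1 - q)) = χ * (1 - q) := by rw [← mul_assoc, hχ.eq]

include h hχ hχπ

theorem complement_mul_right : χ * (1 - q) * χ = χ * (1 - q) := by
  rw [mul_assoc, sub_mul, ← h.commute hχπ, one_mul, mul_sub, ← mul_assoc, hχ.eq, mul_sub, mul_one]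

theorem mul_complement : q * (χ * (1 - q)) = 0 := by
  rw [← mul_assoc, ← h.commute hχπ, mul_assoc, mul_sub, mul_one, h.idem.eq, sub_self, mul_zero]

theorem isIdempotentElem_complement : IsIdempotentElem (χ * (1 - q)) := by
  rw [IsIdempotentElem, ← mul_assoc, h.complement_mul_right hχ hχπ, mul_assoc, h.idem.one_sub.eq]

theorem complement_mul : χ * (1 - q) * (χ + (1 - χ) * π) = χ * (1 - q) := by
  have : χ * (1 - q) * (1 - χ) = 0 := by
    rw [mul_sub _ 1 χ, mul_one, h.complement_mul_right hχ hχπ, sub_self]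
  rw [mul_add, h.complement_mul_right hχ hχπ, ← mul_assoc, this, zero_mul, add_zero]

/-- With `b = χ * (1 - q)`, the idempotent `χ + (1 - χ) * π` is the orthogonal sum `q + b`: the
summand `b` is what `q` lacks of the image of `χ`. Removing `b` leaves `q`, and this is the
level-zero part of `Tower.shift_add_mul_ray`. -/
theorem one_sub_complement_mul :
    (1 - χ * (1 - q)) * (χ + (1 - χ) * π) = q * (1 - χ * (1 - q)) := by
  rw [sub_mul, one_mul, h.complement_mul hχ hχπ, mul_sub q, mul_one, h.mul_complement hχ hχπ,
    ← h.left, mul_sub, mul_one, sub_mul, one_mul]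
  abel

end AgreesOff

end RingLemmas

/-! ### Conjugating projections along a tower -/

namespace Tower

variable {R : Type u} [Ring R] {I : Type}

/-- The endomorphism of a tower which is zero on negative levels, `q` on level zero and `χ` on
positive levels. -/
def ray (χ q : Module.End R (I →₀ R)) : Module.End R (Tower ℤ I →₀ R) :=
  diag fun m => if 0 < m then χ else if m = 0 then q else 0

theorem ray_incl_pos (χ q : Module.End R (I →₀ R)) {m : ℤ} (h : 0 < m) (v : I →₀ R) :
    ray χ q (incl R m v) = incl R m (χ v) := by
  rw [ray, diag_incl, if_pos h]

theorem ray_incl_zero (χ q : Module.End R (I →₀ R)) (v : I →₀ R) :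
    ray χ q (incl R (0 : ℤ) v) = incl R 0 (q v) := by
  rw [ray, diag_incl, if_neg (lt_irrefl _), if_pos rfl]

theorem ray_incl_neg (χ q : Module.End R (I →₀ R)) {m : ℤ} (h : m < 0) (v : I →₀ R) :
    ray χ q (incl R m v) = 0 := by
  rw [ray, diag_incl, if_neg h.not_gt, if_neg h.ne, LinearMap.zero_apply, map_zero]

/-- The conjugating map lifts the image of `b = χ * (1 - q)` by one level and fixes the image of `1
- b`. On level zero the source projection is `q + b`; its part `b` moves to level one, into the
place vacated by the part that moves on to level two, and so forth. Only `q` remains on level zero.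
The source does not involve `q`, so all projections agreeing with `π` off `χ` become conjugate once
extended. -/
theorem shift_add_mul_ray {χ π q : Module.End R (I →₀ R)} (h : AgreesOff χ π q)
    (hχ : IsIdempotentElem χ) (hχπ : Commute χ π) :
    (1 - diag (fun _ => χ * (1 - q)) + shift R I 1 * diag fun _ => χ * (1 - q)) *
        ray χ (χ + (1 - χ) * π) =
      ray χ q * (1 - diag (fun _ => χ * (1 - q)) + shift R I 1 * diag fun _ => χ * (1 - q)) := by
  set b := χ * (1 - q) with hb
  have key : ∀ (m : ℤ) (v : I →₀ R),
      (1 - diag (fun _ => b) + shift R I 1 * diag fun _ => b : Module.End R (Tower ℤ I →₀ R))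
        (incl R m v) = incl R m ((1 - b) v) + incl R (m + 1) (b v) := fun m v => by
    rw [LinearMap.add_apply, LinearMap.sub_apply, Module.End.mul_apply, diag_incl, shift_incl,
      LinearMap.sub_apply, map_sub]
    rfl
  have e1 : b * χ = χ * b := (h.complement_mul_right hχ hχπ).trans
    (AgreesOff.left_mul_complement (q := q) hχ).symm
  have e2 : χ * (χ * (1 - q)) = χ * (1 - q) := AgreesOff.left_mul_complement (q := q) hχ
  have e3 : (1 - b) * χ = χ * (1 - b) :=
    one_sub_mul_eq_mul_one_sub (A := Module.End R (I →₀ R)) e1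
  refine linearMap_ext fun m v => ?_
  rw [Module.End.mul_apply, Module.End.mul_apply, key, map_add]
  obtain hm | rfl | hm := lt_trichotomy m 0
  · rw [ray_incl_neg _ _ hm, ray_incl_neg _ _ hm, map_zero, zero_add]
    -- Level -1 is the only negative level shifted into the ray; what arrives on level zero is
    -- killed because `q * b = 0`.
    obtain hm' | rfl := (show m + 1 < 0 ∨ m = -1 by omega)
    · rw [ray_incl_neg _ _ hm']
    · rw [neg_add_cancel, ray_incl_zero, ← Module.End.mul_apply, h.mul_complement hχ hχπ,
        LinearMap.zero_apply, map_zero]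
  · rw [ray_incl_zero, ray_incl_zero, ray_incl_pos _ _ (by omega), key,
      ← Module.End.mul_apply, ← Module.End.mul_apply, ← Module.End.mul_apply,
      ← Module.End.mul_apply, h.one_sub_complement_mul hχ hχπ, hb, h.complement_mul hχ hχπ,
      e2]
  · rw [ray_incl_pos _ _ hm, ray_incl_pos _ _ hm, ray_incl_pos _ _ (by omega), key,
      ← Module.End.mul_apply, ← Module.End.mul_apply, ← Module.End.mul_apply,
      ← Module.End.mul_apply, e1, e3]

theorem onLevels_mul_ray {χ π q x : Module.End R (I →₀ R)} (h : x * π = q * x) :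
    onLevels (· = 0) x * ray χ π = ray χ q * onLevels (· = 0) x := by
  refine linearMap_ext fun m v => ?_
  rw [Module.End.mul_apply, Module.End.mul_apply]
  obtain hm | rfl | hm := lt_trichotomy m 0
  · rw [onLevels_incl_of_neg (q := (· = 0)) hm.ne, ray_incl_neg _ _ hm, ray_incl_neg _ _ hm,
      map_zero]
  · rw [onLevels_incl_of_pos (q := (· = 0)) rfl, ray_incl_zero, ray_incl_zero,
      onLevels_incl_of_pos (q := (· = 0)) rfl, ← Module.End.mul_apply, h, Module.End.mul_apply]
  · rw [onLevels_incl_of_neg (q := (· = 0)) hm.ne', ray_incl_pos _ _ hm, ray_incl_pos _ _ hm,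
      onLevels_incl_of_neg (q := (· = 0)) hm.ne']

/-- The basis elements over `S` on level zero and those over `N` on positive levels. -/
def raySet (N S : Set I) : Set (Tower ℤ I) :=
  {a | (0 < a.level ∧ a.elt ∈ N) ∨ (a.level = 0 ∧ a.elt ∈ S)}

/-- Extending a coordinate projection gives a coordinate projection again, so commuting with it can
be read off from supports. -/
theorem coordProj_raySet (N S : Set I) :
    coordProj R (raySet N S) = ray (coordProj R N) (coordProj R S) := by
  refine linearMap_ext fun m v => ?_
  suffices H : coordProj R (raySet N S) ∘ₗ incl R m =
      ray (coordProj R N) (coordProj R S) ∘ₗ incl R m from LinearMap.congr_fun H v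
  refine Finsupp.lhom_ext' fun i => LinearMap.ext_ring ?_
  simp only [LinearMap.comp_apply, Finsupp.lsingle_apply]
  obtain hm | rfl | hm := lt_trichotomy m 0
  · rw [ray_incl_neg _ _ hm, incl_single, coordProj_single_of_notMem]
    rintro (h | h)
    · exact hm.not_gt h.1
    · exact hm.ne h.1
  · rw [ray_incl_zero]
    by_cases hi : i ∈ S
    · rw [incl_single, coordProj_single_of_mem (S := raySet N S) (Or.inr ⟨rfl, hi⟩),
        coordProj_single_of_mem hi, incl_single]
    · rw [incl_single, coordProj_single_of_notMem, coordProj_single_of_notMem hi, map_zero]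
      rintro (h | h)
      · exact lt_irrefl _ h.1
      · exact hi h.2
  · rw [ray_incl_pos _ _ hm]
    by_cases hi : i ∈ N
    · rw [incl_single, coordProj_single_of_mem (S := raySet N S) (Or.inl ⟨hm, hi⟩),
        coordProj_single_of_mem hi, incl_single]
    · rw [incl_single, coordProj_single_of_notMem, coordProj_single_of_notMem hi, map_zero]
      rintro (h | h)
      · exact hi h.2
      · exact hm.ne' h.1

end Tower

/-! ### Supports of products with coordinate projections -/

section CoordProj

variable {R : Type u} [Ring R] {I : Type}

theorem coordProj_add_coordProj_compl (S : Set I) : coordProj R S + coordProj R Sᶜ = 1 := by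
  refine Finsupp.lhom_ext' fun i => LinearMap.ext_ring ?_
  simp only [LinearMap.comp_apply, Finsupp.lsingle_apply, LinearMap.add_apply]
  by_cases hi : i ∈ S
  · rw [coordProj_single_of_mem hi, coordProj_single_of_notMem (not_not.2 hi), add_zero]; rfl
  · rw [coordProj_single_of_notMem hi, coordProj_single_of_mem hi, zero_add]; rfl

theorem one_sub_coordProj (S : Set I) : 1 - coordProj R S = coordProj R Sᶜ := by
  rw [← coordProj_add_coordProj_compl S]
  exact add_sub_cancel_left (coordProj R S) (coordProj R Sᶜ)

theorem mul_coordProj_suppIn {f : Module.End R (I →₀ R)} {r : I → I → Prop} (hf : SuppIn f r)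
    (S : Set I) : SuppIn (f * coordProj R S) fun i j => i ∈ S ∧ r i j := fun i j h => by
  rw [Module.End.mul_apply] at h
  by_cases hi : i ∈ S
  · rw [coordProj_single_of_mem hi] at h
    exact ⟨hi, hf i j h⟩
  · rw [coordProj_single_of_notMem hi, map_zero] at h
    exact absurd rfl h

theorem coordProj_mul_suppIn {f : Module.End R (I →₀ R)} {r : I → I → Prop} (hf : SuppIn f r)
    (S : Set I) : SuppIn (coordProj R S * f) fun i j => j ∈ S ∧ r i j := fun i j h => by
  rw [Module.End.mul_apply] at h
  by_cases hj : j ∈ S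
  · rw [coordProj_apply_of_mem hj] at h
    exact ⟨hj, hf i j h⟩
  · exact absurd (coordProj_apply_of_notMem hj _) h

/-- Commutation allows the projection to be put on either side of `f`, which confines both ends of
an entry to `S`. -/
theorem restrict_suppIn {f : Module.End R (I →₀ R)} {r : I → I → Prop} (hf : SuppIn f r)
    {S : Set I} (h : Commute f (coordProj R S)) :
    SuppIn (f * coordProj R S + (1 - coordProj R S))
      fun i j => i = j ∨ (i ∈ S ∧ j ∈ S ∧ r i j) := by
  refine SuppIn.add (fun i j hij => Or.inr ⟨(mul_coordProj_suppIn hf S i j hij).1, ?_⟩) ?_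
  · rw [h.eq] at hij
    exact coordProj_mul_suppIn hf S i j hij
  · rw [one_sub_coordProj]
    exact (coordProj_suppIn _).mono fun _ _ => Or.inl

/-- Entries ending outside `N` do not cross the boundary of `S`, so `f` commutes there with the
projection to `S`. The version for entries starting outside `N` is `coordProj_mul_mul_compl`. -/
theorem compl_mul_mul_coordProj {f : Module.End R (I →₀ R)} {N S : Set I}
    (hf : SuppIn f fun i j => j ∉ N → (i ∈ S ↔ j ∈ S)) :
    (1 - coordProj R N) * (f * coordProj R S) = (1 - coordProj R N) * (coordProj R S * f) := by
  rw [one_sub_coordProj]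
  refine Finsupp.linearMap_ext_entries fun i j => ?_
  simp only [Module.End.mul_apply]
  by_cases hj : j ∈ N
  · rw [coordProj_apply_of_notMem (not_not.2 hj), coordProj_apply_of_notMem (not_not.2 hj)]
  · rw [coordProj_apply_of_mem hj, coordProj_apply_of_mem hj]
    by_cases h0 : f (Finsupp.single i 1) j = 0
    · trans 0
      · by_cases hi : i ∈ S
        · rwa [coordProj_single_of_mem hi]
        · rw [coordProj_single_of_notMem hi, map_zero]; rfl
      · by_cases hj' : j ∈ S
        · rw [coordProj_apply_of_mem hj', h0]
        · rw [coordProj_apply_of_notMem hj']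
    · by_cases hi : i ∈ S
      · rw [coordProj_single_of_mem hi, coordProj_apply_of_mem ((hf i j h0 hj).1 hi)]
      · rw [coordProj_single_of_notMem hi, map_zero,
          coordProj_apply_of_notMem (mt (hf i j h0 hj).2 hi)]
        rfl

theorem coordProj_mul_mul_compl {f : Module.End R (I →₀ R)} {N S : Set I}
    (hf : SuppIn f fun i j => i ∉ N → (i ∈ S ↔ j ∈ S)) :
    coordProj R S * f * (1 - coordProj R N) = f * coordProj R S * (1 - coordProj R N) := by
  rw [one_sub_coordProj]
  refine Finsupp.linearMap_ext_entries fun i j => ?_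
  simp only [Module.End.mul_apply]
  by_cases hi : i ∈ N
  · rw [coordProj_single_of_notMem (not_not.2 hi), map_zero, map_zero, map_zero]
  · rw [coordProj_single_of_mem hi]
    by_cases h0 : f (Finsupp.single i 1) j = 0
    · trans 0
      · by_cases hj' : j ∈ S
        · rw [coordProj_apply_of_mem hj', h0]
        · rw [coordProj_apply_of_notMem hj']
      · by_cases hi : i ∈ S
        · rw [coordProj_single_of_mem hi, h0]
        · rw [coordProj_single_of_notMem hi, map_zero]; rfl
    · by_cases hi' : i ∈ S
      · rw [coordProj_single_of_mem hi', coordProj_apply_of_mem ((hf i j h0 hi).1 hi')]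
      · rw [coordProj_single_of_notMem hi', map_zero,
          coordProj_apply_of_notMem (mt (hf i j h0 hi).2 hi')]
        rfl

end CoordProj

/-! ### Lattices in the line -/

/-- The points of distance at most `ρ` from the lattice `s + tℤ`. -/
def nearLattice (s t ρ : ℝ) : Set ℝ := {x | ∃ k : ℤ, |x - (s + t * k)| ≤ ρ}

open Classical in
/-- The lattice point next to `x`, if there is one of distance at most `ρ`, and otherwise `x`. -/
def snap (s t ρ x : ℝ) : ℝ := if h : x ∈ nearLattice s t ρ then s + t * h.choose else x

section Snap

variable {s t ρ : ℝ}

theorem lattice_eq_of_abs_sub_lt {k l : ℤ} (h : |(s + t * k) - (s + t * l)| < t) : k = l := by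
  have ht : 0 < t := (abs_nonneg _).trans_lt h
  rw [add_sub_add_left_eq_sub, ← mul_sub, abs_mul, abs_of_pos ht, mul_lt_iff_lt_one_right ht] at h
  have h' : |k - l| < 1 := by exact_mod_cast h
  exact sub_eq_zero.1 (Int.abs_lt_one_iff.1 h')

theorem snap_of_mem {x : ℝ} (h : x ∈ nearLattice s t ρ) :
    ∃ k : ℤ, snap s t ρ x = s + t * k ∧ |x - (s + t * k)| ≤ ρ := by
  rw [snap, dif_pos h]
  exact ⟨_, rfl, h.choose_spec⟩

theorem snap_of_notMem {x : ℝ} (h : x ∉ nearLattice s t ρ) : snap s t ρ x = x := by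
  rw [snap, dif_neg h]

/-- Distinct lattice points are at least `t` apart, more than the two points and the gap between
them can span. -/
theorem snap_eq_snap {x y d : ℝ} (hd : 2 * ρ + d < t) (hx : x ∈ nearLattice s t ρ)
    (hy : y ∈ nearLattice s t ρ) (hxy : |x - y| ≤ d) : snap s t ρ x = snap s t ρ y := by
  obtain ⟨k, ek, hk⟩ := snap_of_mem hx
  obtain ⟨l, el, hl⟩ := snap_of_mem hy
  rw [ek, el, lattice_eq_of_abs_sub_lt (s := s) (t := t) (k := k) (l := l)]
  have h1 := abs_le.1 hk
  have h2 := abs_le.1 hl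
  have h3 := abs_le.1 hxy
  exact abs_lt.2 ⟨by linarith, by linarith⟩

theorem abs_sub_snap_le (hρ : 0 ≤ ρ) (x : ℝ) : |x - snap s t ρ x| ≤ ρ := by
  by_cases h : x ∈ nearLattice s t ρ
  · obtain ⟨k, ek, hk⟩ := snap_of_mem h
    rwa [ek]
  · rw [snap_of_notMem h, sub_self, abs_zero]
    exact hρ

variable {G : Type*} [Group G] [MulAction G ℝ] {Xbar : Type*} [TopologicalSpace Xbar]
  [MulAction G Xbar] (p : Xbar → ℝ) [LineCover G p]

include p

/-- The first condition makes the lattice stable under integral translations, the second makes it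
stable under the reflections. -/
theorem exists_smul_lattice (hq : ∃ q : ℤ, t * q = 1) (hl : ∃ l : ℤ, t * l = 2 * s) (g : G)
    (k : ℤ) : ∃ k' : ℤ, g • (s + t * k) = s + t * k' := by
  obtain ⟨q, hq⟩ := hq
  obtain ⟨l, hl⟩ := hl
  obtain ⟨n, h⟩ | ⟨n, h⟩ := LineCover.smul_eq p g
  · refine ⟨k + n * q, ?_⟩
    rw [h]
    push_cast
    linear_combination -(n : ℝ) * hq
  · refine ⟨-k - l + n * q, ?_⟩
    rw [h]
    push_cast
    linear_combination -(n : ℝ) * hq + hl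

theorem smul_mem_nearLattice (hq : ∃ q : ℤ, t * q = 1) (hl : ∃ l : ℤ, t * l = 2 * s) (g : G)
    (x : ℝ) : g • x ∈ nearLattice s t ρ ↔ x ∈ nearLattice s t ρ := by
  have key : ∀ (g : G) (x : ℝ), x ∈ nearLattice s t ρ → g • x ∈ nearLattice s t ρ := by
    rintro g x ⟨k, hk⟩
    obtain ⟨k', hk'⟩ := exists_smul_lattice p hq hl g k
    exact ⟨k', by rwa [← hk', LineCover.abs_smul_sub_smul p]⟩
  exact ⟨fun h => by simpa using key g⁻¹ _ h, key g x⟩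

/-- Since `2 * ρ < t`, the lattice point within `ρ` is unique, so the choice made in `snap` cannot
break equivariance. -/
theorem snap_smul (hρ : 2 * ρ < t) (hq : ∃ q : ℤ, t * q = 1) (hl : ∃ l : ℤ, t * l = 2 * s) (g : G)
    (x : ℝ) : snap s t ρ (g • x) = g • snap s t ρ x := by
  by_cases h : x ∈ nearLattice s t ρ
  · obtain ⟨k, ek, hk⟩ := snap_of_mem h
    obtain ⟨l, el, hl'⟩ := snap_of_mem ((smul_mem_nearLattice p hq hl g x).2 h)
    obtain ⟨k', hk'⟩ := exists_smul_lattice p hq hl g k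
    rw [← LineCover.abs_smul_sub_smul p g, hk'] at hk
    rw [ek, el, hk', lattice_eq_of_abs_sub_lt (s := s) (t := t) (k := l) (l := k')]
    have h1 := abs_le.1 hk
    have h2 := abs_le.1 hl'
    exact abs_lt.2 ⟨by linarith, by linarith⟩
  · rw [snap_of_notMem h, snap_of_notMem (mt (smul_mem_nearLattice p hq hl g x).1 h)]

end Snap

theorem mem_cut_of_abs_sub_le {x y ε : ℝ} (h : |x - y| ≤ ε) (hx : x ∈ nearLattice 0 1 (1 / 4))
    (hy : y ∉ nearLattice 0 1 (1 / 4)) :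
    x ∈ nearLattice (1 / 4) (1 / 2) ε ∧ y ∈ nearLattice (1 / 4) (1 / 2) ε := by
  obtain ⟨k, hk⟩ := hx
  have hy' : 1 / 4 < |y - (0 + 1 * k)| := by
    by_contra hle
    exact hy ⟨k, not_lt.1 hle⟩
  have h1 := abs_le.1 hk
  have h2 := abs_le.1 h
  obtain h3 | h3 := lt_abs.1 hy'
  -- The points k + 1/4 and k - 1/4 have indices 2k and 2k - 1 in the lattice 1/4 + ½ℤ.
  · refine ⟨⟨2 * k, abs_le.2 ⟨?_, ?_⟩⟩, ⟨2 * k, abs_le.2 ⟨?_, ?_⟩⟩⟩ <;> push_cast <;> linarith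
  · refine ⟨⟨2 * k - 1, abs_le.2 ⟨?_, ?_⟩⟩, ⟨2 * k - 1, abs_le.2 ⟨?_, ?_⟩⟩⟩ <;> push_cast <;>
      linarith

theorem nearLattice_mono {s t ρ ρ' : ℝ} (h : ρ ≤ ρ') : nearLattice s t ρ ⊆ nearLattice s t ρ' :=
  fun _ ⟨k, hk⟩ => ⟨k, hk.trans h⟩

/-- Each cut point is at distance exactly 1/4 from an integer and also from a half-integer, so its
neighbourhood can be joined to the piece on either side. -/
theorem mem_nearLattice_zero_of_mem_cut {x ε : ℝ} (h : x ∈ nearLattice (1 / 4) (1 / 2) ε) :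
    x ∈ nearLattice 0 1 (1 / 4 + ε) := by
  obtain ⟨k, hk⟩ := h
  have h1 := abs_le.1 hk
  obtain ⟨l, rfl | rfl⟩ := Int.even_or_odd' k
  · refine ⟨l, abs_le.2 ?_⟩
    push_cast at h1
    constructor <;> linarith
  · refine ⟨l + 1, abs_le.2 ?_⟩
    push_cast at h1 ⊢
    constructor <;> linarith

theorem mem_nearLattice_half_of_mem_cut {x ε : ℝ} (h : x ∈ nearLattice (1 / 4) (1 / 2) ε) :
    x ∈ nearLattice (1 / 2) 1 (1 / 4 + ε) := by
  obtain ⟨k, hk⟩ := h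
  have h1 := abs_le.1 hk
  obtain ⟨l, rfl | rfl⟩ := Int.even_or_odd' k
  · refine ⟨l, abs_le.2 ?_⟩
    push_cast at h1
    constructor <;> linarith
  · refine ⟨l, abs_le.2 ?_⟩
    push_cast at h1 ⊢
    constructor <;> linarith

theorem mem_nearLattice_half_of_notMem {x : ℝ} (h : x ∉ nearLattice 0 1 (1 / 4)) :
    x ∈ nearLattice (1 / 2) 1 (1 / 4) := by
  have h1 : ∀ k : ℤ, 1 / 4 < |x - (0 + 1 * k)| := fun k => by
    by_contra hle
    exact h ⟨k, not_lt.1 hle⟩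
  have h2 := h1 ⌊x⌋
  have h3 := h1 (⌊x⌋ + 1)
  have h4 := Int.floor_le x
  have h5 := Int.lt_floor_add_one x
  rw [abs_of_nonneg (by linarith)] at h2
  rw [abs_of_nonpos (by push_cast; linarith)] at h3
  push_cast at h3
  exact ⟨⌊x⌋, abs_le.2 ⟨by linarith, by linarith⟩⟩

/-! ### Small automorphisms -/

namespace Placement

variable {R : Type u} [Ring R] {G : Type*} [Group G] [MulAction G ℝ] {Xbar : Type*}
  [TopologicalSpace Xbar] [MulAction G Xbar] {p : Xbar → ℝ} [LineCover G p]
  {I : Type} [MulAction G I] (P : Placement G p I)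

/-- The center of a placement given by a lattice. -/
def snapCenter (s t ρ : ℝ) (h0 : 0 ≤ ρ) (h1 : ρ ≤ 1) (hρ : 2 * ρ < t) (hq : ∃ q : ℤ, t * q = 1)
    (hl : ∃ l : ℤ, t * l = 2 * s) : P.Center where
  toFun i := snap s t ρ (P.loc i)
  map_smul g i := by rw [P.loc_smul, snap_smul p hρ hq hl]
  abs_sub_le i := (abs_sub_snap_le h0 _).trans h1

/-- The basis elements of distance at most `1/4` from the integers. -/
def sideSet : Set I := {i | P.loc i ∈ nearLattice 0 1 (1 / 4)}

/-- The basis elements close to the boundary points of `sideSet`. -/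
def cutSet : Set I := {i | P.loc i ∈ nearLattice (1 / 4) (1 / 2) (1 / 30)}

theorem smul_mem_sideSet (g : G) (i : I) : g • i ∈ P.sideSet ↔ i ∈ P.sideSet := by
  rw [sideSet, Set.mem_ofPred_eq, P.loc_smul]
  exact smul_mem_nearLattice p ⟨1, by norm_num⟩ ⟨0, by norm_num⟩ g _

theorem smul_mem_cutSet (g : G) (i : I) : g • i ∈ P.cutSet ↔ i ∈ P.cutSet := by
  rw [cutSet, Set.mem_ofPred_eq, P.loc_smul]
  exact smul_mem_nearLattice p ⟨2, by norm_num⟩ ⟨1, by norm_num⟩ g _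

/-- The center of the components of `cutSet`. -/
def cutCenter : P.Center :=
  P.snapCenter (1 / 4) (1 / 2) (1 / 30) (by norm_num) (by norm_num) (by norm_num)
    ⟨2, by norm_num⟩ ⟨1, by norm_num⟩

theorem cutCenter_eq {i j : I} (hi : i ∈ P.cutSet) (hj : j ∈ P.cutSet)
    (h : |P.loc i - P.loc j| ≤ 1 / 15) : P.cutCenter.toFun i = P.cutCenter.toFun j :=
  -- Here 2 · 1/30 + 1/15 = 2/15 stays below the spacing 1/2 of the cut points.
  snap_eq_snap (by norm_num) hi hj h

theorem towerLoc_mem_cut {i : I} (hi : i ∈ P.cutSet) (m : ℤ) :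
    P.towerLoc P.cutCenter m i ∈ nearLattice (1 / 4) (1 / 2) (1 / 30) := by
  obtain ⟨k, ek, hk⟩ := snap_of_mem hi
  refine ⟨k, ?_⟩
  rw [← ek] at hk ⊢
  exact (P.abs_towerLoc_sub_center_le P.cutCenter m i).trans hk

/-- Basis elements of the tower are related if they are equal or over the same component of
`cutSet`. -/
def cutRel : Setoid (Tower ℤ I) where
  r a b := a = b ∨ (a.elt ∈ P.cutSet ∧ b.elt ∈ P.cutSet ∧
    P.cutCenter.toFun a.elt = P.cutCenter.toFun b.elt)
  iseqv :=
    { refl _ := Or.inl rfl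
      symm := by
        rintro a b (rfl | ⟨h1, h2, h3⟩)
        · exact Or.inl rfl
        · exact Or.inr ⟨h2, h1, h3.symm⟩
      trans := by
        rintro a b c (rfl | ⟨h1, h2, h3⟩) (rfl | ⟨h4, h5, h6⟩)
        · exact Or.inl rfl
        · exact Or.inr ⟨h4, h5, h6⟩
        · exact Or.inr ⟨h1, h2, h3⟩
        · exact Or.inr ⟨h1, h5, h3.trans h6⟩ }

/-- On every level, elements over `cutSet` stay within 1/30 of their center, as the tower only
contracts. -/
theorem abs_loc_sub_loc_le_of_cutRel {a b : Tower ℤ I} (h : P.cutRel a b) :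
    |(P.tower P.cutCenter).loc a - (P.tower P.cutCenter).loc b| ≤ 1 / 15 := by
  obtain rfl | ⟨-, -, h⟩ := h
  · rw [sub_self, abs_zero]; norm_num
  · rw [tower_loc, tower_loc]
    have h1 := abs_le.1 ((P.abs_towerLoc_sub_center_le P.cutCenter a.1 a.2).trans
      (abs_sub_snap_le (by norm_num) _))
    have h2 := abs_le.1 ((P.abs_towerLoc_sub_center_le P.cutCenter b.1 b.2).trans
      (abs_sub_snap_le (by norm_num) _))
    rw [h] at h1
    exact abs_le.2 ⟨by linarith, by linarith⟩

/-- Controlled projections of small size which agree with the projection to `sideSet` away from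
the boundary. -/
structure IsCutProj (q : Module.End R (I →₀ R)) : Prop where
  agrees : AgreesOff (coordProj R P.cutSet) (coordProj R P.sideSet) q
  mem : q ∈ ctlSubring R P
  small : SuppIn q fun i j => |P.loc i - P.loc j| ≤ 1 / 15

theorem isCutProj_sideSet : P.IsCutProj (coordProj R P.sideSet) where
  agrees := ⟨isIdempotentElem_coordProj _, rfl, rfl⟩
  mem := coordProj_mem_ctlSubring P.smul_mem_sideSet
  small := (coordProj_suppIn _).mono fun i j h => by subst h; simp

/-- An entry of length at most 1/30 that crosses the boundary of `sideSet` has both ends in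
`cutSet`. Away from it `e` and its inverse commute with the projection, and conjugation doubles the
size to 1/15. -/
theorem isCutProj_conj (e : (ctlSubring R P)ˣ)
    (he : SuppIn e.val.1 fun i j => |P.loc i - P.loc j| ≤ 1 / 30)
    (he' : SuppIn e.inv.1 fun i j => |P.loc i - P.loc j| ≤ 1 / 30) :
    P.IsCutProj (e.val.1 * coordProj R P.sideSet * e.inv.1) := by
  have h1 : e.val.1 * e.inv.1 = 1 := congrArg Subtype.val e.val_inv
  have h2 : e.inv.1 * e.val.1 = 1 := congrArg Subtype.val e.inv_val
  have cut : ∀ i j, |P.loc i - P.loc j| ≤ 1 / 30 → (j ∉ P.cutSet ∨ i ∉ P.cutSet) →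
      (i ∈ P.sideSet ↔ j ∈ P.sideSet) := fun i j hij h => by
    constructor
    · intro hi
      by_contra hj
      have := mem_cut_of_abs_sub_le hij hi hj
      exact h.elim (· this.2) (· this.1)
    · intro hj
      by_contra hi
      have := mem_cut_of_abs_sub_le ((abs_sub_comm _ _).trans_le hij) hj hi
      exact h.elim (· this.1) (· this.2)
  refine ⟨⟨?_, ?_, ?_⟩, ?_, ?_⟩
  · change _ * _ = _
    simp only [mul_assoc]
    rw [← mul_assoc e.inv.1, h2, one_mul, ← mul_assoc (coordProj R _),
      (isIdempotentElem_coordProj _).eq]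
  · rw [← mul_assoc, compl_mul_mul_coordProj (he.mono fun i j h hj => cut i j h (Or.inl hj)),
      mul_assoc, mul_assoc, h1, mul_one]
  · rw [mul_assoc e.val.1, mul_assoc e.val.1,
      coordProj_mul_mul_compl (he'.mono fun i j h hi => cut i j h (Or.inr hi)), ← mul_assoc,
      ← mul_assoc, h1, one_mul]
  · exact mul_mem (mul_mem e.val.2 (coordProj_mem_ctlSubring P.smul_mem_sideSet)) e.inv.2
  · refine (SuppIn.comp he' (SuppIn.comp (coordProj_suppIn P.sideSet) he)).mono ?_
    rintro i j ⟨k, hik, l, rfl, hkj⟩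
    exact (abs_sub_le _ (P.loc k) _).trans (by linarith)

namespace IsCutProj

variable {P} {q : Module.End R (I →₀ R)} (h : P.IsCutProj q)

include h

theorem isIdempotentElem_complement : IsIdempotentElem (coordProj R P.cutSet * (1 - q)) :=
  h.agrees.isIdempotentElem_complement (isIdempotentElem_coordProj _) (commute_coordProj _ _)

theorem complement_mem : coordProj R P.cutSet * (1 - q) ∈ ctlSubring R P :=
  mul_mem (coordProj_mem_ctlSubring P.smul_mem_cutSet) (sub_mem (one_mem _) h.mem)

/-- This makes the complement fit to be stacked on the tower: its entries are too short to join
different components of `cutSet`. -/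
theorem complement_suppIn : SuppIn (coordProj R P.cutSet * (1 - q)) fun i j =>
    i ∈ P.cutSet ∧ j ∈ P.cutSet ∧ P.cutCenter.toFun i = P.cutCenter.toFun j := by
  have h1 : SuppIn (1 - q) fun i j => |P.loc i - P.loc j| ≤ 1 / 15 := by
    have e : (1 - q : Module.End R (I →₀ R)) = 1 + -q := sub_eq_add_neg (1 : Module.End R _) q
    rw [e]
    exact SuppIn.add (.refl fun i => by simp) h.small.neg
  rw [← h.agrees.complement_mul_right (isIdempotentElem_coordProj _) (commute_coordProj _ _)]
  refine (mul_coordProj_suppIn (coordProj_mul_suppIn h1 _) _).mono ?_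
  rintro i j ⟨hi, hj, hij⟩
  exact ⟨hi, hj, P.cutCenter_eq hi hj hij⟩

theorem diag_complement_mem :
    Tower.diag (fun _ => coordProj R P.cutSet * (1 - q)) ∈ ctlSubring R (P.tower P.cutCenter) :=
  diag_mem_ctlSubring _ (mem_ctlSubring.1 h.complement_mem).squeezing
    (fun _ => (mem_ctlSubring.1 h.complement_mem).equivariant)
    fun _ i j hij => ⟨hij, Or.inr (h.complement_suppIn i j hij).2.2⟩

theorem isIdempotentElem_diag_complement :
    IsIdempotentElem (⟨_, h.diag_complement_mem⟩ : ctlSubring R (P.tower P.cutCenter)) := by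
  have e : Tower.diag (fun _ : ℤ => coordProj R P.cutSet * (1 - q)) *
      Tower.diag (fun _ : ℤ => coordProj R P.cutSet * (1 - q)) =
        Tower.diag fun _ : ℤ => coordProj R P.cutSet * (1 - q) := by
    rw [Tower.diag_mul_diag, h.isIdempotentElem_complement.eq]
  exact Subtype.ext e

theorem commute_shiftUnit_diag_complement :
    Commute (P.shiftUnit R P.cutCenter : ctlSubring R (P.tower P.cutCenter))
      ⟨_, h.diag_complement_mem⟩ := by
  have e : Tower.shift R I 1 * Tower.diag (fun _ : ℤ => coordProj R P.cutSet * (1 - q)) =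
      Tower.diag (fun _ : ℤ => coordProj R P.cutSet * (1 - q)) * Tower.shift R I 1 :=
    Tower.shift_mul_diag 1 _
  exact Subtype.ext e

/-- The controlled automorphism of the tower which shifts the complement of the image of `q`. -/
def bassUnit : (ctlSubring R (P.tower P.cutCenter))ˣ :=
  Units.bass (P.shiftUnit R P.cutCenter) ⟨_, h.diag_complement_mem⟩
    h.isIdempotentElem_diag_complement h.commute_shiftUnit_diag_complement

theorem bassUnit_mul_ray :
    h.bassUnit.val.1 * Tower.ray (coordProj R P.cutSet)
        (coordProj R P.cutSet + (1 - coordProj R P.cutSet) * coordProj R P.sideSet) =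
      Tower.ray (coordProj R P.cutSet) q * h.bassUnit.val.1 :=
  Tower.shift_add_mul_ray h.agrees (isIdempotentElem_coordProj _) (commute_coordProj _ _)

/-- The shift by `k` covers `bassUnit` and its inverse together. -/
theorem shift_mul_diag_complement_mem (k : ℤ) :
    1 - Tower.diag (fun _ => coordProj R P.cutSet * (1 - q)) +
      Tower.shift R I k * Tower.diag (fun _ => coordProj R P.cutSet * (1 - q)) ∈
        suppSubring R P.cutRel := by
  have h1 : SuppIn (Tower.diag fun _ : ℤ => coordProj R P.cutSet * (1 - q)) P.cutRel :=
    (Tower.diag_suppIn fun _ => h.complement_suppIn).mono fun _ _ hab => Or.inr hab.2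
  refine (suppSubring R P.cutRel).add_mem
    ((suppSubring R P.cutRel).sub_mem (suppSubring R P.cutRel).one_mem h1) ?_
  refine (SuppIn.comp (Tower.diag_suppIn fun _ => h.complement_suppIn)
    (Tower.shift_suppIn k)).mono ?_
  rintro a b ⟨c, ⟨-, h1, h2, h3⟩, h4, -⟩
  exact Or.inr (h4 ▸ ⟨h1, h2, h3⟩)

theorem bassUnit_val_mem : h.bassUnit.val.1 ∈ suppSubring R P.cutRel :=
  h.shift_mul_diag_complement_mem 1

theorem bassUnit_inv_mem : h.bassUnit.inv.1 ∈ suppSubring R P.cutRel :=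
  h.shift_mul_diag_complement_mem (-1)

end IsCutProj

variable (R) in
/-- The projection of the tower to the basis elements over `sideSet` on level zero and the basis
elements over `cutSet` on positive levels. -/
def rayProj : ctlSubring R (P.tower P.cutCenter) :=
  ⟨coordProj R (Tower.raySet P.cutSet P.sideSet), coordProj_mem_ctlSubring fun g a =>
    or_congr (and_congr_right fun _ => P.smul_mem_cutSet g a.elt)
      (and_congr_right fun _ => P.smul_mem_sideSet g a.elt)⟩

theorem isIdempotentElem_rayProj : IsIdempotentElem (P.rayProj R) :=
  Subtype.ext (isIdempotentElem_coordProj _)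

/-- The places of the non-zero entries of a small automorphism of the tower which is trivial
outside of `cutSet` on the levels other than zero. -/
def smallRel (a b : Tower ℤ I) : Prop :=
  a = b ∨ ((a.level = 0 ∨ a.elt ∈ P.cutSet) ∧ (b.level = 0 ∨ b.elt ∈ P.cutSet) ∧
    |(P.tower P.cutCenter).loc a - (P.tower P.cutCenter).loc b| ≤ 1 / 10)

theorem onLevels_suppIn {x : Module.End R (I →₀ R)}
    (hx : SuppIn x fun i j => |P.loc i - P.loc j| ≤ 1 / 30) :
    SuppIn (Tower.onLevels (· = (0 : ℤ)) x) fun a b => a = b ∨ (a.level = 0 ∧ b.level = 0 ∧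
      |(P.tower P.cutCenter).loc a - (P.tower P.cutCenter).loc b| ≤ 1 / 30) := by
  refine (Tower.diag_suppIn (r := fun m i j => i = j ∨ (m = 0 ∧ |P.loc i - P.loc j| ≤ 1 / 30))
    fun m => ?_).mono ?_
  · split_ifs with hm
    · exact hx.mono fun i j h => Or.inr ⟨hm, h⟩
    · exact SuppIn.refl fun _ => Or.inl rfl
  · rintro ⟨m, i⟩ ⟨n, j⟩ ⟨h1, h2⟩
    dsimp only at h1 h2
    subst h1
    obtain rfl | ⟨rfl, h2⟩ := h2
    · exact Or.inl rfl
    · refine Or.inr ⟨rfl, rfl, ?_⟩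
      rwa [tower_loc, tower_loc, towerLoc_zero, towerLoc_zero]

/-- The constant 1/10 of `smallRel` is 1/30 for the given automorphism plus 1/15 for the correction
near the cut points. -/
theorem smallRel_of_level_of_cutRel {a b c : Tower ℤ I}
    (h : a = b ∨ (a.level = 0 ∧ b.level = 0 ∧
      |(P.tower P.cutCenter).loc a - (P.tower P.cutCenter).loc b| ≤ 1 / 30))
    (h' : P.cutRel b c) : P.smallRel a c := by
  have h'' := P.abs_loc_sub_loc_le_of_cutRel h'
  obtain rfl | ⟨h1, h2, h3⟩ := h <;> obtain rfl | ⟨h4, h5, -⟩ := h'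
  · exact Or.inl rfl
  · exact Or.inr ⟨Or.inr h4, Or.inr h5, h''.trans (by norm_num)⟩
  · exact Or.inr ⟨Or.inl h1, Or.inl h2, h3.trans (by norm_num)⟩
  · exact Or.inr ⟨Or.inl h1, Or.inr h5,
      (abs_sub_le _ ((P.tower P.cutCenter).loc b) _).trans (by linarith)⟩

theorem smallRel_symm {a b : Tower ℤ I} (h : P.smallRel a b) : P.smallRel b a := by
  obtain rfl | ⟨h1, h2, h3⟩ := h
  · exact Or.inl rfl
  · exact Or.inr ⟨h2, h1, by rwa [abs_sub_comm]⟩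

/-- The radius 17/60 = 1/4 + 1/30 accommodates the pieces together with the neighbourhoods of the
cut points bounding them. -/
theorem loc_mem_of_mem_raySet {a : Tower ℤ I} (h : a ∈ Tower.raySet P.cutSet P.sideSet) :
    (P.tower P.cutCenter).loc a ∈ nearLattice 0 1 (17 / 60) := by
  rw [tower_loc]
  obtain ⟨-, h⟩ | ⟨h0, h⟩ := h
  · exact nearLattice_mono (by norm_num) (mem_nearLattice_zero_of_mem_cut
      (P.towerLoc_mem_cut h a.level))
  · rw [h0, towerLoc_zero]
    exact nearLattice_mono (by norm_num) h

/-- The hypothesis `h'` leaves out elements off `cutSet` on nonzero levels; they can lie anywhere,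
but `smallRel` relates them only to themselves. -/
theorem loc_mem_of_notMem_raySet {a : Tower ℤ I} (h : a ∉ Tower.raySet P.cutSet P.sideSet)
    (h' : a.level = 0 ∨ a.elt ∈ P.cutSet) :
    (P.tower P.cutCenter).loc a ∈ nearLattice (1 / 2) 1 (17 / 60) := by
  rw [tower_loc]
  by_cases ha : a.elt ∈ P.cutSet
  · exact nearLattice_mono (by norm_num) (mem_nearLattice_half_of_mem_cut
      (P.towerLoc_mem_cut ha a.level))
  · have h0 := h'.resolve_right ha
    rw [h0, towerLoc_zero]
    exact nearLattice_mono (by norm_num) (mem_nearLattice_half_of_notMem fun hs =>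
      h (Or.inr ⟨h0, hs⟩))

/-- An automorphism of a placement over a cover of the line which moves basis elements by at most
`1/30` has trivial class in `K₁`. -/
theorem Framing.cls_eq_zero_of_small {A : ObsCat R G p} (a : P.Framing A) (e : (ctlSubring R P)ˣ)
    (he : SuppIn e.val.1 fun i j => |P.loc i - P.loc j| ≤ 1 / 30)
    (he' : SuppIn e.inv.1 fun i j => |P.loc i - P.loc j| ≤ 1 / 30) : a.cls e = 0 := by
  have hQ := P.isCutProj_conj e he he'
  have hS := P.isCutProj_sideSet (R := R)
  have hinv : e.inv.1 * e.val.1 = 1 := congrArg Subtype.val e.inv_val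
  let T := P.tower P.cutCenter
  let b := T.framing R
  let α := levelUnit P.cutCenter (· = 0) e (fun _ h => Or.inl h) fun _ h => Or.inl h
  -- Both units start from the same projection, so `γ` conjugates the extended q to the extended π,
  -- undoing the effect of `α`.
  let γ := hS.bassUnit * hQ.bassUnit⁻¹
  let β := γ * α
  let x := P.rayProj R
  have hx : IsIdempotentElem x := P.isIdempotentElem_rayProj
  have hβx : Commute (β : ctlSubring R T) x := by
    have key := commute_mul_mul_of_conj (congrArg Subtype.val hQ.bassUnit.val_inv)
      (congrArg Subtype.val hQ.bassUnit.inv_val) hQ.bassUnit_mul_ray hS.bassUnit_mul_ray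
      (Tower.onLevels_mul_ray (χ := coordProj R P.cutSet) (π := coordProj R P.sideSet)
        (q := e.val.1 * coordProj R P.sideSet * e.inv.1) (x := e.val.1) (by
          rw [mul_assoc, hinv, mul_one]))
    rw [← Tower.coordProj_raySet] at key
    exact Subtype.ext key
  have hγ : γ.val.1 ∈ suppSubring R P.cutRel := mul_mem hS.bassUnit_val_mem hQ.bassUnit_inv_mem
  have hγ' : γ.inv.1 ∈ suppSubring R P.cutRel := mul_mem hQ.bassUnit_val_mem hS.bassUnit_inv_mem
  have hβ : SuppIn β.val.1 P.smallRel :=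
    (SuppIn.comp (P.onLevels_suppIn he) hγ).mono fun _ _ ⟨_, h, h'⟩ =>
      P.smallRel_of_level_of_cutRel h h'
  have hβ' : SuppIn β.inv.1 P.smallRel := by
    refine (SuppIn.comp hγ' (P.onLevels_suppIn he')).mono ?_
    rintro c d ⟨k, h, h'⟩
    refine P.smallRel_symm (P.smallRel_of_level_of_cutRel ?_ (P.cutRel.symm' h))
    obtain rfl | ⟨h1, h2, h3⟩ := h'
    · exact Or.inl rfl
    · exact Or.inr ⟨h2, h1, by rwa [abs_sub_comm]⟩
  have hy : IsIdempotentElem (1 - x) := hx.one_sub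
  have hβy : Commute (β : ctlSubring R T) (1 - x) := (Commute.one_right _).sub_right hβx
  have hxc : (1 - x : ctlSubring R T).1 =
      coordProj R (Tower.raySet P.cutSet P.sideSet)ᶜ := one_sub_coordProj _
  have zero_γ : b.cls γ = 0 := by
    -- The swindle for `γ` takes place on a second tower, built over `T`, with the centers of the
    -- underlying elements.
    let c : T.Center :=
      { toFun d := P.cutCenter.toFun d.elt
        map_smul g d := P.cutCenter.map_smul g d.elt
        abs_sub_le d := by
          rw [tower_loc]
          exact (P.abs_towerLoc_sub_center_le _ _ _).trans (P.cutCenter.abs_sub_le _) }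
    have hc : ∀ d d', P.cutRel d d' → c.toFun d = c.toFun d' := by
      rintro d d' (rfl | ⟨-, -, h⟩)
      · rfl
      · exact h
    exact cls_eq_zero_of_center c b γ (hγ.mono hc) (hγ'.mono hc)
  have zero_x : b.cls (β.restrict x hx hβx) = 0 := by
    -- The image of `x` lies near the integers, and 2 · 17/60 + 1/10 = 2/3 < 1, so entries of length
    -- 1/10 cannot join different pieces. The kernel is treated alike around the half-integers.
    let c : T.Center := T.snapCenter 0 1 (17 / 60) (by norm_num) (by norm_num) (by norm_num)
      ⟨1, by norm_num⟩ ⟨0, by norm_num⟩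
    have hc : ∀ d d', d = d' ∨ (d ∈ Tower.raySet P.cutSet P.sideSet ∧
        d' ∈ Tower.raySet P.cutSet P.sideSet ∧ P.smallRel d d') → c.toFun d = c.toFun d' := by
      rintro d d' (rfl | ⟨h1, h2, rfl | ⟨-, -, h3⟩⟩)
      · rfl
      · rfl
      · exact snap_eq_snap (by norm_num) (P.loc_mem_of_mem_raySet h1)
          (P.loc_mem_of_mem_raySet h2) h3
    exact cls_eq_zero_of_center c b _
      ((restrict_suppIn hβ (congrArg Subtype.val hβx)).mono hc)
      ((restrict_suppIn hβ' (congrArg Subtype.val hβx.units_inv_left)).mono hc)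
  have zero_y : b.cls (β.restrict (1 - x) hy hβy) = 0 := by
    let c : T.Center := T.snapCenter (1 / 2) 1 (17 / 60) (by norm_num) (by norm_num) (by norm_num)
      ⟨1, by norm_num⟩ ⟨1, by norm_num⟩
    have hc : ∀ d d', d = d' ∨ (d ∈ (Tower.raySet P.cutSet P.sideSet)ᶜ ∧
        d' ∈ (Tower.raySet P.cutSet P.sideSet)ᶜ ∧ P.smallRel d d') →
        c.toFun d = c.toFun d' := by
      rintro d d' (rfl | ⟨h1, h2, rfl | ⟨h3, h4, h5⟩⟩)
      · rfl
      · rfl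
      · exact snap_eq_snap (by norm_num) (P.loc_mem_of_notMem_raySet h1 h3)
          (P.loc_mem_of_notMem_raySet h2 h4) h5
    have h1 : Commute β.val.1 (coordProj R (Tower.raySet P.cutSet P.sideSet)ᶜ) := by
      rw [← hxc]; exact congrArg Subtype.val hβy
    have h2 : Commute β.inv.1 (coordProj R (Tower.raySet P.cutSet P.sideSet)ᶜ) := by
      rw [← hxc]; exact congrArg Subtype.val hβy.units_inv_left
    have s1 := (restrict_suppIn hβ h1).mono hc
    have s2 := (restrict_suppIn hβ' h2).mono hc
    rw [← hxc] at s1 s2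
    exact cls_eq_zero_of_center c b _ s1 s2
  have h1 : b.cls β = 0 := by
    rw [← β.restrict_mul_restrict x (1 - x) hx hβx hy hβy (add_sub_cancel _ _), cls_mul, zero_x,
      zero_y, add_zero]
  have h2 : b.cls β = b.cls γ + b.cls α := b.cls_mul γ α
  rw [h1, zero_γ, zero_add] at h2
  exact (cls_tower_eq P.cutCenter a b e α rfl).symm.trans h2.symm

end Placement

/-- An automorphism in the obstruction category of a cover of the line has trivial class in `K₁`
if it is a `1/30`-automorphism. -/
theorem ObsCat.mk_eq_zero_of_isEpsAutomorphism {R : Type u} [Ring R] {G : Type*} [Group G]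
    [MulAction G ℝ] {Xbar : Type} [TopologicalSpace Xbar] [MulAction G Xbar] (p : Xbar → ℝ)
    [LineCover G p] (A : ObsCat R G p) (α : Aut A) (h : ObsCat.IsEpsAutomorphism (1 / 30) α) :
    AddK1.mk α = 0 := by
  obtain ⟨e, rfl, he, he'⟩ := A.framing.exists_unit_of_bounded α (1 / 30)
    (ObsCat.abs_le_of_hsize_lt h.1) (ObsCat.abs_le_of_hsize_lt h.2)
  exact A.framing.cls_eq_zero_of_small A.placement e he he'

/-! ### The two covers -/

theorem isCompact_abs_le (B : ℝ) : IsCompact {x : ℝ | |x| ≤ B} := by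
  convert isCompact_Icc (a := -B) (b := B) using 1
  ext x
  exact abs_le (a := x) (b := B)

instance CyclicT.lineCover : LineCover CyclicT (id : ℝ → ℝ) where
  continuous := continuous_id
  isCompact := isCompact_abs_le
  map_smul _ _ := rfl
  free g x h := by
    have h' : x + ((Multiplicative.toAdd g : ℤ) : ℝ) = x := h
    rw [add_eq_left, Int.cast_eq_zero] at h'
    exact Multiplicative.toAdd.injective h'
  move _ y := y
  map_move _ _ := rfl
  move_map _ := rfl
  smul_move _ _ _ := rfl
  smul_eq g := Or.inl ⟨Multiplicative.toAdd g, fun _ => rfl⟩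
  exists_translation n := ⟨Multiplicative.ofAdd n, fun _ => rfl⟩

instance DInf.lineCover : LineCover DInf (Prod.snd : ZMod 2 × ℝ → ℝ) where
  continuous := continuous_snd
  isCompact B := by
    convert (isCompact_univ (X := ZMod 2)).prod (isCompact_abs_le B) using 1
    ext x
    simp
  map_smul _ _ := rfl
  free := by
    rintro (i | i) ⟨e, x⟩ h
    · have h' : x + Int.cast (R := ℝ) i = x := congrArg Prod.snd h
      rw [add_eq_left] at h'
      exact congrArg DihedralGroup.r (Int.cast_eq_zero.1 h')
    -- A reflection has a fixed point on the line but exchanges the two elements of ℤ/2.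
    · have h' : e + 1 = e := congrArg Prod.fst h
      rw [add_eq_left] at h'
      exact absurd h' (by decide)
  move x y := (x.1, y)
  map_move _ _ := rfl
  move_map _ := rfl
  smul_move _ _ _ := rfl
  smul_eq := by
    rintro (i | i)
    · exact Or.inl ⟨i, fun _ => rfl⟩
    · refine Or.inr ⟨-i, fun y => ?_⟩
      change -(y + Int.cast (R := ℝ) i) = -y + Int.cast (R := ℝ) (-i)
      have : Int.cast (R := ℝ) (-i) = -Int.cast (R := ℝ) i := Int.cast_neg (R := ℝ) i
      rw [this]
      ring
  exists_translation n := ⟨.r n, fun _ => rfl⟩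

end

theorem theorem4p5 {R : Type*} [Ring R] :
    (∀ (A : ObsCyclic R) (α : Aut A),
      ObsCat.IsEpsAutomorphism (1 / 30) α → AddK1.mk α = (0 : AddK1 (ObsCyclic R))) ∧
    (∀ (A : ObsDihedral R) (α : Aut A),
      ObsCat.IsEpsAutomorphism (1 / 30) α → AddK1.mk α = (0 : AddK1 (ObsDihedral R))) :=
  ⟨ObsCat.mk_eq_zero_of_isEpsAutomorphism _, ObsCat.mk_eq_zero_of_isEpsAutomorphism _⟩
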